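/- **Setting.** Let $\mathbb S^3=\{y\in\mathbb R^4:|y|^2=9\}$ with the induced round metric $\mathring g$ (scalar curvature $2/3$). For $1\le k<l\le 4$ put $\Omega_{kl}=\frac13(y^k\partial_{y^l}-y^l\partial_{y^k})$, and let $\mathscr Z=\{Z_{(1)},Z_{(2)},Z_{(3)}\}$ be the global $\mathring g$-orthonormal frame $Z_{(1)}=\Omega_{12}+\Omega_{34}$, $Z_{(2)}=\Omega_{23}+\Omega_{14}$, $Z_{(3)}=\Omega_{13}-\Omega_{24}$, extended to $[0,T)\times\mathbb S^3$ independently of $t$. For $\vec I=(i_1,\dots,i_N)\in\{1,2,3\}^N$ write $|\vec I|=N$ and $\mathcal L_{\mathscr Z}^{\vec I}=\mathcal L_{Z_{(i_1)}}\cdots\mathcal L_{Z_{(i_N)}}$ (Lie derivatives on $\Sigma_t=\{t\}\times\mathbb S^3$; for functions write $\mathscr Z^{\vec I}$). $\mathcal L_{\partial_t}$ denotes the $\Sigma_t$-projected Lie derivative, i.e. the $t$-derivative of the components with respect to a $t$-independent frame (one-sided at $t=0$). Let $a$ be the solution of $a''=-\frac23a^{1/3}$, $a(0)=1$, $a'(0)=0$,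 and let $T>0$ be such that $a>0$ on $[0,T)$. Put $\mathcal H=a'/a$. **Solutions.** Let $(g,k,n,\phi)$ be a classical solution on $[0,T)\times\mathbb S^3$ of the Einstein-scalar field equations for the space-time metric $-n^2dt^2+g$ in constant-mean-curvature-transported spatial coordinates gauge: $g$ is a Riemannian metric on each $\Sigma_t$, $k=k^i{}_j$ is the second fundamental form in mixed form, $n>0$; $g,\phi$ are $C^{17}$, $k$ is $C^{16}$, $n$ is $C^{18}$; and, with $\hat k$ the trace-free part of $k$ and $\nabla$, $\mathrm{Ric}[g]$, $R[g]$ the connection and curvatures of $g$ (positive on round spheres), indices being moved with $g$, $$k^a{}_a=-\mathcal H,\qquad R[g]-k^a{}_bk^b{}_a+\mathcal H^2=(n^{-1}\partial_t\phi)^2+\nabla^a\phi\nabla_a\phi,\qquad \nabla_a\hat k^a{}_i=-n^{-1}\partial_t\phi\,\nabla_i\phi,$$ $$\partial_tg_{ij}=-2n\,g_{ia}k^a{}_j,\qquad \partial_tk^i{}_j=-\nabla^i\nabla_jn+n\{\mathrm{Ric}[g]^i{}_j-\mathcal Hk^i{}_j-\nabla^i\phi\nabla_j\phi\},$$ $$-n^{-1}\partial_t(n^{-1}\partial_t\phi)+\nabla^a\nabla_a\phi=\mathcal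 Hn^{-1}\partial_t\phi-n^{-1}\nabla^an\nabla_a\phi,$$ $$\nabla^a\nabla_an=\mathcal H'+n\{\hat k^a{}_b\hat k^b{}_a+\tfrac13\mathcal H^2+(n^{-1}\partial_t\phi)^2\}.$$ **Rescaled variables.** $G=a^{-2/3}g$, $K=a\hat k$ (type $\binom11$), $\nu=a^{-4/3}(n-1)$, $\Psi=n^{-1}a\,\partial_t\phi-\sqrt{2/3}$, $\omega=\nabla\phi$ (the spatial one-form $d\phi|_{\Sigma_t}$); $\mathrm{Ric}^\#$ is the Ricci tensor of $G$ with one index raised by $G^{-1}$, and $\mathrm{Id}$ the identity. **Norms.** For $h\in\{\mathring g,G\}$ let $|\xi|_h$ be the pointwise norm of a tensor and $\|\xi\|_{C^0_h(\Sigma_t)}=\sup_{\Sigma_t}|\xi|_h$. Put $\|\mathcal L_{\mathscr Z}^{\le M}\xi\|_{C_h^0}=\sum_{|\vec I|\le M}\sup_{\Sigma_t}|\mathcal L^{\vec I}_{\mathscr Z}\xi|_h$, $\|\mathcal L_{\mathscr Z}^{[1,M]}\xi\|_{C_h^0}=\sum_{1\le|\vec I|\le M}\sup_{\Sigma_t}|\mathcal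 L^{\vec I}_{\mathscr Z}\xi|_h$, $\|\mathcal L_{\partial_t}\mathcal L_{\mathscr Z}^{\le M}\xi\|_{C_h^0}=\sum_{|\vec I|\le M}\sup_{\Sigma_t}|\mathcal L_{\partial_t}\mathcal L^{\vec I}_{\mathscr Z}\xi|_h$. Further, with the volume measure of $\mathring g$, $\|\xi\|_{H^M}^2=\sum_{|\vec I|\le M}\big\||\mathcal L^{\vec I}_{\mathscr Z}\xi|_{\mathring g}\big\|_{L^2}^2$, $\|\xi\|_{\dot H^M}^2$ is the same sum over $|\vec I|=M$, and $\|\xi\|_{C^M}^2=\sum_{|\vec I|\le M}\sup|\mathcal L^{\vec I}_{\mathscr Z}\xi|^2_{\mathring g}$. The solution norm is $$\begin{aligned}\mathcal N(t)=\;&\|K\|_{H^{16}}+a^{2/3}\|G\|_{\dot H^{17}}+\|G-\mathring g\|_{H^{16}}+\|G^{-1}-\mathring g^{-1}\|_{H^{16}}+\sum_{L=1}^4a^{2L/3}\|\nu\|_{\dot H^{14+L}}+\|\nu\|_{H^{14}}\\&+\|\Psi\|_{H^{16}}+a^{2/3}\|\omega\|_{H^{16}}+\|\omega\|_{H^{15}}+\|K\|_{C^{14}}+\|G-\mathring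 g\|_{C^{14}}+\|G^{-1}-\mathring g^{-1}\|_{C^{14}}\\&+\|\nu\|_{C^{12}}+\|\Psi\|_{C^{14}}+\|\omega\|_{C^{13}},\end{aligned}$$ all evaluated on $\Sigma_t$. **Proposition (strong sup-norm estimates).** There are constants $\varepsilon_0,\sigma_0,C,c>0$ such that the following holds whenever $0<\varepsilon\le\varepsilon_0$ and $\sqrt\varepsilon\le\sigma\le\sigma_0$, for all $T$ and all solutions as above (the constants do not depend on $\varepsilon$, $\sigma$, $T$ or the solution). If $\mathcal N(0)\le\varepsilon^2$ and $\mathcal N(t)\le\varepsilon a^{-\sigma}(t)$ for all $t\in[0,T)$, then for all $t\in[0,T)$, all norms being taken on $\Sigma_t$ and $a=a(t)$: 1. $\|\mathcal L_{\mathscr Z}^{\le10}(G-\mathring g)\|_{C^0_{\mathring g}}\le C\sqrt\varepsilon\,a^{-c\sqrt\varepsilon}$; 2. $\|\mathcal L_{\mathscr Z}^{\le10}(G^{-1}-\mathring g^{-1})\|_{C^0_{\mathring g}}\le C\sqrt\varepsilon\,a^{-c\sqrt\varepsilon}$; 3. $\|\mathcal L_{\mathscr Z}^{\le10}(G-\mathring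 g)\|_{C^0_{G}}\le C\sqrt\varepsilon\,a^{-c\sqrt\varepsilon}$; 4. $\|\mathcal L_{\mathscr Z}^{\le10}(G^{-1}-\mathring g^{-1})\|_{C^0_{G}}\le C\sqrt\varepsilon\,a^{-c\sqrt\varepsilon}$; 5. $\|\mathcal L_{\partial_t}G\|_{C^0_G}\le C\varepsilon a^{-1}$; 6. $\|\mathcal L_{\partial_t}G^{-1}\|_{C^0_G}\le C\varepsilon a^{-1}$; 7. $\|\mathcal L_{\mathscr Z}^{\le10}K\|_{C^0_{\mathring g}}\le C\varepsilon$; 8. $\|\mathcal L_{\partial_t}\mathcal L_{\mathscr Z}^{\le10}K\|_{C^0_{\mathring g}}\le C\varepsilon a^{1/3-c\sigma}$; 9. $\|K\|_{C^0_G}\le C\varepsilon$; 10. $\|\mathcal L_{\mathscr Z}^{[1,10]}K\|_{C^0_G}\le C\varepsilon a^{-c\sqrt\varepsilon}$; 11. $\|\mathscr Z^{\le10}\Psi\|_{C^0}\le C\varepsilon$; 12. $\|\partial_t\mathscr Z^{\le10}\Psi\|_{C^0}\le C\varepsilon a^{1/3-c\sigma}$; 13. $\|\mathcal L_{\mathscr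 Z}^{\le9}\omega\|_{C^0_G}\le C\sqrt\varepsilon\,a^{-c\sqrt\varepsilon}$; 14. $\|\mathscr Z^{\le8}\nu\|_{C^0}\le C\sqrt\varepsilon\,a^{-c\sqrt\varepsilon}$; 15. $\|\mathcal L_{\mathscr Z}^{\le8}\{\mathrm{Ric}^\#-\tfrac29\mathrm{Id}\}\|_{C^0_G}\le C\sqrt\varepsilon\,a^{-c\sqrt\varepsilon}$. -/

import Mathlib

open Set MeasureTheory

namespace EinsteinScalar

noncomputable section

/-! ### The three-sphere of radius `3` and its rotation frame -/

/-- The ambient Euclidean space `ℝ⁴`, with coordinates `y 0, y 1, y 2, y 3`. -/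
abbrev E4 : Type := EuclideanSpace ℝ (Fin 4)

/-- The sphere `{y ∈ ℝ⁴ : |y|² = 9}`; the metric induced by `ℝ⁴` has scalar curvature `2/3`. -/
abbrev S3 : Type := Metric.sphere (0 : E4) 3

/-- The point `3 • ω` of the sphere of radius `3`, for `ω` on the unit sphere. -/
def tripleUnit (ω : Metric.sphere (0 : E4) 1) : S3 :=
  ⟨(3 : ℝ) • (ω : E4), by
    have h : ‖(ω : E4)‖ = 1 := by simp
    simp [norm_smul, h]⟩

/-- The volume measure of the round metric of radius `3`: the push-forward of `3³` times the
surface measure of the unit sphere. -/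
def roundVolume : Measure S3 :=
  (27 : ENNReal) • ((volume : Measure E4).toSphere.map tripleUnit)

/-- The radial projection `y ↦ 3 y / |y|` of `ℝ⁴ \ {0}` to the sphere (an arbitrary value at
the origin, which plays no role). -/
def radial (y : E4) : S3 :=
  if h : y = 0 then
    ⟨EuclideanSpace.single 0 3, by simp⟩
  else
    ⟨(3 / ‖y‖) • y, by
      have h' : ‖y‖ ≠ 0 := norm_ne_zero_iff.mpr h
      simp [norm_smul, h']⟩

/-- The rotation vector field `(1/3) (yᵏ ∂_l - yˡ ∂_k)`. -/
def Rot (k l : Fin 4) (y : E4) : E4 :=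
  (1 / 3 : ℝ) • (y k • EuclideanSpace.single l (1 : ℝ) - y l • EuclideanSpace.single k (1 : ℝ))

/-- The frame `Z₁ = Ω₁₂ + Ω₃₄`, `Z₂ = Ω₂₃ + Ω₁₄`, `Z₃ = Ω₁₃ - Ω₂₄` (indices shifted by one). -/
def Z (A : Fin 3) (y : E4) : E4 :=
  ![Rot 0 1 y + Rot 2 3 y, Rot 1 2 y + Rot 0 3 y, Rot 0 2 y - Rot 1 3 y] A

/-- The totally antisymmetric symbol with `ε₁₂₃ = 1`. -/
def eps (A B C : Fin 3) : ℝ :=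
  (((B : ℕ) : ℝ) - ((A : ℕ) : ℝ)) * (((C : ℕ) : ℝ) - ((B : ℕ) : ℝ)) *
    (((C : ℕ) : ℝ) - ((A : ℕ) : ℝ)) / 2

/-- The structure constants of the frame, `[Z_A, Z_B] = ∑ C, structConst A B C • Z_C`;
see `lieBracket_Z`. -/
def structConst (A B C : Fin 3) : ℝ := (2 / 3) * eps A B C

/-- The frame is tangent to the sphere. -/
theorem inner_self_Z (A : Fin 3) (y : E4) : inner ℝ y (Z A y) = 0 := by
  fin_cases A <;> simp [Z, Rot, PiLp.inner_apply, Fin.sum_univ_four] <;> ring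

/-- The frame is orthonormal for the round metric, so that in this frame the round metric and
its inverse both have the identity matrix as matrix of components. -/
theorem inner_Z_Z (A B : Fin 3) (p : S3) :
    inner ℝ (Z A (p : E4)) (Z B (p : E4)) = if A = B then 1 else 0 := by
  have hp : ‖(p : E4)‖ = 3 := by simp
  have h9 : (p : E4) 0 ^ 2 + (p : E4) 1 ^ 2 + (p : E4) 2 ^ 2 + (p : E4) 3 ^ 2 = 9 := by
    have := EuclideanSpace.norm_sq_eq (p : E4)
    rw [hp, Fin.sum_univ_four] at this
    simp only [Real.norm_eq_abs, sq_abs] at this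
    linarith
  rw [PiLp.inner_apply, Fin.sum_univ_four]
  fin_cases A <;> fin_cases B <;> simp [Z, Rot] <;>
    first
    | (ring; done)
    | (simp only [mul_pow, sq_abs]; linear_combination (1 / 9 : ℝ) * h9)

/-- The frame fields are linear vector fields on `ℝ⁴`. -/
def ZLin (A : Fin 3) : E4 →ₗ[ℝ] E4 where
  toFun := Z A
  map_add' x y := by
    fin_cases A <;> ext i <;> fin_cases i <;> simp [Z, Rot] <;> ring
  map_smul' r y := by
    fin_cases A <;> ext i <;> fin_cases i <;> simp [Z, Rot] <;> ring

/-- The commutation relations of the frame. -/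
theorem lieBracket_Z (A B : Fin 3) (y : E4) :
    VectorField.lieBracket ℝ (Z A) (Z B) y = ∑ C, structConst A B C • Z C y := by
  have hd : ∀ (A : Fin 3) (y : E4), fderiv ℝ (Z A) y = LinearMap.toContinuousLinearMap (ZLin A) :=
    fun A y => (LinearMap.toContinuousLinearMap (ZLin A)).hasFDerivAt.fderiv
  have hz : ∀ (A : Fin 3) (v : E4), LinearMap.toContinuousLinearMap (ZLin A) v = Z A v :=
    fun _ _ => rfl
  simp only [VectorField.lieBracket, hd, hz]
  fin_cases A <;> fin_cases B <;> ext i <;> fin_cases i <;>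
    simp [Z, Rot, structConst, eps, Fin.sum_univ_three] <;> ring

/-! ### Tensor fields, differentiation, norms

The frame `Z` is global, so a tensor field of type `(l, m)` on the sphere is the family of its
components `ξ^{A₁ ⋯ A_l}_{B₁ ⋯ B_m}` with respect to `Z` and the dual coframe. -/

/-- Tensor fields of type `(l, m)` on the sphere. -/
abbrev Tensor (l m : ℕ) : Type := (Fin l → Fin 3) → (Fin m → Fin 3) → S3 → ℝ

/-- Fields of `3 × 3` matrices of frame components (of a tensor with two indices). -/
abbrev MatrixField : Type := S3 → Matrix (Fin 3) (Fin 3) ℝ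

/-- The scalar function `f` as a tensor field of type `(0, 0)`. -/
def scalarT (f : S3 → ℝ) : Tensor 0 0 := fun _ _ p => f p

/-- The one-form with components `ω_A`. -/
def formT (ω : Fin 3 → S3 → ℝ) : Tensor 0 1 := fun _ B p => ω (B 0) p

/-- The tensor field of type `(0, 2)` with components `h_{AB} = h p A B`. -/
def covT (h : MatrixField) : Tensor 0 2 := fun _ B p => h p (B 0) (B 1)

/-- The tensor field of type `(2, 0)` with components `h^{AB} = h p A B`. -/
def contraT (h : MatrixField) : Tensor 2 0 := fun A _ p => h p (A 0) (A 1)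

/-- The tensor field of type `(1, 1)` with components `k^A_B = k p A B`. -/
def mixedT (k : MatrixField) : Tensor 1 1 := fun A B p => k p (A 0) (B 0)

/-- The derivative `Z_A f` of a function on the sphere. -/
def Zder (A : Fin 3) (f : S3 → ℝ) (p : S3) : ℝ :=
  fderiv ℝ (fun y : E4 => f (radial y)) (p : E4) (Z A (p : E4))

/-- The Lie derivative along `Z_C`, from the Leibniz rule and
`𝓛_{Z_C} Z_B = c_{CB}^D Z_D`, `𝓛_{Z_C} θ^A = - c_{CD}^A θ^D`. -/
def lieZ {l m : ℕ} (C : Fin 3) (ξ : Tensor l m) : Tensor l m := fun A B p =>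
  Zder C (ξ A B) p
    + ∑ i : Fin l, ∑ D : Fin 3, structConst C D (A i) * ξ (Function.update A i D) B p
    - ∑ j : Fin m, ∑ D : Fin 3, structConst C (B j) D * ξ A (Function.update B j D) p

/-- The iterated Lie derivative `𝓛_{Z_{i₁}} ⋯ 𝓛_{Z_{i_N}} ξ`. -/
def lieI {l m N : ℕ} (I : Fin N → Fin 3) (ξ : Tensor l m) : Tensor l m :=
  (List.ofFn I).foldr lieZ ξ

/-- The time derivative (one-sided at `0`) on `[0, T)`. As the frame and coframe do not depend
on `t`, these are the components of the projected Lie derivative along `∂_t`. -/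
def timeDeriv {l m : ℕ} (T : ℝ) (ξ : ℝ → Tensor l m) (t : ℝ) : Tensor l m :=
  fun A B p => derivWithin (fun s => ξ s A B p) (Ico 0 T) t

/-- The pointwise norm `|ξ|_h` at `p`, for a metric `h`. -/
def pnorm {l m : ℕ} (h : MatrixField) (ξ : Tensor l m) (p : S3) : ℝ :=
  Real.sqrt (∑ A : Fin l → Fin 3, ∑ A' : Fin l → Fin 3, ∑ B : Fin m → Fin 3, ∑ B' : Fin m → Fin 3,
    (∏ i, h p (A i) (A' i)) * (∏ j, (h p)⁻¹ (B j) (B' j)) * ξ A B p * ξ A' B' p)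

/-- The sup-norm `sup_p |ξ|_h`. -/
def supNorm {l m : ℕ} (h : MatrixField) (ξ : Tensor l m) : ℝ := ⨆ p : S3, pnorm h ξ p

/-- The round metric, in the orthonormal frame `Z`. -/
def St : MatrixField := fun _ => 1

/-- `(∑ ‖𝓛^I ξ‖²_{L²})^{1/2}`, for the round metric, over the multi-indices with order in `s`. -/
def sobolev {l m : ℕ} (s : Finset ℕ) (ξ : Tensor l m) : ℝ :=
  Real.sqrt (∑ N ∈ s, ∑ I : Fin N → Fin 3, ∫ p, (pnorm St (lieI I ξ) p) ^ 2 ∂roundVolume)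

/-- The norm of `H^M`, for the round metric. -/
def normH {l m : ℕ} (M : ℕ) (ξ : Tensor l m) : ℝ := sobolev (Finset.range (M + 1)) ξ

/-- The homogeneous seminorm of order `M` in `L²`, for the round metric. -/
def normHdot {l m : ℕ} (M : ℕ) (ξ : Tensor l m) : ℝ := sobolev {M} ξ

/-- The norm of `C^M`, for the round metric. -/
def normC {l m : ℕ} (M : ℕ) (ξ : Tensor l m) : ℝ :=
  Real.sqrt (∑ N ∈ Finset.range (M + 1), ∑ I : Fin N → Fin 3, (supNorm St (lieI I ξ)) ^ 2)

/-- `∑ sup_p |𝓛^I ξ|_h` over the multi-indices with order in `s`. -/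
def sumSup {l m : ℕ} (h : MatrixField) (s : Finset ℕ) (ξ : Tensor l m) : ℝ :=
  ∑ N ∈ s, ∑ I : Fin N → Fin 3, supNorm h (lieI I ξ)

/-- `∑ sup_p |∂_t 𝓛^I ξ|_h` over the multi-indices with order in `s`. -/
def sumSupDt {l m : ℕ} (T : ℝ) (h : MatrixField) (s : Finset ℕ) (ξ : ℝ → Tensor l m) (t : ℝ) : ℝ :=
  ∑ N ∈ s, ∑ I : Fin N → Fin 3, supNorm h (timeDeriv T (fun r => lieI I (ξ r)) t)

/-! ### Levi-Civita connection and curvature of a metric `h` with components `h p A B` -/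

/-- `Γ_{ACB} = h(∇_{Z_A} Z_B, Z_C)`, by the Koszul formula. -/
def gammaLow (h : MatrixField) (A C B : Fin 3) (p : S3) : ℝ :=
  (1 / 2) * (Zder A (fun q => h q B C) p + Zder B (fun q => h q A C) p
      - Zder C (fun q => h q A B) p
    + ∑ D, structConst A B D * h p D C
    - ∑ D, structConst A C D * h p D B
    - ∑ D, structConst B C D * h p D A)

/-- The connection coefficients: `∇_{Z_A} Z_B = ∑ D, conn h A D B • Z_D`. -/
def conn (h : MatrixField) (A D B : Fin 3) (p : S3) : ℝ :=
  ∑ C, (h p)⁻¹ C D * gammaLow h A C B p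

/-- The components of the covariant derivative `∇_{Z_C} ξ`. -/
def covD {l m : ℕ} (h : MatrixField) (C : Fin 3) (ξ : Tensor l m) : Tensor l m := fun A B p =>
  Zder C (ξ A B) p
    + ∑ i : Fin l, ∑ D : Fin 3, conn h C (A i) D p * ξ (Function.update A i D) B p
    - ∑ j : Fin m, ∑ D : Fin 3, conn h C D (B j) p * ξ A (Function.update B j D) p

/-- The differential of a function, as a one-form: components `Z_A f`. -/
def dT (f : S3 → ℝ) : Tensor 0 1 := formT (fun A => Zder A f)

/-- The Hessian `∇_A ∇_B f`. -/
def hess (h : MatrixField) (f : S3 → ℝ) (A B : Fin 3) (p : S3) : ℝ :=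
  covD h A (dT f) ![] ![B] p

/-- The Laplacian `∇^A ∇_A f`. -/
def lap (h : MatrixField) (f : S3 → ℝ) (p : S3) : ℝ := ∑ A, ∑ B, (h p)⁻¹ A B * hess h f A B p

/-- `∇^A f ∇_A f'`. -/
def gradInner (h : MatrixField) (f f' : S3 → ℝ) (p : S3) : ℝ :=
  ∑ A, ∑ B, (h p)⁻¹ A B * Zder A f p * Zder B f' p

/-- The curvature `R(Z_A, Z_B) Z_C = ∑ D, curv h A B C D • Z_D`, where
`R(X, Y) W = ∇_X ∇_Y W - ∇_Y ∇_X W - ∇_{[X, Y]} W`. -/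
def curv (h : MatrixField) (A B C D : Fin 3) (p : S3) : ℝ :=
  Zder A (conn h B D C) p - Zder B (conn h A D C) p
    + ∑ F, (conn h B F C p * conn h A D F p - conn h A F C p * conn h B D F p)
    - ∑ F, structConst A B F * conn h F D C p

/-- The Ricci tensor `Ric_{BC}`, the trace of `X ↦ R(X, Z_B) Z_C`
(positive on round spheres). -/
def Ric (h : MatrixField) : MatrixField := fun p => Matrix.of fun B C => ∑ A, curv h A B C A p

/-- The Ricci tensor with the first index raised by `h`, `(Ric^#)^A_B`. -/
def RicSharp (h : MatrixField) : MatrixField := fun p => (h p)⁻¹ * Ric h p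

/-- The scalar curvature. -/
def scalarCurv (h : MatrixField) (p : S3) : ℝ := (RicSharp h p).trace

/-! ### The scale factor and the field equations -/

/-- The derivative of a function of time on `[0, T)` (one-sided at `0`). -/
def dt (T : ℝ) (f : ℝ → ℝ) (t : ℝ) : ℝ := derivWithin f (Ico 0 T) t

/-- `a` is, on `[0, T)`, the solution of `a'' = -(2/3) a^{1/3}`, `a(0) = 1`, `a'(0) = 0`, and it
has not vanished before the time `T`. -/
structure IsScaleFactor (T : ℝ) (a : ℝ → ℝ) : Prop where
  init : a 0 = 1
  init_deriv : dt T a 0 = 0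
  pos : ∀ t ∈ Ico 0 T, 0 < a t
  diff : DifferentiableOn ℝ a (Ico 0 T)
  ode : ∀ t ∈ Ico 0 T, HasDerivWithinAt (dt T a) (-(2 / 3) * a t ^ (1 / 3 : ℝ)) (Ico 0 T) t

/-- The Hubble factor `a' / a`. -/
def hubble (T : ℝ) (a : ℝ → ℝ) (t : ℝ) : ℝ := dt T a t / a t

/-- `u` is of class `C^N` on `[0, T) × S³`. -/
def SlabC (N : ℕ) (T : ℝ) (u : ℝ → S3 → ℝ) : Prop :=
  ContDiffOn ℝ N (fun q : ℝ × E4 => u q.1 (radial q.2)) (Ico 0 T ×ˢ {0}ᶜ)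

/-- The trace-free part of a tensor of type `(1, 1)`. -/
def traceFree (k : MatrixField) : MatrixField := fun p => k p - ((1 / 3 : ℝ) * (k p).trace) • 1

/-- `n⁻¹ ∂_t φ`. -/
def normalDeriv (T : ℝ) (n φ : ℝ → S3 → ℝ) (t : ℝ) (p : S3) : ℝ :=
  (n t p)⁻¹ * dt T (fun s => φ s p) t

/-- Classical solutions on `[0, T) × S³` of the Einstein-scalar field equations in
constant-mean-curvature-transported spatial coordinates gauge, normalized by `tr k = - a'/a`.
Here `g t p A B = g_{AB}` is the metric induced on the slice of time `t`, `k t p A B = k^A_B` its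
second fundamental form in mixed form, `n` the lapse, `φ` the scalar field; the space-time metric is
`-n² dt² + g`. -/
structure IsSolution (T : ℝ) (a : ℝ → ℝ) (g k : ℝ → MatrixField) (n φ : ℝ → S3 → ℝ) : Prop where
  reg_g : ∀ A B, SlabC 17 T (fun t p => g t p A B)
  reg_k : ∀ A B, SlabC 16 T (fun t p => k t p A B)
  reg_n : SlabC 18 T n
  reg_φ : SlabC 17 T φ
  metric : ∀ t ∈ Ico 0 T, ∀ p, (g t p).PosDef
  lapse_pos : ∀ t ∈ Ico 0 T, ∀ p, 0 < n t p
  cmc : ∀ t ∈ Ico 0 T, ∀ p, (k t p).trace = - hubble T a t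
  hamiltonian : ∀ t ∈ Ico 0 T, ∀ p,
    scalarCurv (g t) p - (k t p * k t p).trace + hubble T a t ^ 2
      = normalDeriv T n φ t p ^ 2 + gradInner (g t) (φ t) (φ t) p
  momentum : ∀ t ∈ Ico 0 T, ∀ p, ∀ B,
    ∑ A, covD (g t) A (mixedT (traceFree (k t))) ![A] ![B] p
      = - normalDeriv T n φ t p * Zder B (φ t) p
  evol_g : ∀ t ∈ Ico 0 T, ∀ p, ∀ A B,
    dt T (fun s => g s p A B) t = -2 * n t p * ∑ C, g t p A C * k t p C B
  evol_k : ∀ t ∈ Ico 0 T, ∀ p, ∀ A B,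
    dt T (fun s => k s p A B) t
      = - ∑ C, (g t p)⁻¹ A C * hess (g t) (n t) C B p
        + n t p * (RicSharp (g t) p A B - hubble T a t * k t p A B
          - (∑ C, (g t p)⁻¹ A C * Zder C (φ t) p) * Zder B (φ t) p)
  wave : ∀ t ∈ Ico 0 T, ∀ p,
    - (n t p)⁻¹ * dt T (fun s => normalDeriv T n φ s p) t + lap (g t) (φ t) p
      = hubble T a t * normalDeriv T n φ t p - (n t p)⁻¹ * gradInner (g t) (n t) (φ t) p
  lapse : ∀ t ∈ Ico 0 T, ∀ p,
    lap (g t) (n t) p = dt T (hubble T a) t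
      + n t p * ((traceFree (k t) p * traceFree (k t) p).trace + (1 / 3) * hubble T a t ^ 2
        + normalDeriv T n φ t p ^ 2)

/-! ### The time-rescaled variables and the solution norm -/

/-- The rescaled metric `a^{-2/3} g`. -/
def resMetric (a : ℝ → ℝ) (g : ℝ → MatrixField) (t : ℝ) : MatrixField :=
  fun p => a t ^ (-(2 / 3) : ℝ) • g t p

/-- The inverse of the rescaled metric. -/
def resInv (a : ℝ → ℝ) (g : ℝ → MatrixField) (t : ℝ) : MatrixField := fun p => (resMetric a g t p)⁻¹

/-- The rescaled trace-free part of the second fundamental form, `a` times the trace-free part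
of `k`. -/
def resK (a : ℝ → ℝ) (k : ℝ → MatrixField) (t : ℝ) : MatrixField :=
  fun p => a t • traceFree (k t) p

/-- The rescaled lapse `a^{-4/3} (n - 1)`. -/
def resLapse (a : ℝ → ℝ) (n : ℝ → S3 → ℝ) (t : ℝ) (p : S3) : ℝ :=
  a t ^ (-(4 / 3) : ℝ) * (n t p - 1)

/-- The rescaled time derivative of the scalar field, `n⁻¹ a ∂_t φ - √(2/3)`. -/
def timeScalar (T : ℝ) (a : ℝ → ℝ) (n φ : ℝ → S3 → ℝ) (t : ℝ) (p : S3) : ℝ :=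
  a t * normalDeriv T n φ t p - Real.sqrt (2 / 3)

/-- The solution norm at time `t`. -/
def highNorm (T : ℝ) (a : ℝ → ℝ) (g k : ℝ → MatrixField) (n φ : ℝ → S3 → ℝ) (t : ℝ) : ℝ :=
  normH 16 (mixedT (resK a k t))
  + a t ^ (2 / 3 : ℝ) * normHdot 17 (covT (resMetric a g t))
  + normH 16 (covT (resMetric a g t - St))
  + normH 16 (contraT (resInv a g t - St))
  + ∑ L ∈ Finset.Icc (1 : ℕ) 4,
      a t ^ ((2 / 3 : ℝ) * (L : ℝ)) * normHdot (14 + L) (scalarT (resLapse a n t))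
  + normH 14 (scalarT (resLapse a n t))
  + normH 16 (scalarT (timeScalar T a n φ t))
  + a t ^ (2 / 3 : ℝ) * normH 16 (dT (φ t))
  + normH 15 (dT (φ t))
  + normC 14 (mixedT (resK a k t))
  + normC 14 (covT (resMetric a g t - St))
  + normC 14 (contraT (resInv a g t - St))
  + normC 12 (scalarT (resLapse a n t))
  + normC 14 (scalarT (timeScalar T a n φ t))
  + normC 13 (dT (φ t))

end

end EinsteinScalar

open EinsteinScalar

namespace EinsteinScalar
noncomputable section

/-! ### Regularity on the slab and commutation of derivatives -/

/-! The bootstrap bound loses `a^{-σ}`, and derivatives are spent to trade this loss for one of size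
`a^{-c√ε}` or for none at all. Write `r = a^{1/3}` and `τ = t - log a`, so that the bootstrap bound
reads `ε exp(σ τ)`. Only the `C^M` parts of the solution norm enter. Through compactness and the
constant structure coefficients of the frame they become bounds on frame derivatives of components:
14 derivatives of `G`, `G⁻¹`, `K`, `Ψ`, 13 of `dφ`, 12 of `ν`.

The argument rests on a hierarchy. The time derivatives of `K` and `Ψ` carry a factor `r` (`rate_K`,
`rate_Ψ`). This factor absorbs any fixed power of `exp(σ τ)` once `σ` is small (`r_mul_exp_le`), and
the time interval has length at most 2 (`IsScaleFactor.le_two`), so integration gives `K, Ψ = O(ε)`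
without loss. The right-hand sides contain second derivatives of `ν`, which is why 10 derivatives
remain.

Since `n - 1 = r⁴ ν`, the lapse is also close to 1 without loss. The equation for the metric becomes
the linear system `∂ₜG = a⁻¹ G κ` with `κ = O(ε)`, and similarly for `G⁻¹`. The function `τ`
satisfies `τ' ≥ 1/a`, so a Gronwall argument with weight `exp(√ε τ)` gains `√ε` on integration and
yields `G - 1, G⁻¹ - 1 = O(√ε exp(√ε τ))` (`sharp_near_of_linear_rate`). The one-form `dφ` has rate
`a⁻¹ O(ε)`; direct integration costs one derivative and gives the same type of bound
(`sharp_of_rate`). The Ricci tensor follows algebraically from `G` and `G⁻¹` at a cost of two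
derivatives.

For `ν` no elliptic estimate is needed. After insertion of the Hamiltonian constraint the lapse
equation expresses `(1 - r⁴/3) ν` through the scalar curvature, `|dφ|²` and `r⁴ Δν`
(`resLapse_elliptic`); the last term is harmless because `r⁴` beats the crude bound on `Δν`.

Norms taken with `G` cost powers of the bounds on `G` and `G⁻¹`, which is affordable where a loss
`a^{-c√ε}` is allowed. The lossless bounds on `K`, `∂ₜG` and `∂ₜG⁻¹` use instead that an
endomorphism `M` self-adjoint for `G` has `|M|²_G = tr M²`, an expression free of `G`.

Constants are handled by two filters. `smallParam` expresses smallness of `σ`, uniformly in the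
solution and in time; each final estimate then holds for all large values of one constant, so
finitely many can share it. -/

theorem coe_ne_zero (p : S3) : (p : E4) ≠ 0 := by
  intro h
  have hp : ‖(p : E4)‖ = 3 := by simp
  rw [h, norm_zero] at hp
  norm_num at hp

theorem radial_coe (p : S3) : radial (p : E4) = p := by
  have hp : ‖(p : E4)‖ = 3 := by simp
  apply Subtype.ext
  simp [radial, coe_ne_zero p, hp]

theorem contDiffOn_radial {N : WithTop ℕ∞} :
    ContDiffOn ℝ N (fun y : E4 => (radial y : E4)) {0}ᶜ := by
  have h : ContDiffOn ℝ N (fun y : E4 => (3 / ‖y‖) • y) {0}ᶜ := by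
    intro y hy
    have hy0 : y ≠ 0 := hy
    have h1 : ContDiffAt ℝ N (fun y : E4 => ‖y‖) y := contDiffAt_norm ℝ hy0
    exact ((contDiffAt_const.div h1 (norm_ne_zero_iff.mpr hy0)).smul
      contDiffAt_id).contDiffWithinAt
  refine h.congr fun y hy => ?_
  have hy0 : y ≠ 0 := hy
  simp [radial, hy0]

/-- The slab `[0, T) × (ℝ⁴ \ {0})`. -/
abbrev slab (T : ℝ) : Set (ℝ × E4) := Ico 0 T ×ˢ {0}ᶜ

theorem uniqueDiffOn_slab (T : ℝ) : UniqueDiffOn ℝ (slab T) :=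
  (uniqueDiffOn_Ico 0 T).prod isOpen_compl_singleton.uniqueDiffOn

theorem contDiffOn_slab_radial (T : ℝ) {N : WithTop ℕ∞} :
    ContDiffOn ℝ N (fun q : ℝ × E4 => (q.1, (radial q.2 : E4))) (slab T) :=
  contDiffOn_fst.prodMk (contDiffOn_radial.comp contDiffOn_snd fun _ hq => hq.2)

theorem mapsTo_slab_radial (T : ℝ) :
    MapsTo (fun q : ℝ × E4 => (q.1, (radial q.2 : E4))) (slab T) (slab T) :=
  fun q hq => ⟨hq.1, coe_ne_zero (radial q.2)⟩

theorem contDiff_Z {N : WithTop ℕ∞} (A : Fin 3) : ContDiff ℝ N (Z A) :=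
  (LinearMap.toContinuousLinearMap (ZLin A)).contDiff

/-! ### Closure properties of regularity on the slab. -/

theorem SlabC.of_le {M N : ℕ} {T : ℝ} {u : ℝ → S3 → ℝ} (h : SlabC N T u) (hMN : M ≤ N) :
    SlabC M T u :=
  ContDiffOn.of_le h (by exact_mod_cast hMN)

theorem slabC_const (N : ℕ) (T c : ℝ) : SlabC N T (fun _ _ => c) := contDiffOn_const

theorem SlabC.add {N : ℕ} {T : ℝ} {u v : ℝ → S3 → ℝ} (hu : SlabC N T u) (hv : SlabC N T v) :
    SlabC N T (fun t p => u t p + v t p) := ContDiffOn.add hu hv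

theorem SlabC.sub {N : ℕ} {T : ℝ} {u v : ℝ → S3 → ℝ} (hu : SlabC N T u) (hv : SlabC N T v) :
    SlabC N T (fun t p => u t p - v t p) := ContDiffOn.sub hu hv

theorem SlabC.mul {N : ℕ} {T : ℝ} {u v : ℝ → S3 → ℝ} (hu : SlabC N T u) (hv : SlabC N T v) :
    SlabC N T (fun t p => u t p * v t p) := ContDiffOn.mul hu hv

theorem SlabC.sum {ι : Type*} {N : ℕ} {T : ℝ} {s : Finset ι} {u : ι → ℝ → S3 → ℝ}
    (hu : ∀ i ∈ s, SlabC N T (u i)) : SlabC N T (fun t p => ∑ i ∈ s, u i t p) :=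
  ContDiffOn.sum hu

theorem SlabC.inv {N : ℕ} {T : ℝ} {u : ℝ → S3 → ℝ} (hu : SlabC N T u)
    (h0 : ∀ t ∈ Ico 0 T, ∀ p, u t p ≠ 0) : SlabC N T (fun t p => (u t p)⁻¹) :=
  ContDiffOn.inv hu fun q hq => h0 q.1 hq.1 _

theorem slabC_of_time {N : ℕ} {T : ℝ} {b : ℝ → ℝ} (hb : ContDiffOn ℝ N b (Ico 0 T)) :
    SlabC N T (fun t _ => b t) :=
  hb.comp contDiffOn_fst fun _ hq => hq.1

/-- Functions on the sphere which are differentiable along the sphere. -/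
def SphereDiff (f : S3 → ℝ) : Prop :=
  ∀ p : S3, DifferentiableAt ℝ (fun y : E4 => f (radial y)) p

/-! ### Time and frame derivatives as values of one derivative on the slab. -/

theorem SlabC.slice {N : ℕ} {T t : ℝ} {u : ℝ → S3 → ℝ} (h : SlabC N T u) (ht : t ∈ Ico 0 T)
    (T' : ℝ) : SlabC N T' (fun _ => u t) :=
  ContDiffOn.comp (g := fun q : ℝ × E4 => u q.1 (radial q.2)) (f := fun q : ℝ × E4 => (t, q.2))
    h (contDiffOn_const.prodMk contDiffOn_snd) fun _ hq => ⟨ht, hq.2⟩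

theorem SlabC.hasFDerivWithinAt {N : ℕ} {T t : ℝ} {u : ℝ → S3 → ℝ} (h : SlabC (N + 1) T u)
    (ht : t ∈ Ico 0 T) {y : E4} (hy : y ≠ 0) :
    HasFDerivWithinAt (fun q : ℝ × E4 => u q.1 (radial q.2))
      (fderivWithin ℝ (fun q : ℝ × E4 => u q.1 (radial q.2)) (slab T) (t, y)) (slab T) (t, y) :=
  ((ContDiffOn.differentiableOn h (by simp)) (t, y) ⟨ht, hy⟩).hasFDerivWithinAt

theorem SlabC.hasFDerivAt_slice {N : ℕ} {T t : ℝ} {u : ℝ → S3 → ℝ} (h : SlabC (N + 1) T u)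
    (ht : t ∈ Ico 0 T) {y : E4} (hy : y ≠ 0) :
    HasFDerivAt (fun y : E4 => u t (radial y))
      ((fderivWithin ℝ (fun q : ℝ × E4 => u q.1 (radial q.2)) (slab T) (t, y)).comp
        (ContinuousLinearMap.inr ℝ ℝ E4)) y := by
  have h2 := (h.hasFDerivWithinAt ht hy).comp (s := {0}ᶜ) y
    (f := fun y : E4 => (t, y)) (hasFDerivAt_prodMk_right t y).hasFDerivWithinAt
    (fun y hy => ⟨ht, hy⟩)
  exact h2.hasFDerivAt (isOpen_compl_singleton.mem_nhds hy)

theorem SlabC.sphereDiff {N : ℕ} {T t : ℝ} {u : ℝ → S3 → ℝ} (h : SlabC (N + 1) T u)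
    (ht : t ∈ Ico 0 T) : SphereDiff (u t) := fun p =>
  (h.hasFDerivAt_slice ht (coe_ne_zero p)).differentiableAt

theorem SlabC.hasDerivWithinAt {N : ℕ} {T t : ℝ} {u : ℝ → S3 → ℝ} (h : SlabC (N + 1) T u)
    (ht : t ∈ Ico 0 T) (p : S3) :
    HasDerivWithinAt (fun s => u s p)
      (fderivWithin ℝ (fun q : ℝ × E4 => u q.1 (radial q.2)) (slab T) (t, (p : E4)) (1, 0))
      (Ico 0 T) t := by
  have h2 := (h.hasFDerivWithinAt ht (coe_ne_zero p)).comp_hasDerivWithinAt (s := Ico 0 T) t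
    (f := fun s : ℝ => (s, (p : E4)))
    ((hasDerivWithinAt_id t _).prodMk (hasDerivWithinAt_const t _ _))
    (fun s hs => ⟨hs, coe_ne_zero p⟩)
  have h3 : (fun q : ℝ × E4 => u q.1 (radial q.2)) ∘ (fun s : ℝ => (s, (p : E4)))
      = fun s => u s p := by
    funext s
    simp [radial_coe]
  rwa [h3] at h2

theorem SlabC.hasDerivWithinAt_dt {N : ℕ} {T t : ℝ} {u : ℝ → S3 → ℝ} (h : SlabC (N + 1) T u)
    (ht : t ∈ Ico 0 T) (p : S3) :
    HasDerivWithinAt (fun s => u s p) (dt T (fun s => u s p) t) (Ico 0 T) t :=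
  (h.hasDerivWithinAt ht p).differentiableWithinAt.hasDerivWithinAt

theorem dt_eq {T t f' : ℝ} {f : ℝ → ℝ} (h : HasDerivWithinAt f f' (Ico 0 T) t)
    (ht : t ∈ Ico 0 T) : dt T f t = f' :=
  h.derivWithin (uniqueDiffOn_Ico 0 T t ht)

theorem dt_congr {T t : ℝ} {f g : ℝ → ℝ} (h : ∀ s ∈ Ico 0 T, f s = g s)
    (ht : t ∈ Ico 0 T) : dt T f t = dt T g t :=
  derivWithin_congr h (h t ht)

theorem SlabC.dt_eq_fderivWithin {N : ℕ} {T t : ℝ} {u : ℝ → S3 → ℝ} (h : SlabC (N + 1) T u)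
    (ht : t ∈ Ico 0 T) (p : S3) :
    dt T (fun s => u s p) t
      = fderivWithin ℝ (fun q : ℝ × E4 => u q.1 (radial q.2)) (slab T) (t, (p : E4)) (1, 0) :=
  dt_eq (h.hasDerivWithinAt ht p) ht

theorem SlabC.Zder_eq_fderivWithin {N : ℕ} {T t : ℝ} {u : ℝ → S3 → ℝ} (h : SlabC (N + 1) T u)
    (ht : t ∈ Ico 0 T) (A : Fin 3) (p : S3) :
    Zder A (u t) p = fderivWithin ℝ (fun q : ℝ × E4 => u q.1 (radial q.2)) (slab T) (t, (p : E4))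
      (0, Z A (p : E4)) := by
  rw [Zder, (h.hasFDerivAt_slice ht (coe_ne_zero p)).fderiv]
  rfl

theorem SlabC.dt {N : ℕ} {T : ℝ} {u : ℝ → S3 → ℝ} (h : SlabC (N + 1) T u) :
    SlabC N T (fun t p => dt T (fun s => u s p) t) := by
  have h1 := ContDiffOn.fderivWithin h (uniqueDiffOn_slab T) (m := (N : WithTop ℕ∞)) (by simp)
  have h2 : ContDiffOn ℝ N (fun q : ℝ × E4 =>
      fderivWithin ℝ (fun q : ℝ × E4 => u q.1 (radial q.2)) (slab T) (q.1, (radial q.2 : E4))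
        ((1 : ℝ), (0 : E4))) (slab T) :=
    (h1.comp (contDiffOn_slab_radial T) (mapsTo_slab_radial T)).clm_apply contDiffOn_const
  exact ContDiffOn.congr h2 fun q hq => h.dt_eq_fderivWithin hq.1 _

theorem SlabC.zder {N : ℕ} {T : ℝ} {u : ℝ → S3 → ℝ} (h : SlabC (N + 1) T u) (A : Fin 3) :
    SlabC N T (fun t => Zder A (u t)) := by
  have h1 := ContDiffOn.fderivWithin h (uniqueDiffOn_slab T) (m := (N : WithTop ℕ∞)) (by simp)
  have h2 : ContDiffOn ℝ N (fun q : ℝ × E4 =>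
      fderivWithin ℝ (fun q : ℝ × E4 => u q.1 (radial q.2)) (slab T) (q.1, (radial q.2 : E4))
        ((0 : ℝ), Z A (radial q.2 : E4))) (slab T) :=
    (h1.comp (contDiffOn_slab_radial T) (mapsTo_slab_radial T)).clm_apply
      (contDiffOn_const.prodMk ((contDiff_Z A).comp_contDiffOn
        (contDiffOn_slab_radial T).snd))
  exact ContDiffOn.congr h2 fun q hq => h.Zder_eq_fderivWithin hq.1 A _

/-- The radial projection restricts to the identity on the sphere and `Z A` is tangent to it. This
is what makes iterated frame derivatives, each taken after a radial extension, consistent with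
derivatives on the slab. -/
theorem hasFDerivAt_radial_Z (A : Fin 3) (p : S3) :
    fderiv ℝ (fun y : E4 => (radial y : E4)) (p : E4) (Z A (p : E4)) = Z A (p : E4) := by
  have hp : ‖(p : E4)‖ = 3 := by simp
  have hn : HasFDerivAt (fun y : E4 => ‖y‖ ^ 2) (2 • (innerSL ℝ (p : E4))) (p : E4) :=
    (hasStrictFDerivAt_norm_sq (p : E4)).hasFDerivAt
  have hd : DifferentiableAt ℝ (fun y : E4 => ‖y‖) (p : E4) :=
    (contDiffAt_norm ℝ (n := 1) (coe_ne_zero p)).differentiableAt (by simp)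
  -- The derivative of `‖y‖²` computed in two ways: by the chain rule, and as `2⟨p, ·⟩`, which kills
  -- `Z A`.
  have hn2 : fderiv ℝ (fun y : E4 => ‖y‖) (p : E4) (Z A (p : E4)) = 0 := by
    have h1 := (hd.hasFDerivAt.pow 2).unique hn
    have h2 := congrArg (fun L => L (Z A (p : E4))) h1
    simp [inner_self_Z, hp] at h2
    exact h2
  have he : (fun y : E4 => (radial y : E4)) =ᶠ[nhds (p : E4)] fun y => (3 / ‖y‖) • y := by
    filter_upwards [isOpen_compl_singleton.mem_nhds (coe_ne_zero p)] with y hy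
    have hy0 : y ≠ 0 := hy
    simp [radial, hy0]
  have h3 : HasFDerivAt (fun y : E4 => 3 / ‖y‖)
      ((3 : ℝ) • ((-(‖(p : E4)‖ ^ 2)⁻¹) • fderiv ℝ (fun y : E4 => ‖y‖) (p : E4))) (p : E4) := by
    have h4 := ((hasDerivAt_inv (x := ‖(p : E4)‖) (by rw [hp]; norm_num)).comp_hasFDerivAt
      (p : E4) hd.hasFDerivAt).const_smul (3 : ℝ)
    refine h4.congr_of_eventuallyEq (Filter.Eventually.of_forall fun y => ?_)
    simp [div_eq_mul_inv]
  rw [he.fderiv_eq, fderiv_fun_smul h3.differentiableAt differentiableAt_fun_id, h3.fderiv]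
  simp [hn2, hp]

/-- Both sides are the second derivative of `u` on the slab, in the directions `(1, 0)` and `(0, Z
A)`, in either order. -/
theorem SlabC.dt_zder {T t : ℝ} {u : ℝ → S3 → ℝ} (h : SlabC 2 T u)
    (ht : t ∈ Ico 0 T) (A : Fin 3) (p : S3) :
    EinsteinScalar.dt T (fun s => Zder A (u s) p) t
      = Zder A (fun p => EinsteinScalar.dt T (fun s => u s p) t) p := by
  set F : ℝ × E4 → ℝ := fun q => u q.1 (radial q.2) with hF
  set D := fderivWithin ℝ F (slab T) with hD
  have hD1 : ContDiffOn ℝ 1 D (slab T) :=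
    ContDiffOn.fderivWithin h (uniqueDiffOn_slab T) (by norm_num)
  have hmem : (t, (p : E4)) ∈ slab T := ⟨ht, coe_ne_zero p⟩
  have hDd := (hD1.differentiableOn (by simp) _ hmem).hasFDerivWithinAt
  set D2 := fderivWithin ℝ D (slab T) (t, (p : E4)) with hD2
  have hsymm : D2 (1, 0) (0, Z A (p : E4)) = D2 (0, Z A (p : E4)) (1, 0) := by
    have h2 : IsSymmSndFDerivWithinAt ℝ F (slab T) (t, (p : E4)) := by
      -- At `t = 0` the point lies on the boundary of the slab; symmetry survives because it is in
      -- the closure of the interior.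
      refine ContDiffWithinAt.isSymmSndFDerivWithinAt (n := 2) (h _ hmem) (by simp)
        (uniqueDiffOn_slab T) ?_ hmem
      have hT : (0 : ℝ) < T := lt_of_le_of_lt ht.1 ht.2
      rw [interior_prod_eq, closure_prod_eq, interior_Ico,
        isOpen_compl_singleton.interior_eq, closure_Ioo hT.ne]
      exact ⟨⟨ht.1, ht.2.le⟩, subset_closure (coe_ne_zero p)⟩
    exact h2 _ _
  have hl : EinsteinScalar.dt T (fun s => Zder A (u s) p) t = D2 (1, 0) (0, Z A (p : E4)) := by
    have h3 : HasDerivWithinAt (fun s : ℝ => D (s, (p : E4)) (0, Z A (p : E4)))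
        (D2 (1, 0) (0, Z A (p : E4))) (Ico 0 T) t := by
      have h4 := hDd.comp_hasDerivWithinAt (s := Ico 0 T) t
        (f := fun s : ℝ => (s, (p : E4)))
        ((hasDerivWithinAt_id t _).prodMk (hasDerivWithinAt_const t _ _))
        (fun s hs => ⟨hs, coe_ne_zero p⟩)
      have h5 := h4.clm_apply (hasDerivWithinAt_const t (Ico 0 T) ((0 : ℝ), Z A (p : E4)))
      simpa using h5
    rw [dt_congr (fun s hs => SlabC.Zder_eq_fderivWithin (N := 1) h hs A p) ht]
    exact dt_eq h3 ht
  have hr : Zder A (fun p => EinsteinScalar.dt T (fun s => u s p) t) p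
      = D2 (0, Z A (p : E4)) (1, 0) := by
    have he : (fun y : E4 => EinsteinScalar.dt T (fun s => u s (radial y)) t)
        = fun y => D (t, (radial y : E4)) (1, 0) := by
      funext y
      exact SlabC.dt_eq_fderivWithin (N := 1) h ht _
    have hrad : HasFDerivAt (fun y : E4 => (radial y : E4))
        (fderiv ℝ (fun y : E4 => (radial y : E4)) (p : E4)) (p : E4) :=
      ((contDiffOn_radial (N := 1)).differentiableOn (by simp) _
        (coe_ne_zero p)).differentiableAt
        (isOpen_compl_singleton.mem_nhds (coe_ne_zero p)) |>.hasFDerivAt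
    have hpair := (hasFDerivAt_const t (p : E4)).prodMk hrad
    have hDd' : HasFDerivWithinAt D D2 (slab T) (t, (radial (p : E4) : E4)) := by
      rw [radial_coe]; exact hDd
    have h6 := (hDd'.comp (s := {0}ᶜ) (p : E4) (f := fun y : E4 => (t, (radial y : E4)))
      hpair.hasFDerivWithinAt (fun y _ => ⟨ht, coe_ne_zero (radial y)⟩)).hasFDerivAt
      (isOpen_compl_singleton.mem_nhds (coe_ne_zero p))
    have h7 := h6.clm_apply (hasFDerivAt_const ((1 : ℝ), (0 : E4)) (p : E4))
    rw [Zder, he]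
    have h8 := h7.fderiv
    simp only [Function.comp_def] at h8
    rw [h8]
    simp [hasFDerivAt_radial_Z]
  rw [hl, hr, hsymm]

/-! ### Bounds for frame derivatives -/

theorem SphereDiff.add {f g : S3 → ℝ} (hf : SphereDiff f) (hg : SphereDiff g) :
    SphereDiff (fun p => f p + g p) := fun p => (hf p).add (hg p)

theorem SphereDiff.mul {f g : S3 → ℝ} (hf : SphereDiff f) (hg : SphereDiff g) :
    SphereDiff (fun p => f p * g p) := fun p => (hf p).mul (hg p)

theorem sphereDiff_const (c : ℝ) : SphereDiff (fun _ => c) := fun _ => differentiableAt_const c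

theorem Zder_add {f g : S3 → ℝ} (hf : SphereDiff f) (hg : SphereDiff g) (A : Fin 3) :
    Zder A (fun p => f p + g p) = fun p => Zder A f p + Zder A g p := by
  funext p
  simp only [Zder]
  rw [fderiv_fun_add (hf p) (hg p)]
  rfl

theorem Zder_mul {f g : S3 → ℝ} (hf : SphereDiff f) (hg : SphereDiff g) (A : Fin 3) :
    Zder A (fun p => f p * g p) = fun p => Zder A f p * g p + f p * Zder A g p := by
  funext p
  simp only [Zder]
  rw [fderiv_fun_mul (hf p) (hg p)]
  simp [radial_coe]
  ring

theorem Zder_const (c : ℝ) (A : Fin 3) : Zder A (fun _ => c) = fun _ => 0 := by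
  funext p
  simp [Zder]

theorem Zder_const_mul (c : ℝ) (f : S3 → ℝ) (A : Fin 3) :
    Zder A (fun p => c * f p) = fun p => c * Zder A f p := by
  funext p
  simp only [Zder]
  change fderiv ℝ (c • (fun y : E4 => f (radial y))) (p : E4) _ = _
  rw [fderiv_const_smul_field]
  rfl

theorem Zder_sub_const (c : ℝ) (f : S3 → ℝ) (A : Fin 3) :
    Zder A (fun p => f p - c) = Zder A f := by
  funext p
  simp only [Zder]
  rw [fderiv_sub_const]

/-- All frame derivatives of `f` of order at most `N` exist and are bounded by `B`. -/
def DerivBound : ℕ → (S3 → ℝ) → ℝ → Prop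
  | 0, f, B => ∀ p, |f p| ≤ B
  | N + 1, f, B => (∀ p, |f p| ≤ B) ∧ SphereDiff f ∧ ∀ A, DerivBound N (Zder A f) B

namespace DerivBound

theorem abs_le {N : ℕ} {f : S3 → ℝ} {B : ℝ} (h : DerivBound N f B) (p : S3) : |f p| ≤ B := by
  cases N with
  | zero => exact h p
  | succ N => exact h.1 p

theorem nonneg {N : ℕ} {f : S3 → ℝ} {B : ℝ} (h : DerivBound N f B) : 0 ≤ B :=
  (abs_nonneg _).trans (h.abs_le (radial 0))

theorem mono {N : ℕ} {f : S3 → ℝ} {B B' : ℝ} (h : DerivBound N f B) (hB : B ≤ B') :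
    DerivBound N f B' := by
  induction N generalizing f with
  | zero => exact fun p => (h p).trans hB
  | succ N ih => exact ⟨fun p => (h.1 p).trans hB, h.2.1, fun A => ih (h.2.2 A)⟩

theorem of_succ {N : ℕ} {f : S3 → ℝ} {B : ℝ} (h : DerivBound (N + 1) f B) :
    DerivBound N f B := by
  induction N generalizing f with
  | zero => exact h.1
  | succ N ih => exact ⟨h.1, h.2.1, fun A => ih (h.2.2 A)⟩

theorem of_le {M N : ℕ} {f : S3 → ℝ} {B : ℝ} (h : DerivBound N f B) (hMN : M ≤ N) :
    DerivBound M f B := by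
  induction N, hMN using Nat.le_induction with
  | base => exact h
  | succ N _ ih => exact ih h.of_succ

theorem zder {N : ℕ} {f : S3 → ℝ} {B : ℝ} (h : DerivBound (N + 1) f B) (A : Fin 3) :
    DerivBound N (Zder A f) B := h.2.2 A

theorem zero (N : ℕ) {B : ℝ} (hB : 0 ≤ B) : DerivBound N (fun _ => 0) B := by
  induction N with
  | zero => intro p; simpa using hB
  | succ N ih =>
    refine ⟨fun p => by simpa using hB, sphereDiff_const 0, fun A => ?_⟩
    rw [Zder_const]
    exact ih

theorem const (N : ℕ) (c : ℝ) : DerivBound N (fun _ => c) |c| := by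
  cases N with
  | zero => exact fun p => le_rfl
  | succ N =>
    refine ⟨fun p => le_rfl, sphereDiff_const c, fun A => ?_⟩
    rw [Zder_const]
    exact zero N (abs_nonneg c)

theorem add {N : ℕ} {f g : S3 → ℝ} {B B' : ℝ} (hf : DerivBound N f B) (hg : DerivBound N g B') :
    DerivBound N (fun p => f p + g p) (B + B') := by
  induction N generalizing f g with
  | zero => exact fun p => (abs_add_le _ _).trans (add_le_add (hf p) (hg p))
  | succ N ih =>
    refine ⟨fun p => (abs_add_le _ _).trans (add_le_add (hf.1 p) (hg.1 p)), hf.2.1.add hg.2.1,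
      fun A => ?_⟩
    rw [Zder_add hf.2.1 hg.2.1]
    exact ih (hf.2.2 A) (hg.2.2 A)

/-- Each application of the Leibniz rule doubles the number of terms, hence the factor `2 ^ N`. -/
theorem mul {N : ℕ} {f g : S3 → ℝ} {B B' : ℝ} (hf : DerivBound N f B) (hg : DerivBound N g B') :
    DerivBound N (fun p => f p * g p) (2 ^ N * (B * B')) := by
  induction N generalizing f g with
  | zero =>
    intro p
    rw [abs_mul, pow_zero, one_mul]
    exact mul_le_mul (hf p) (hg p) (abs_nonneg _) hf.nonneg
  | succ N ih =>
    have hBB : 0 ≤ B * B' := mul_nonneg hf.nonneg hg.nonneg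
    refine ⟨fun p => ?_, hf.2.1.mul hg.2.1, fun A => ?_⟩
    · rw [abs_mul]
      calc |f p| * |g p| ≤ B * B' :=
            mul_le_mul (hf.1 p) (hg.1 p) (abs_nonneg _) hf.nonneg
        _ ≤ 2 ^ (N + 1) * (B * B') :=
            le_mul_of_one_le_left hBB (one_le_pow₀ one_le_two)
    · rw [Zder_mul hf.2.1 hg.2.1]
      refine ((ih (hf.2.2 A) hg.of_succ).add (ih hf.of_succ (hg.2.2 A))).mono (le_of_eq ?_)
      ring

theorem const_mul {N : ℕ} {f : S3 → ℝ} {B : ℝ} (hf : DerivBound N f B) (c : ℝ) :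
    DerivBound N (fun p => c * f p) (|c| * B) := by
  induction N generalizing f with
  | zero =>
    intro p
    rw [abs_mul]
    exact mul_le_mul_of_nonneg_left (hf p) (abs_nonneg c)
  | succ N ih =>
    refine ⟨fun p => ?_, (sphereDiff_const c).mul hf.2.1, fun A => ?_⟩
    · rw [abs_mul]
      exact mul_le_mul_of_nonneg_left (hf.1 p) (abs_nonneg c)
    · rw [Zder_const_mul]
      exact ih (hf.2.2 A)

theorem sum {ι : Type*} {s : Finset ι} {N : ℕ} {f : ι → S3 → ℝ} {B : ι → ℝ}
    (h : ∀ i ∈ s, DerivBound N (f i) (B i)) :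
    DerivBound N (fun p => ∑ i ∈ s, f i p) (∑ i ∈ s, B i) := by
  classical
  induction s using Finset.induction_on with
  | empty => simpa using zero N le_rfl
  | insert i s hi ih =>
    simp only [Finset.sum_insert hi]
    exact (h i (Finset.mem_insert_self i s)).add
      (ih fun j hj => h j (Finset.mem_insert_of_mem hj))

theorem of_forall_add {N : ℕ} {f : S3 → ℝ} {B : ℝ}
    (h : ∀ δ > 0, DerivBound N f (B + δ)) : DerivBound N f B := by
  induction N generalizing f with
  | zero => exact fun p => le_of_forall_pos_le_add fun δ hδ => h δ hδ p
  | succ N ih =>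
    exact ⟨fun p => le_of_forall_pos_le_add fun δ hδ => (h δ hδ).1 p, (h 1 one_pos).2.1,
      fun A => ih fun δ hδ => (h δ hδ).2.2 A⟩

end DerivBound

/-- Continuity and compactness of the sphere. The bound is only qualitative; it guarantees that
suprema are genuine and not the default value 0 of an unbounded `⨆`. -/
theorem exists_bound_of_slabC {T : ℝ} (hT : 0 < T) {f : S3 → ℝ} (h : SlabC 0 T (fun _ => f)) :
    ∃ B, ∀ p, |f p| ≤ B := by
  have hc : Continuous f := by
    have h1 : ContinuousOn (fun q : ℝ × E4 => f (radial q.2)) (slab T) := ContDiffOn.continuousOn h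
    have h2 : Continuous (fun p : S3 => f (radial (p : E4))) :=
      h1.comp_continuous (f := fun p : S3 => ((0 : ℝ), (p : E4))) (by fun_prop)
        fun p => ⟨⟨le_rfl, hT⟩, coe_ne_zero p⟩
    simpa only [radial_coe] using h2
  obtain ⟨B, hB⟩ := isCompact_univ.exists_bound_of_continuousOn hc.continuousOn
  exact ⟨B, fun p => hB p (mem_univ p)⟩

theorem exists_derivBound_of_slabC {T : ℝ} (hT : 0 < T) {N : ℕ} {f : S3 → ℝ}
    (h : SlabC N T (fun _ => f)) : ∃ B, DerivBound N f B := by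
  induction N generalizing f with
  | zero => exact exists_bound_of_slabC hT h
  | succ N ih =>
    obtain ⟨B, hB⟩ := exists_bound_of_slabC hT (h.of_le (Nat.zero_le _))
    choose B' hB' using fun A => ih (SlabC.zder h A)
    refine ⟨|B| + ∑ A, |B' A|, fun p => ?_, h.sphereDiff ⟨le_rfl, hT⟩, fun A => ?_⟩
    · exact (hB p).trans ((le_abs_self B).trans
        (le_add_of_nonneg_right (Finset.sum_nonneg fun _ _ => abs_nonneg _)))
    · refine (hB' A).mono ((le_abs_self _).trans ?_)
      exact (Finset.single_le_sum (f := fun A => |B' A|) (fun _ _ => abs_nonneg _)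
        (Finset.mem_univ A)).trans (le_add_of_nonneg_left (abs_nonneg B))

/-- The mean value inequality with a comparison function: derivatives within `[0, T)` are turned
into right derivatives on `[0, t]`. -/
theorem abs_le_of_hasDerivWithinAt_le {T : ℝ} {f f' β β' : ℝ → ℝ}
    (hf : ∀ t ∈ Ico 0 T, HasDerivWithinAt f (f' t) (Ico 0 T) t)
    (hβ : ∀ t ∈ Ico 0 T, HasDerivWithinAt β (β' t) (Ico 0 T) t)
    {t : ℝ} (ht : t ∈ Ico 0 T) (h0 : |f 0| ≤ β 0) (h : ∀ s ∈ Icc 0 t, |f' s| ≤ β' s) :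
    |f t| ≤ β t := by
  have hs : ∀ s ∈ Icc 0 t, s ∈ Ico 0 T := fun s hs => ⟨hs.1, hs.2.trans_lt ht.2⟩
  have hI : ∀ s ∈ Ico 0 t, Ico 0 T ∈ nhdsWithin s (Ici s) := fun s hs' =>
    Filter.mem_of_superset (Ico_mem_nhdsGE (hs'.2.trans ht.2)) (Ico_subset_Ico_left hs'.1)
  have key := image_norm_le_of_norm_deriv_right_le_deriv_boundary' (a := 0) (b := t)
    (f := f) (f' := f') (B := β) (B' := β')
    (fun s hs' => ((hf s (hs s hs')).continuousWithinAt).mono fun x hx => hs x hx)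
    (fun s hs' => (hf s (hs s (Ico_subset_Icc_self hs'))).mono_of_mem_nhdsWithin (hI s hs'))
    h0
    (fun s hs' => ((hβ s (hs s hs')).continuousWithinAt).mono fun x hx => hs x hx)
    (fun s hs' => (hβ s (hs s (Ico_subset_Icc_self hs'))).mono_of_mem_nhdsWithin (hI s hs'))
    (fun s hs' => h s (Ico_subset_Icc_self hs'))
  exact key ⟨ht.1, le_rfl⟩

/-- Integration in time of bounds for frame derivatives. -/
theorem DerivBound.integrate {N : ℕ} {T : ℝ} {u : ℝ → S3 → ℝ} (hu : SlabC (N + 1) T u)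
    {β β' : ℝ → ℝ} (hβ : ∀ t ∈ Ico 0 T, HasDerivWithinAt β (β' t) (Ico 0 T) t)
    {t : ℝ} (ht : t ∈ Ico 0 T) (h0 : DerivBound N (u 0) (β 0))
    (h : ∀ s ∈ Icc 0 t, DerivBound N (fun p => dt T (fun s => u s p) s) (β' s)) :
    DerivBound N (u t) (β t) := by
  induction N generalizing u with
  | zero =>
    intro p
    exact abs_le_of_hasDerivWithinAt_le (fun s hs => hu.hasDerivWithinAt_dt hs p) hβ ht (h0 p)
      fun s hs => h s hs p
  | succ N ih =>
    refine ⟨fun p => abs_le_of_hasDerivWithinAt_le (fun s hs => hu.hasDerivWithinAt_dt hs p) hβ ht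
      (h0.1 p) fun s hs => (h s hs).1 p, hu.sphereDiff ht, fun A => ?_⟩
    refine ih (u := fun t => Zder A (u t)) (hu.zder A) (h0.2.2 A) fun s hs => ?_
    have hs' : s ∈ Ico 0 T := ⟨hs.1, hs.2.trans_lt ht.2⟩
    -- Frame derivatives commute with the time derivative, so each of them satisfies the same
    -- differential inequality.
    have he : (fun p => dt T (fun r => Zder A (u r) p) s)
        = Zder A (fun p => dt T (fun r => u r p) s) := by
      funext p
      exact SlabC.dt_zder (hu.of_le (by omega)) hs' A p
    rw [he]
    exact (h s hs).2.2 A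

/-! ### Lie derivatives of tensor fields and frame derivatives of their components -/

theorem abs_structConst_le (A B C : Fin 3) : |structConst A B C| ≤ 1 := by
  fin_cases A <;> fin_cases B <;> fin_cases C <;> norm_num [structConst, eps, abs_le]

/-- All components of `ξ` have frame derivatives of order at most `N` bounded by `B`. -/
def TensorBound {l m : ℕ} (N : ℕ) (ξ : Tensor l m) (B : ℝ) : Prop :=
  ∀ I J, DerivBound N (ξ I J) B

/-- The growth factor of component bounds under a Lie derivative. -/
def lieFactor (l m : ℕ) : ℝ := 1 + 3 * l + 3 * m

theorem one_le_lieFactor (l m : ℕ) : 1 ≤ lieFactor l m := by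
  unfold lieFactor
  have hl : (0 : ℝ) ≤ l := Nat.cast_nonneg l
  have hm : (0 : ℝ) ≤ m := Nat.cast_nonneg m
  linarith

/-- A Lie derivative differs from the frame derivative of the components by zeroth-order terms with
constant coefficients of modulus at most 1, three for each index. -/
theorem derivBound_lower_order_terms {l m N : ℕ} {ξ : Tensor l m} {B : ℝ}
    (h : TensorBound N ξ B) (C : Fin 3) (I : Fin l → Fin 3) (J : Fin m → Fin 3) :
    DerivBound N (fun p => ∑ i : Fin l, ∑ D : Fin 3,
        structConst C D (I i) * ξ (Function.update I i D) J p) (3 * l * B) ∧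
    DerivBound N (fun p => ∑ j : Fin m, ∑ D : Fin 3,
        structConst C (J j) D * ξ I (Function.update J j D) p) (3 * m * B) := by
  have hB : 0 ≤ B := (h I J).nonneg
  have key : ∀ (c : ℝ) (f : S3 → ℝ), |c| ≤ 1 → DerivBound N f B →
      DerivBound N (fun p => c * f p) B := fun c f hc hf =>
    (hf.const_mul c).mono (mul_le_of_le_one_left hB hc)
  constructor
  · refine (DerivBound.sum (s := Finset.univ) (B := fun _ : Fin l => 3 * B) fun i _ =>
      (DerivBound.sum (s := Finset.univ) (B := fun _ : Fin 3 => B) fun D _ =>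
        key _ _ (abs_structConst_le _ _ _) (h _ _)).mono (by simp)).mono ?_
    simp only [Finset.sum_const, Finset.card_univ, Fintype.card_fin, nsmul_eq_mul]
    exact le_of_eq (by ring)
  · refine (DerivBound.sum (s := Finset.univ) (B := fun _ : Fin m => 3 * B) fun i _ =>
      (DerivBound.sum (s := Finset.univ) (B := fun _ : Fin 3 => B) fun D _ =>
        key _ _ (abs_structConst_le _ _ _) (h _ _)).mono (by simp)).mono ?_
    simp only [Finset.sum_const, Finset.card_univ, Fintype.card_fin, nsmul_eq_mul]
    exact le_of_eq (by ring)

theorem DerivBound.sub {N : ℕ} {f g : S3 → ℝ} {B B' : ℝ} (hf : DerivBound N f B)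
    (hg : DerivBound N g B') : DerivBound N (fun p => f p - g p) (B + B') := by
  have h := hf.add (hg.const_mul (-1))
  simpa [sub_eq_add_neg] using h

theorem TensorBound.lieZ {l m N : ℕ} {ξ : Tensor l m} {B : ℝ} (h : TensorBound (N + 1) ξ B)
    (C : Fin 3) : TensorBound N (lieZ C ξ) (lieFactor l m * B) := by
  intro I J
  have h2 := derivBound_lower_order_terms (fun I J => (h I J).of_succ) C I J
  refine ((((h I J).zder C).add h2.1).sub h2.2).mono (le_of_eq ?_)
  unfold lieFactor
  ring

theorem TensorBound.foldr_lieZ {l m N : ℕ} (L : List (Fin 3)) {ξ : Tensor l m} {B : ℝ}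
    (h : TensorBound (N + L.length) ξ B) :
    TensorBound N (L.foldr EinsteinScalar.lieZ ξ) (lieFactor l m ^ L.length * B) := by
  induction L generalizing N with
  | nil => simpa using h
  | cons C L ih =>
    have h2 := (ih (N := N + 1) (by rw [List.length_cons] at h; convert h using 1; ring)).lieZ C
    simp only [List.foldr_cons, List.length_cons]
    rw [pow_succ', mul_assoc]
    exact h2

theorem TensorBound.lieI {l m M N : ℕ} (I : Fin M → Fin 3) {ξ : Tensor l m} {B : ℝ}
    (h : TensorBound (N + M) ξ B) :
    TensorBound N (lieI I ξ) (lieFactor l m ^ M * B) := by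
  have h2 := TensorBound.foldr_lieZ (N := N) (List.ofFn I) (ξ := ξ) (B := B) (by simpa using h)
  rwa [List.length_ofFn] at h2

theorem zder_eq_lieZ {l m : ℕ} (ξ : Tensor l m) (C : Fin 3) (I : Fin l → Fin 3)
    (J : Fin m → Fin 3) : Zder C (ξ I J) = fun p => lieZ C ξ I J p
      - ∑ i : Fin l, ∑ D : Fin 3, structConst C D (I i) * ξ (Function.update I i D) J p
      + ∑ j : Fin m, ∑ D : Fin 3, structConst C (J j) D * ξ I (Function.update J j D) p := by
  funext p
  simp only [lieZ]
  ring

theorem slabC_lieZ {l m N : ℕ} {T : ℝ} {ξ : ℝ → Tensor l m}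
    (h : ∀ I J, SlabC (N + 1) T (fun t => ξ t I J)) (C : Fin 3) (I : Fin l → Fin 3)
    (J : Fin m → Fin 3) : SlabC N T (fun t => lieZ C (ξ t) I J) := by
  refine (SlabC.add ((h I J).zder C) ?_).sub ?_
  · exact SlabC.sum fun i _ => SlabC.sum fun D _ =>
      (slabC_const N T _).mul ((h _ _).of_le (Nat.le_succ N))
  · exact SlabC.sum fun i _ => SlabC.sum fun D _ =>
      (slabC_const N T _).mul ((h _ _).of_le (Nat.le_succ N))

/-- Induction on the order: a frame derivative of a component is a component of one Lie derivative
plus zeroth-order terms, and both are already controlled to one order less. This costs one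
`lieFactor` per order. -/
theorem TensorBound.of_foldr_lieZ {l m M : ℕ} {ξ : Tensor l m} {b : ℝ}
    (hξ : ∀ I J, SlabC M 1 (fun _ => ξ I J))
    (h : ∀ L : List (Fin 3), L.length ≤ M → ∀ I J p, |L.foldr EinsteinScalar.lieZ ξ I J p| ≤ b) :
    TensorBound M ξ (lieFactor l m ^ M * b) := by
  have hb : 0 ≤ b := (abs_nonneg _).trans
    (h [] (Nat.zero_le M) (fun _ => 0) (fun _ => 0) (radial 0))
  induction M generalizing ξ with
  | zero => exact fun I J p => by simpa using h [] le_rfl I J p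
  | succ M ih =>
    have hK := one_le_lieFactor l m
    have h0 := ih (fun I J => (hξ I J).of_le (Nat.le_succ M))
      (fun L hL => h L (hL.trans (Nat.le_succ M)))
    have h1 : ∀ C, TensorBound M (EinsteinScalar.lieZ C ξ) (lieFactor l m ^ M * b) := fun C =>
      ih (slabC_lieZ (ξ := fun _ => ξ) hξ C) fun L hL I J p => by
        -- The additional derivative acts first, so it stands at the end of the list.
        have h2 := h (L ++ [C]) (by simpa using hL) I J p
        simpa using h2
    intro I J
    refine ⟨fun p => (h [] (Nat.zero_le _) I J p).trans ?_, (hξ I J).sphereDiff (t := 0)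
      ⟨le_rfl, one_pos⟩, fun C => ?_⟩
    · exact le_mul_of_one_le_left hb (one_le_pow₀ hK)
    · rw [zder_eq_lieZ]
      have h3 := derivBound_lower_order_terms h0 C I J
      refine (((h1 C I J).sub h3.1).add h3.2).mono (le_of_eq ?_)
      unfold lieFactor
      ring

/-- Bounds for all Lie derivatives give bounds for all frame derivatives of the components. -/
theorem TensorBound.of_lieI {l m M : ℕ} {ξ : Tensor l m} {b : ℝ}
    (hξ : ∀ I J, SlabC M 1 (fun _ => ξ I J))
    (h : ∀ N ≤ M, ∀ W : Fin N → Fin 3, ∀ I J p, |EinsteinScalar.lieI W ξ I J p| ≤ b) :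
    TensorBound M ξ (lieFactor l m ^ M * b) :=
  TensorBound.of_foldr_lieZ hξ fun L hL I J p => by
    have h1 := h L.length hL L.get I J p
    rwa [EinsteinScalar.lieI, List.ofFn_get] at h1

theorem timeDeriv_lieZ {l m : ℕ} {T t : ℝ} {ξ : ℝ → Tensor l m}
    (h : ∀ I J, SlabC 2 T (fun t => ξ t I J)) (ht : t ∈ Ico 0 T) (C : Fin 3) :
    timeDeriv T (fun s => lieZ C (ξ s)) t = lieZ C (timeDeriv T ξ t) := by
  funext I J p
  have h1 : ∀ I J, HasDerivWithinAt (fun s => ξ s I J p) (timeDeriv T ξ t I J p) (Ico 0 T) t :=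
    fun I J => SlabC.hasDerivWithinAt_dt (N := 1) (h I J) ht p
  have h2 : HasDerivWithinAt (fun s => Zder C (ξ s I J) p) (Zder C (timeDeriv T ξ t I J) p)
      (Ico 0 T) t := by
    have h3 := SlabC.hasDerivWithinAt_dt (N := 0) (SlabC.zder (N := 1) (h I J) C) ht p
    rwa [SlabC.dt_zder (h I J) ht C p] at h3
  refine dt_eq ?_ ht
  exact (h2.add (HasDerivWithinAt.fun_sum fun i _ => HasDerivWithinAt.fun_sum fun D _ =>
    (h1 _ _).const_mul _)).sub (HasDerivWithinAt.fun_sum fun i _ =>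
      HasDerivWithinAt.fun_sum fun D _ => (h1 _ _).const_mul _)

theorem slabC_and_timeDeriv_foldr {l m N : ℕ} {T : ℝ} (L : List (Fin 3)) {ξ : ℝ → Tensor l m}
    (h : ∀ I J, SlabC (N + 1 + L.length) T (fun t => ξ t I J)) :
    (∀ I J, SlabC (N + 1) T (fun t => L.foldr lieZ (ξ t) I J)) ∧
    ∀ t ∈ Ico 0 T, timeDeriv T (fun s => L.foldr lieZ (ξ s)) t
      = L.foldr lieZ (timeDeriv T ξ t) := by
  induction L generalizing N with
  | nil => exact ⟨by simpa using h, fun t _ => rfl⟩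
  | cons C L ih =>
    obtain ⟨h1, h2⟩ := ih (N := N + 1) (fun I J => by
      have := h I J
      rw [List.length_cons] at this
      convert this using 1
      ring)
    refine ⟨fun I J => slabC_lieZ h1 C I J, fun t ht => ?_⟩
    simp only [List.foldr_cons]
    rw [timeDeriv_lieZ (ξ := fun t => L.foldr lieZ (ξ t))
      (fun I J => (h1 I J).of_le (by omega)) ht C, h2 t ht]

theorem timeDeriv_lieI {l m M : ℕ} {T t : ℝ} (W : Fin M → Fin 3) {ξ : ℝ → Tensor l m}
    (h : ∀ I J, SlabC (M + 1) T (fun t => ξ t I J)) (ht : t ∈ Ico 0 T) :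
    timeDeriv T (fun s => lieI W (ξ s)) t = lieI W (timeDeriv T ξ t) :=
  (slabC_and_timeDeriv_foldr (N := 0) (List.ofFn W) (fun I J => by
    simpa [add_comm] using h I J)).2 t ht

/-! ### Pointwise norms -/

theorem pnorm_St {l m : ℕ} (ξ : Tensor l m) (p : S3) :
    pnorm St ξ p = Real.sqrt (∑ I, ∑ J, ξ I J p ^ 2) := by
  have h1 : ∀ (n : ℕ) (I I' : Fin n → Fin 3),
      ∏ i, (1 : Matrix (Fin 3) (Fin 3) ℝ) (I i) (I' i) = if I = I' then 1 else 0 := by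
    intro n I I'
    simp only [Matrix.one_apply, Finset.prod_ite_zero, Finset.prod_const_one, funext_iff,
      Finset.mem_univ, true_implies]
  unfold pnorm St
  congr 1
  refine Finset.sum_congr rfl fun I _ => ?_
  rw [Finset.sum_eq_single I]
  · refine Finset.sum_congr rfl fun J _ => ?_
    rw [Finset.sum_eq_single J]
    · simp only [inv_one, h1]
      simp [sq]
    · intro J' _ hJ'
      simp only [inv_one, h1]
      simp [hJ'.symm]
    · simp
  · intro I' _ hI'
    simp only [inv_one, h1]
    simp [hI'.symm]
  · simp

theorem abs_le_pnorm_St {l m : ℕ} (ξ : Tensor l m) (I : Fin l → Fin 3) (J : Fin m → Fin 3)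
    (p : S3) : |ξ I J p| ≤ pnorm St ξ p := by
  rw [pnorm_St]
  refine Real.abs_le_sqrt ?_
  calc ξ I J p ^ 2 ≤ ∑ J, ξ I J p ^ 2 :=
        Finset.single_le_sum (f := fun J => ξ I J p ^ 2) (fun _ _ => sq_nonneg _)
          (Finset.mem_univ J)
    _ ≤ ∑ I, ∑ J, ξ I J p ^ 2 :=
        Finset.single_le_sum (f := fun I => ∑ J, ξ I J p ^ 2)
          (fun _ _ => Finset.sum_nonneg fun _ _ => sq_nonneg _) (Finset.mem_univ I)

theorem pnorm_le {l m : ℕ} {h : MatrixField} {ξ : Tensor l m} {p : S3} {H B : ℝ} (hH : 1 ≤ H)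
    (hh : ∀ A B, |h p A B| ≤ H) (hi : ∀ A B, |(h p)⁻¹ A B| ≤ H)
    (hξ : ∀ I J, |ξ I J p| ≤ B) : pnorm h ξ p ≤ 3 ^ (l + m) * H ^ (l + m) * B := by
  have hB : 0 ≤ B := (abs_nonneg _).trans (hξ (fun _ => 0) (fun _ => 0))
  have hH0 : 0 ≤ H := zero_le_one.trans hH
  unfold pnorm
  refine Real.sqrt_le_iff.mpr ⟨by positivity, ?_⟩
  have hterm : ∀ I I' J J', (∏ i, h p (I i) (I' i)) * (∏ j, (h p)⁻¹ (J j) (J' j)) * ξ I J p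
      * ξ I' J' p ≤ H ^ (l + m) * B * B := by
    intro I I' J J'
    refine (le_abs_self _).trans ?_
    rw [abs_mul, abs_mul, abs_mul, Finset.abs_prod, Finset.abs_prod, pow_add]
    have h1 : ∏ i, |h p (I i) (I' i)| ≤ H ^ l := by
      simpa using Finset.prod_le_prod (s := Finset.univ) (f := fun i => |h p (I i) (I' i)|)
        (g := fun _ => H) (fun _ _ => abs_nonneg _) (fun i _ => hh _ _)
    have h2 : ∏ j, |(h p)⁻¹ (J j) (J' j)| ≤ H ^ m := by
      simpa using Finset.prod_le_prod (s := Finset.univ) (f := fun i => |(h p)⁻¹ (J i) (J' i)|)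
        (g := fun _ => H) (fun _ _ => abs_nonneg _) (fun i _ => hi _ _)
    have h3 : 0 ≤ ∏ j, |(h p)⁻¹ (J j) (J' j)| := Finset.prod_nonneg fun _ _ => abs_nonneg _
    have h4 := hξ I J
    have h5 := hξ I' J'
    gcongr
  calc _ ≤ ∑ I : Fin l → Fin 3, ∑ I' : Fin l → Fin 3, ∑ J : Fin m → Fin 3, ∑ J' : Fin m → Fin 3,
        H ^ (l + m) * B * B :=
        Finset.sum_le_sum fun I _ => Finset.sum_le_sum fun I' _ => Finset.sum_le_sum fun J _ =>
          Finset.sum_le_sum fun J' _ => hterm I I' J J'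
    _ = (3 ^ (l + m)) ^ 2 * (H ^ (l + m) * B ^ 2) := by
        simp only [Finset.sum_const, Finset.card_univ, Fintype.card_fun, Fintype.card_fin,
          nsmul_eq_mul]
        push_cast
        ring
    -- A surplus factor `H ^ (l + m) ≥ 1` turns the bound into a perfect square.
    _ ≤ (3 ^ (l + m)) ^ 2 * (H ^ (l + m) * (H ^ (l + m) * B ^ 2)) := by
        have h1 : 1 ≤ H ^ (l + m) := one_le_pow₀ hH
        gcongr
        exact le_mul_of_one_le_left (by positivity) h1
    _ = _ := by ring

theorem supNorm_le {l m : ℕ} {h : MatrixField} {ξ : Tensor l m} {H B : ℝ} (hH : 1 ≤ H)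
    (hh : ∀ p A B, |h p A B| ≤ H) (hi : ∀ p A B, |(h p)⁻¹ A B| ≤ H)
    (hξ : ∀ I J p, |ξ I J p| ≤ B) : supNorm h ξ ≤ 3 ^ (l + m) * H ^ (l + m) * B := by
  have : Nonempty S3 := ⟨radial 0⟩
  exact ciSup_le fun p => pnorm_le hH (hh p) (hi p) fun I J => hξ I J p

/-- The number `B` does not enter the estimate; it only makes the supremum bounded above. -/
theorem abs_le_supNorm_St {l m : ℕ} {ξ : Tensor l m} {B : ℝ} (hξ : ∀ I J p, |ξ I J p| ≤ B)
    (I : Fin l → Fin 3) (J : Fin m → Fin 3) (p : S3) : |ξ I J p| ≤ supNorm St ξ := by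
  refine (abs_le_pnorm_St ξ I J p).trans (le_ciSup (f := fun p => pnorm St ξ p) ?_ p)
  refine ⟨3 ^ (l + m) * 1 ^ (l + m) * B, ?_⟩
  rintro _ ⟨q, rfl⟩
  have h1 : ∀ A B, |(1 : Matrix (Fin 3) (Fin 3) ℝ) A B| ≤ 1 := by
    intro A B
    rw [Matrix.one_apply]
    split_ifs <;> simp
  exact pnorm_le le_rfl (fun A B => h1 A B) (fun A B => by simpa [St] using h1 A B)
    fun I J => hξ I J q

/-- The factor in the bound of `sumSup` by bounds of components. -/
def sumFactor (l m : ℕ) (s : Finset ℕ) : ℝ :=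
  ∑ N ∈ s, 3 ^ N * (3 ^ (l + m) * lieFactor l m ^ N)

theorem sumFactor_nonneg (l m : ℕ) (s : Finset ℕ) : 0 ≤ sumFactor l m s := by
  have := zero_le_one.trans (one_le_lieFactor l m)
  exact Finset.sum_nonneg fun N _ => by positivity

theorem sumSup_le {l m M : ℕ} {s : Finset ℕ} {h : MatrixField} {ξ : Tensor l m} {H B : ℝ}
    (hH : 1 ≤ H) (hh : ∀ p A B, |h p A B| ≤ H) (hi : ∀ p A B, |(h p)⁻¹ A B| ≤ H)
    (hs : ∀ N ∈ s, N ≤ M) (hξ : TensorBound M ξ B) :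
    sumSup h s ξ ≤ sumFactor l m s * (H ^ (l + m) * B) := by
  unfold sumSup sumFactor
  rw [Finset.sum_mul]
  refine Finset.sum_le_sum fun N hN => ?_
  calc _ ≤ ∑ I : Fin N → Fin 3, 3 ^ (l + m) * H ^ (l + m) * (lieFactor l m ^ N * B) :=
        Finset.sum_le_sum fun W _ => supNorm_le hH hh hi fun I J p =>
          ((TensorBound.lieI (N := 0) W fun I J => (hξ I J).of_le (by simpa using hs N hN))
            I J).abs_le p
    _ = _ := by
        simp only [Finset.sum_const, Finset.card_univ, Fintype.card_fun, Fintype.card_fin,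
          nsmul_eq_mul]
        push_cast
        ring

theorem sumSupDt_le {l m M : ℕ} {s : Finset ℕ} {T t B : ℝ} {ξ : ℝ → Tensor l m}
    (hr : ∀ I J, SlabC (M + 1) T (fun t => ξ t I J)) (ht : t ∈ Ico 0 T)
    (hs : ∀ N ∈ s, N ≤ M) (hξ : TensorBound M (timeDeriv T ξ t) B) :
    sumSupDt T St s ξ t ≤ sumFactor l m s * B := by
  have h1 : sumSupDt T St s ξ t = sumSup St s (timeDeriv T ξ t) := by
    unfold sumSupDt sumSup
    refine Finset.sum_congr rfl fun N hN => Finset.sum_congr rfl fun W _ => ?_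
    rw [timeDeriv_lieI W (fun I J => (hr I J).of_le (by have := hs N hN; omega)) ht]
  have h2 : ∀ A B, |(1 : Matrix (Fin 3) (Fin 3) ℝ) A B| ≤ 1 := by
    intro A B
    rw [Matrix.one_apply]
    split_ifs <;> simp
  rw [h1]
  simpa using sumSup_le (h := St) le_rfl (fun p A B => h2 A B)
    (fun p A B => by simpa [St] using h2 A B) hs hξ

theorem abs_le_normC {l m M N : ℕ} {ξ : Tensor l m} (hN : N ≤ M)
    (hξ : ∀ I J, SlabC M 1 (fun _ => ξ I J)) (W : Fin N → Fin 3) (I : Fin l → Fin 3)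
    (J : Fin m → Fin 3) (p : S3) : |lieI W ξ I J p| ≤ normC M ξ := by
  choose B hB using fun I J => exists_derivBound_of_slabC one_pos (hξ I J)
  have h1 : TensorBound (0 + N) ξ (∑ I, ∑ J, |B I J|) := fun I J =>
    ((hB I J).of_le (by simpa using hN)).mono ((le_abs_self _).trans
      ((Finset.single_le_sum (f := fun J => |B I J|) (fun _ _ => abs_nonneg _)
        (Finset.mem_univ J)).trans
        (Finset.single_le_sum (f := fun I => ∑ J, |B I J|)
          (fun _ _ => Finset.sum_nonneg fun _ _ => abs_nonneg _) (Finset.mem_univ I))))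
  refine (abs_le_supNorm_St (fun I J p => (TensorBound.lieI W h1 I J).abs_le p) I J p).trans ?_
  refine (le_abs_self _).trans (Real.abs_le_sqrt ?_)
  calc _ ≤ ∑ W : Fin N → Fin 3, supNorm St (lieI W ξ) ^ 2 :=
        Finset.single_le_sum (f := fun W : Fin N → Fin 3 => supNorm St (lieI W ξ) ^ 2)
          (fun _ _ => sq_nonneg _) (Finset.mem_univ W)
    _ ≤ _ := Finset.single_le_sum
          (f := fun N => ∑ W : Fin N → Fin 3, supNorm St (lieI W ξ) ^ 2)
          (fun _ _ => Finset.sum_nonneg fun _ _ => sq_nonneg _)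
          (Finset.mem_range.mpr (Nat.lt_succ_of_le hN))

theorem TensorBound.of_normC {l m M : ℕ} {ξ : Tensor l m} {b : ℝ}
    (hξ : ∀ I J, SlabC M 1 (fun _ => ξ I J)) (hb : normC M ξ ≤ b) :
    TensorBound M ξ (lieFactor l m ^ M * b) :=
  TensorBound.of_lieI hξ fun _ hN W I J p => (abs_le_normC hN hξ W I J p).trans hb

/-! ### The scale factor -/

theorem le_of_hasDerivWithinAt_le {T : ℝ} {f f' β β' : ℝ → ℝ}
    (hf : ∀ t ∈ Ico 0 T, HasDerivWithinAt f (f' t) (Ico 0 T) t)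
    (hβ : ∀ t ∈ Ico 0 T, HasDerivWithinAt β (β' t) (Ico 0 T) t)
    {t : ℝ} (ht : t ∈ Ico 0 T) (h0 : f 0 ≤ β 0) (h : ∀ s ∈ Icc 0 t, f' s ≤ β' s) :
    f t ≤ β t := by
  have hs : ∀ s ∈ Icc 0 t, s ∈ Ico 0 T := fun s hs => ⟨hs.1, hs.2.trans_lt ht.2⟩
  have hI : ∀ s ∈ Ico 0 t, Ico 0 T ∈ nhdsWithin s (Ici s) := fun s hs' =>
    Filter.mem_of_superset (Ico_mem_nhdsGE (hs'.2.trans ht.2)) (Ico_subset_Ico_left hs'.1)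
  have key := image_le_of_deriv_right_le_deriv_boundary (a := 0) (b := t)
    (f := f) (f' := f') (B := β) (B' := β')
    (fun s hs' => ((hf s (hs s hs')).continuousWithinAt).mono fun x hx => hs x hx)
    (fun s hs' => (hf s (hs s (Ico_subset_Icc_self hs'))).mono_of_mem_nhdsWithin (hI s hs'))
    h0
    (fun s hs' => ((hβ s (hs s hs')).continuousWithinAt).mono fun x hx => hs x hx)
    (fun s hs' => (hβ s (hs s (Ico_subset_Icc_self hs'))).mono_of_mem_nhdsWithin (hI s hs'))
    (fun s hs' => h s (Ico_subset_Icc_self hs'))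
  exact key ⟨ht.1, le_rfl⟩

/-- A time function comparable with the logarithm of the scale factor. -/
def logTime (a : ℝ → ℝ) (t : ℝ) : ℝ := t - Real.log (a t)

namespace IsScaleFactor

variable {T : ℝ} {a : ℝ → ℝ}

theorem hasDerivWithinAt (h : IsScaleFactor T a) {t : ℝ} (ht : t ∈ Ico 0 T) :
    HasDerivWithinAt a (dt T a t) (Ico 0 T) t := (h.diff t ht).hasDerivWithinAt

theorem hasDerivWithinAt_rpow (h : IsScaleFactor T a) {t : ℝ} (ht : t ∈ Ico 0 T) (q : ℝ) :
    HasDerivWithinAt (fun s => a s ^ q) (q * a t ^ (q - 1) * dt T a t) (Ico 0 T) t := by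
  have h1 := (h.hasDerivWithinAt ht).rpow_const (p := q) (Or.inl (h.pos t ht).ne')
  convert h1 using 1
  ring

/-- The differential equation feeds the regularity of `a` back into that of `a'`, so both are raised
together; the cube root is smooth because `a > 0`. -/
theorem contDiffOn_aux (h : IsScaleFactor T a) (N : ℕ) :
    ContDiffOn ℝ N a (Ico 0 T) ∧ ContDiffOn ℝ N (dt T a) (Ico 0 T) := by
  induction N with
  | zero =>
    refine ⟨?_, ?_⟩
    · simpa using h.diff.continuousOn
    · exact contDiffOn_zero.mpr fun t ht => (h.ode t ht).continuousWithinAt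
  | succ N ih =>
    have hu := uniqueDiffOn_Ico (0 : ℝ) T
    refine ⟨?_, ?_⟩
    · push_cast
      rw [contDiffOn_succ_iff_derivWithin hu]
      exact ⟨h.diff, by simp, ih.2⟩
    · push_cast
      rw [contDiffOn_succ_iff_derivWithin hu]
      refine ⟨fun t ht => (h.ode t ht).differentiableWithinAt, by simp, ?_⟩
      have h1 : ContDiffOn ℝ N (fun t => -(2 / 3) * a t ^ (1 / 3 : ℝ)) (Ico 0 T) :=
        contDiffOn_const.mul (ih.1.rpow_const_of_ne fun t ht => (h.pos t ht).ne')
      exact h1.congr fun t ht => (h.ode t ht).derivWithin (hu t ht)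

theorem contDiffOn (h : IsScaleFactor T a) (N : ℕ) : ContDiffOn ℝ N a (Ico 0 T) :=
  (h.contDiffOn_aux N).1

theorem contDiffOn_rpow (h : IsScaleFactor T a) (N : ℕ) (q : ℝ) :
    ContDiffOn ℝ N (fun t => a t ^ q) (Ico 0 T) :=
  (h.contDiffOn N).rpow_const_of_ne fun t ht => (h.pos t ht).ne'

/-- The energy `a'² + a^{4/3}` is conserved and equals 1 initially. -/
theorem dt_sq (h : IsScaleFactor T a) {t : ℝ} (ht : t ∈ Ico 0 T) :
    dt T a t ^ 2 = 1 - a t ^ (4 / 3 : ℝ) := by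
  have key := abs_le_of_hasDerivWithinAt_le (T := T)
    (f := fun t => dt T a t ^ 2 + a t ^ (4 / 3 : ℝ) - 1) (f' := fun _ => 0)
    (β := fun _ => 0) (β' := fun _ => 0) (fun t ht => ?_)
    (fun t _ => hasDerivWithinAt_const t _ _) ht (by simp [h.init, h.init_deriv]) (by simp)
  · have h1 := abs_nonpos_iff.mp key
    linarith
  · have h1 := (((h.ode t ht).pow 2).add (h.hasDerivWithinAt_rpow ht (4 / 3))).sub_const 1
    refine h1.congr_deriv ?_
    rw [show (4 / 3 : ℝ) - 1 = 1 / 3 by norm_num]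
    push_cast
    ring

theorem dt_nonpos (h : IsScaleFactor T a) {t : ℝ} (ht : t ∈ Ico 0 T) : dt T a t ≤ 0 :=
  le_of_hasDerivWithinAt_le h.ode (fun t _ => hasDerivWithinAt_const t _ (0 : ℝ)) ht
    h.init_deriv.le fun s hs => by
      have h1 := Real.rpow_nonneg (h.pos s ⟨hs.1, hs.2.trans_lt ht.2⟩).le (1 / 3 : ℝ)
      linarith

theorem le_one (h : IsScaleFactor T a) {t : ℝ} (ht : t ∈ Ico 0 T) : a t ≤ 1 :=
  le_of_hasDerivWithinAt_le (fun _ ht => h.hasDerivWithinAt ht)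
    (fun t _ => hasDerivWithinAt_const t _ (1 : ℝ)) ht
    h.init.le fun _ hs => h.dt_nonpos ⟨hs.1, hs.2.trans_lt ht.2⟩

theorem abs_dt_le_one (h : IsScaleFactor T a) {t : ℝ} (ht : t ∈ Ico 0 T) : |dt T a t| ≤ 1 := by
  have h1 := h.dt_sq ht
  have h2 := Real.rpow_nonneg (h.pos t ht).le (4 / 3 : ℝ)
  rw [abs_le]
  constructor <;> nlinarith

/-- Sturm comparison with `cos (4t/5)`. As `a ≤ 1`, one has `a'' = -(2/3) a^{1/3} ≤ -(16/25) a`, so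
`a' cos + (4/5) a sin` does not increase from its initial value 0. At `t = 5π/8 < 2` it would equal
`(4/5) a`, contradicting positivity. -/
theorem le_two (h : IsScaleFactor T a) {t : ℝ} (ht : t ∈ Ico 0 T) : t ≤ 2 := by
  by_contra! h2
  have hpi := Real.pi_lt_d2
  have hpi0 := Real.pi_pos
  have h0 : Real.pi * (5 / 8) ∈ Ico 0 T := ⟨by positivity, by linarith [ht.2]⟩
  have hcos : ∀ s : ℝ, HasDerivAt (fun s => Real.cos (4 / 5 * s))
      (-Real.sin (4 / 5 * s) * (4 / 5)) s := fun s => by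
    simpa using ((hasDerivAt_id s).const_mul (4 / 5)).cos
  have hsin : ∀ s : ℝ, HasDerivAt (fun s => Real.sin (4 / 5 * s))
      (Real.cos (4 / 5 * s) * (4 / 5)) s := fun s => by
    simpa using ((hasDerivAt_id s).const_mul (4 / 5)).sin
  have key := le_of_hasDerivWithinAt_le (T := T)
    (f := fun s => dt T a s * Real.cos (4 / 5 * s) + 4 / 5 * (a s * Real.sin (4 / 5 * s)))
    (fun s hs => ((h.ode s hs).mul (hcos s).hasDerivWithinAt).add
      (((h.hasDerivWithinAt hs).mul (hsin s).hasDerivWithinAt).const_mul (4 / 5)))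
    (fun t _ => hasDerivWithinAt_const t _ (0 : ℝ)) h0 (by simp [h.init_deriv]) (fun s hs => ?_)
  · have he : (4 / 5 : ℝ) * (Real.pi * (5 / 8)) = Real.pi / 2 := by ring
    simp only [he, Real.cos_pi_div_two, Real.sin_pi_div_two] at key
    have := h.pos _ h0
    linarith
  · have hs' : s ∈ Ico 0 T := ⟨hs.1, hs.2.trans_lt h0.2⟩
    have hc : 0 ≤ Real.cos (4 / 5 * s) :=
      Real.cos_nonneg_of_neg_pi_div_two_le_of_le (by linarith [hs.1]) (by linarith [hs.2])
    have ha := h.pos s hs'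
    have h1 : a s ≤ a s ^ (1 / 3 : ℝ) := by
      simpa using Real.rpow_le_rpow_of_exponent_ge ha (h.le_one hs') (show (1 / 3 : ℝ) ≤ 1 by norm_num)
    have h3 : 0 ≤ Real.cos (4 / 5 * s) * (2 / 3 * a s ^ (1 / 3 : ℝ) - 16 / 25 * a s) :=
      mul_nonneg hc (by linarith)
    linarith

theorem hasDerivWithinAt_logTime (h : IsScaleFactor T a) {t : ℝ} (ht : t ∈ Ico 0 T) :
    HasDerivWithinAt (logTime a) (1 - dt T a t / a t) (Ico 0 T) t :=
  (hasDerivWithinAt_id t _).sub ((h.hasDerivWithinAt ht).log (h.pos t ht).ne')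

/-- The claim is `a - a' ≥ 1`, which follows from `a'² = 1 - a^{4/3} ≥ 1 - a ≥ (1 - a)²`. The
summand `t` in `logTime` is needed near `t = 0`, where `a' = 0` and `-log a` alone has no growth. -/
theorem inv_le_deriv_logTime (h : IsScaleFactor T a) {t : ℝ} (ht : t ∈ Ico 0 T) :
    (a t)⁻¹ ≤ 1 - dt T a t / a t := by
  have ha := h.pos t ht
  have h1 := h.le_one ht
  have h2 := h.dt_nonpos ht
  have h3 := h.dt_sq ht
  have h4 : a t ^ (4 / 3 : ℝ) ≤ a t := by
    simpa using Real.rpow_le_rpow_of_exponent_ge ha h1 (show (1 : ℝ) ≤ 4 / 3 by norm_num)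
  have h5 : 1 - a t ≤ -dt T a t := by
    refine abs_le_of_sq_le_sq' ?_ (by linarith) |>.2
    nlinarith
  rw [inv_eq_one_div, ← sub_nonneg]
  have h6 : 1 - dt T a t / a t - 1 / a t = (a t - dt T a t - 1) / a t := by
    field_simp
  rw [h6]
  exact div_nonneg (by linarith) ha.le

theorem logTime_zero (h : IsScaleFactor T a) : logTime a 0 = 0 := by
  simp [logTime, h.init]

theorem logTime_nonneg (h : IsScaleFactor T a) {t : ℝ} (ht : t ∈ Ico 0 T) : 0 ≤ logTime a t := by
  have h1 := Real.log_nonpos (h.pos t ht).le (h.le_one ht)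
  have h2 := ht.1
  unfold logTime
  linarith

/-- The two exponentials differ by the factor `exp (θ t)`, and `0 ≤ t ≤ 2`. Hence bounds can be
carried in terms of `logTime` and converted to powers of `a` at the end. -/
theorem exp_mul_logTime_le (h : IsScaleFactor T a) {t θ : ℝ} (ht : t ∈ Ico 0 T) (hθ : 0 ≤ θ) :
    Real.exp (θ * logTime a t) ≤ Real.exp (2 * θ) * a t ^ (-θ) := by
  rw [Real.rpow_def_of_pos (h.pos t ht), ← Real.exp_add, logTime]
  apply Real.exp_le_exp.mpr
  have := h.le_two ht
  nlinarith

theorem rpow_neg_le_exp (h : IsScaleFactor T a) {t θ : ℝ} (ht : t ∈ Ico 0 T) (hθ : 0 ≤ θ) :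
    a t ^ (-θ) ≤ Real.exp (θ * logTime a t) := by
  rw [Real.rpow_def_of_pos (h.pos t ht), logTime]
  apply Real.exp_le_exp.mpr
  have := ht.1
  nlinarith

end IsScaleFactor

/-! ### Behaviour of the geometric operators under constant rescalings of the metric -/

theorem hess_eq (h : MatrixField) (f : S3 → ℝ) (A B : Fin 3) (p : S3) :
    hess h f A B p = Zder A (Zder B f) p - ∑ D, conn h A D B p * Zder D f p := by
  have h1 : formT (fun A => Zder A f) ![] ![B] = Zder B f := rfl
  simp [hess, covD, dT, h1]
  simp [formT]

theorem inv_const_smul {c : ℝ} (hc : c ≠ 0) {M : Matrix (Fin 3) (Fin 3) ℝ} (hM : IsUnit M.det) :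
    (c • M)⁻¹ = c⁻¹ • M⁻¹ :=
  Matrix.inv_smul' M (Units.mk0 c hc) hM

theorem gammaLow_const_smul (c : ℝ) (h : MatrixField) (A C B : Fin 3) (p : S3) :
    gammaLow (fun p => c • h p) A C B p = c * gammaLow h A C B p := by
  simp only [gammaLow, Matrix.smul_apply, smul_eq_mul, Zder_const_mul, Fin.sum_univ_three]
  ring

/-- The Koszul expression is linear in the metric and the inverse metric scales oppositely. The
curvature operators then scale only through the indices raised. -/
theorem conn_const_smul {c : ℝ} (hc : c ≠ 0) {h : MatrixField} (hh : ∀ p, IsUnit (h p).det)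
    (A D B : Fin 3) : conn (fun p => c • h p) A D B = conn h A D B := by
  funext p
  simp only [conn, gammaLow_const_smul, inv_const_smul hc (hh p), Matrix.smul_apply, smul_eq_mul]
  refine Finset.sum_congr rfl fun C _ => ?_
  field_simp

theorem RicSharp_const_smul {c : ℝ} (hc : c ≠ 0) {h : MatrixField} (hh : ∀ p, IsUnit (h p).det)
    (p : S3) : RicSharp (fun p => c • h p) p = c⁻¹ • RicSharp h p := by
  have h1 : Ric (fun p => c • h p) p = Ric h p := by
    ext B C
    simp only [Ric, curv, conn_const_smul hc hh]
  rw [RicSharp, RicSharp, h1, inv_const_smul hc (hh p), Matrix.smul_mul]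

theorem hess_const_smul {c : ℝ} (hc : c ≠ 0) {h : MatrixField} (hh : ∀ p, IsUnit (h p).det)
    (f : S3 → ℝ) (A B : Fin 3) (p : S3) :
    hess (fun p => c • h p) f A B p = hess h f A B p := by
  simp only [hess_eq, conn_const_smul hc hh]

theorem lap_const_smul {c : ℝ} (hc : c ≠ 0) {h : MatrixField} (hh : ∀ p, IsUnit (h p).det)
    (f : S3 → ℝ) (p : S3) : lap (fun p => c • h p) f p = c⁻¹ * lap h f p := by
  simp only [lap, hess_const_smul hc hh, inv_const_smul hc (hh p), Matrix.smul_apply, smul_eq_mul,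
    Finset.mul_sum, mul_assoc]

theorem gradInner_const_smul {c : ℝ} (hc : c ≠ 0) {h : MatrixField} (hh : ∀ p, IsUnit (h p).det)
    (f f' : S3 → ℝ) (p : S3) :
    gradInner (fun p => c • h p) f f' p = c⁻¹ * gradInner h f f' p := by
  simp only [gradInner, inv_const_smul hc (hh p), Matrix.smul_apply, smul_eq_mul,
    Finset.mul_sum, mul_assoc]

theorem Zder_affine (c b : ℝ) (f : S3 → ℝ) (A : Fin 3) :
    Zder A (fun p => c + b * f p) = fun p => b * Zder A f p := by
  have h := Zder_sub_const (-c) (fun p => b * f p) A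
  rw [Zder_const_mul] at h
  rw [← h]
  congr 1
  funext p
  ring

theorem hess_affine (h : MatrixField) (c b : ℝ) (f : S3 → ℝ) (A B : Fin 3) (p : S3) :
    hess h (fun p => c + b * f p) A B p = b * hess h f A B p := by
  simp only [hess_eq, Zder_affine, Zder_const_mul, mul_sub, Finset.mul_sum]
  congr 1
  refine Finset.sum_congr rfl fun D _ => ?_
  ring

theorem lap_affine (h : MatrixField) (c b : ℝ) (f : S3 → ℝ) (p : S3) :
    lap h (fun p => c + b * f p) p = b * lap h f p := by
  simp only [lap, hess_affine, Finset.mul_sum]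
  refine Finset.sum_congr rfl fun A _ => Finset.sum_congr rfl fun B _ => ?_
  ring

theorem gradInner_affine_left (h : MatrixField) (c b : ℝ) (f f' : S3 → ℝ) (p : S3) :
    gradInner h (fun p => c + b * f p) f' p = b * gradInner h f f' p := by
  simp only [gradInner, Zder_affine, Finset.mul_sum]
  refine Finset.sum_congr rfl fun A _ => Finset.sum_congr rfl fun B _ => ?_
  ring

/-! ### Regularity of the rescaled variables -/

theorem SlabC.prod {ι : Type*} {N : ℕ} {T : ℝ} {s : Finset ι} {u : ι → ℝ → S3 → ℝ}
    (hu : ∀ i ∈ s, SlabC N T (u i)) : SlabC N T (fun t p => ∏ i ∈ s, u i t p) :=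
  contDiffOn_prod hu

theorem slabC_det {N : ℕ} {T : ℝ} {M : ℝ → MatrixField}
    (h : ∀ A B, SlabC N T (fun t p => M t p A B)) : SlabC N T (fun t p => (M t p).det) := by
  simp only [Matrix.det_apply']
  exact SlabC.sum fun σ _ => (slabC_const N T _).mul (SlabC.prod fun i _ => h _ _)

/-- Cramer's rule: the entries are quotients of determinants. -/
theorem slabC_matrix_inv {N : ℕ} {T : ℝ} {M : ℝ → MatrixField}
    (h : ∀ A B, SlabC N T (fun t p => M t p A B))
    (hd : ∀ t ∈ Ico 0 T, ∀ p, (M t p).det ≠ 0) (A B : Fin 3) :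
    SlabC N T (fun t p => (M t p)⁻¹ A B) := by
  simp only [Matrix.inv_def, Matrix.smul_apply, smul_eq_mul, Ring.inverse_eq_inv',
    Matrix.adjugate_apply]
  refine ((slabC_det h).inv hd).mul (slabC_det (M := fun t p =>
    (M t p).updateRow B (Pi.single A 1)) fun C D => ?_)
  by_cases hC : C = B
  · subst hC
    simp only [Matrix.updateRow_self]
    exact slabC_const N T _
  · simp only [Matrix.updateRow_ne hC]
    exact h C D

section Rescaled

variable {T : ℝ} {a : ℝ → ℝ} {g k : ℝ → MatrixField} {n φ : ℝ → S3 → ℝ}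

theorem slabC_resMetric (ha : IsScaleFactor T a) (h : IsSolution T a g k n φ) (A B : Fin 3) :
    SlabC 17 T (fun t p => resMetric a g t p A B) :=
  (slabC_of_time (ha.contDiffOn_rpow 17 _)).mul (h.reg_g A B)

theorem isUnit_det_metric (h : IsSolution T a g k n φ) {t : ℝ} (ht : t ∈ Ico 0 T) (p : S3) :
    IsUnit (g t p).det := (h.metric t ht p).det_pos.ne'.isUnit

theorem isUnit_det_resMetric (ha : IsScaleFactor T a) (h : IsSolution T a g k n φ) {t : ℝ}
    (ht : t ∈ Ico 0 T) (p : S3) : IsUnit (resMetric a g t p).det := by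
  rw [resMetric, Matrix.det_smul]
  exact (mul_ne_zero (pow_ne_zero _ (Real.rpow_pos_of_pos (ha.pos t ht) _).ne')
    (isUnit_det_metric h ht p).ne_zero).isUnit

theorem slabC_resInv (ha : IsScaleFactor T a) (h : IsSolution T a g k n φ) (A B : Fin 3) :
    SlabC 17 T (fun t p => resInv a g t p A B) :=
  slabC_matrix_inv (slabC_resMetric ha h)
    (fun _ ht p => (isUnit_det_resMetric ha h ht p).ne_zero) A B

theorem slabC_resK (ha : IsScaleFactor T a) (h : IsSolution T a g k n φ) (A B : Fin 3) :
    SlabC 16 T (fun t p => resK a k t p A B) := by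
  refine (slabC_of_time (ha.contDiffOn 16)).mul ((h.reg_k A B).sub
    (((slabC_const 16 T (1 / 3)).mul ?_).mul (slabC_const 16 T _)))
  exact SlabC.sum fun C _ => h.reg_k C C

theorem slabC_resLapse (ha : IsScaleFactor T a) (h : IsSolution T a g k n φ) :
    SlabC 18 T (resLapse a n) :=
  (slabC_of_time (ha.contDiffOn_rpow 18 _)).mul (h.reg_n.sub (slabC_const 18 T 1))

theorem slabC_normalDeriv (h : IsSolution T a g k n φ) :
    SlabC 16 T (fun t p => normalDeriv T n φ t p) :=
  ((h.reg_n.of_le (by norm_num)).inv fun t ht p => (h.lapse_pos t ht p).ne').mul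
    (SlabC.dt (N := 16) h.reg_φ)

theorem slabC_timeScalar (ha : IsScaleFactor T a) (h : IsSolution T a g k n φ) :
    SlabC 16 T (fun t p => timeScalar T a n φ t p) :=
  ((slabC_of_time (ha.contDiffOn 16)).mul (slabC_normalDeriv h)).sub (slabC_const 16 T _)

theorem slabC_dT (h : IsSolution T a g k n φ) (A : Fin 3) :
    SlabC 16 T (fun t => Zder A (φ t)) := SlabC.zder (N := 16) h.reg_φ A

/-! ### Evolution equations of the rescaled variables -/

/-- With the cube root as variable, all powers of the scale factor become integral, and the rescaled
equations can be checked by `field_simp` and `ring`. -/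
theorem rpow_thirds {r : ℝ} (hr : 0 < r) : r = (r ^ (1 / 3 : ℝ)) ^ 3 ∧
    r ^ (-(2 / 3) : ℝ) = ((r ^ (1 / 3 : ℝ)) ^ 2)⁻¹ ∧ r ^ (4 / 3 : ℝ) = (r ^ (1 / 3 : ℝ)) ^ 4 ∧
    r ^ (-(4 / 3) : ℝ) = ((r ^ (1 / 3 : ℝ)) ^ 4)⁻¹ := by
  have h : ∀ m : ℕ, (r ^ (1 / 3 : ℝ)) ^ m = r ^ ((m : ℝ) / 3) := fun m => by
    rw [← Real.rpow_natCast, ← Real.rpow_mul hr.le]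
    congr 1
    ring
  refine ⟨?_, ?_, ?_, ?_⟩
  · rw [h]; norm_num
  · rw [h, ← Real.rpow_neg hr.le]; norm_num
  · rw [h]; norm_num
  · rw [h, ← Real.rpow_neg hr.le]; norm_num

/-- The cube root of the scale factor. -/
def cbrt (a : ℝ → ℝ) (t : ℝ) : ℝ := a t ^ (1 / 3 : ℝ)

theorem cbrt_pos (ha : IsScaleFactor T a) {t : ℝ} (ht : t ∈ Ico 0 T) : 0 < cbrt a t :=
  Real.rpow_pos_of_pos (ha.pos t ht) _

theorem cbrt_le_one (ha : IsScaleFactor T a) {t : ℝ} (ht : t ∈ Ico 0 T) : cbrt a t ≤ 1 :=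
  Real.rpow_le_one (ha.pos t ht).le (ha.le_one ht) (by norm_num)

theorem cbrt_pow_three (ha : IsScaleFactor T a) {t : ℝ} (ht : t ∈ Ico 0 T) :
    a t = cbrt a t ^ 3 := (rpow_thirds (ha.pos t ht)).1

theorem dt_sq_cbrt (ha : IsScaleFactor T a) {t : ℝ} (ht : t ∈ Ico 0 T) :
    dt T a t ^ 2 = 1 - cbrt a t ^ 4 := by
  rw [ha.dt_sq ht, (rpow_thirds (ha.pos t ht)).2.2.1]
  rfl

theorem lapse_eq (ha : IsScaleFactor T a) {t : ℝ} (ht : t ∈ Ico 0 T) :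
    n t = fun p => 1 + cbrt a t ^ 4 * resLapse a n t p := by
  funext p
  have hx := cbrt_pos ha ht
  rw [resLapse, (rpow_thirds (ha.pos t ht)).2.2.2]
  change _ = 1 + cbrt a t ^ 4 * ((cbrt a t ^ 4)⁻¹ * _)
  field_simp
  ring

theorem resMetric_eq (ha : IsScaleFactor T a) {t : ℝ} (ht : t ∈ Ico 0 T) :
    resMetric a g t = fun p => (cbrt a t ^ 2)⁻¹ • g t p := by
  funext p
  rw [resMetric, (rpow_thirds (ha.pos t ht)).2.1]
  rfl

theorem resK_apply (ha : IsScaleFactor T a) (h : IsSolution T a g k n φ) {t : ℝ}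
    (ht : t ∈ Ico 0 T) (p : S3) (A B : Fin 3) :
    resK a k t p A B = a t * k t p A B + (1 / 3) * dt T a t * (1 : Matrix _ _ ℝ) A B := by
  have h1 := (ha.pos t ht).ne'
  simp only [resK, traceFree, h.cmc t ht p, hubble, Matrix.smul_apply, Matrix.sub_apply,
    smul_eq_mul]
  field_simp
  ring

/-- The logarithmic rate of change of the rescaled metric, multiplied by the scale factor. -/
def metricRate (T : ℝ) (a : ℝ → ℝ) (k : ℝ → MatrixField) (n : ℝ → S3 → ℝ) (t : ℝ) :
    MatrixField := fun p =>
  (-2 * n t p) • resK a k t p + (2 / 3 * cbrt a t ^ 4 * dt T a t * resLapse a n t p) • 1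

/-- The weight `a^{-2/3}` removes the homogeneous part of the expansion. Besides the trace-free part
only `(n - 1) a'/a` survives, which is smaller by the factor `r⁴`. -/
theorem evol_resMetric (ha : IsScaleFactor T a) (h : IsSolution T a g k n φ) {t : ℝ}
    (ht : t ∈ Ico 0 T) (p : S3) (A B : Fin 3) :
    dt T (fun s => resMetric a g s p A B) t
      = (a t)⁻¹ * (resMetric a g t p * metricRate T a k n t p) A B := by
  have hx := cbrt_pos ha ht
  have h1 := (ha.hasDerivWithinAt_rpow ht (-(2 / 3))).mul
    (SlabC.hasDerivWithinAt_dt (N := 16) (h.reg_g A B) ht p)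
  have h2 : a t ^ (-(2 / 3) - 1 : ℝ) = (cbrt a t ^ 5)⁻¹ := by
    rw [Real.rpow_sub_one (ha.pos t ht).ne', (rpow_thirds (ha.pos t ht)).2.1]
    change (cbrt a t ^ 2)⁻¹ / _ = _
    rw [cbrt_pow_three ha ht]
    field_simp
  have hk : k t p = (a t)⁻¹ • resK a k t p - ((1 / 3) * (a t)⁻¹ * dt T a t) • 1 := by
    ext C D
    have := (ha.pos t ht).ne'
    simp only [Matrix.sub_apply, Matrix.smul_apply, smul_eq_mul, resK_apply ha h ht]
    field_simp
    ring
  have h3 : ∑ C, g t p A C * k t p C B = (g t p * k t p) A B := (Matrix.mul_apply).symm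
  rw [h.evol_g t ht p A B, h3, h2, (rpow_thirds (ha.pos t ht)).2.1] at h1
  refine (dt_eq h1 ht).trans ?_
  have hn := congrFun (lapse_eq (n := n) ha ht) p
  rw [resMetric_eq ha ht, metricRate, hk]
  change _ * g t p A B + (cbrt a t ^ 2)⁻¹ * _ = _
  rw [cbrt_pow_three ha ht]
  simp only [Matrix.mul_add, Matrix.mul_sub, Matrix.mul_smul, Matrix.smul_mul, Matrix.mul_one,
    Matrix.add_apply, Matrix.sub_apply, Matrix.smul_apply, smul_eq_mul]
  generalize resLapse a n t p = ν at hn ⊢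
  rw [hn]
  field_simp
  ring

/-- Differentiate `G G⁻¹ = 1` and multiply by `G⁻¹` from the left. -/
theorem evol_resInv (ha : IsScaleFactor T a) (h : IsSolution T a g k n φ) {t : ℝ}
    (ht : t ∈ Ico 0 T) (p : S3) (A B : Fin 3) :
    dt T (fun s => resInv a g s p A B) t
      = -((a t)⁻¹ * (metricRate T a k n t p * resInv a g t p) A B) := by
  set D : Matrix (Fin 3) (Fin 3) ℝ :=
    Matrix.of fun A B => dt T (fun s => resInv a g s p A B) t with hD
  have h1 : (a t)⁻¹ • (resMetric a g t p * metricRate T a k n t p) * resInv a g t p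
      + resMetric a g t p * D = 0 := by
    ext A B
    have h2 : HasDerivWithinAt (fun s => ∑ C, resMetric a g s p A C * resInv a g s p C B)
        (∑ C, (dt T (fun s => resMetric a g s p A C) t * resInv a g t p C B
          + resMetric a g t p A C * dt T (fun s => resInv a g s p C B) t)) (Ico 0 T) t :=
      HasDerivWithinAt.fun_sum fun C _ =>
        (SlabC.hasDerivWithinAt_dt (N := 16) (slabC_resMetric ha h A C) ht p).mul
          (SlabC.hasDerivWithinAt_dt (N := 16) (slabC_resInv ha h C B) ht p)
    have h3 : HasDerivWithinAt (fun s => ∑ C, resMetric a g s p A C * resInv a g s p C B)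
        0 (Ico 0 T) t := by
      refine (hasDerivWithinAt_const t (Ico 0 T) ((1 : Matrix (Fin 3) (Fin 3) ℝ) A B)).congr
        (fun s hs => ?_) ?_
      · rw [← Matrix.mul_apply, resInv, Matrix.mul_nonsing_inv _ (isUnit_det_resMetric ha h hs p)]
      · rw [← Matrix.mul_apply, resInv, Matrix.mul_nonsing_inv _ (isUnit_det_resMetric ha h ht p)]
    have h4 := (dt_eq h2 ht).symm.trans (dt_eq h3 ht)
    simp only [evol_resMetric ha h ht] at h4
    rw [Matrix.add_apply, Matrix.mul_apply, Matrix.mul_apply, ← Finset.sum_add_distrib]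
    exact h4
  have hinv : resInv a g t p * resMetric a g t p = 1 :=
    Matrix.nonsing_inv_mul _ (isUnit_det_resMetric ha h ht p)
  have h2 := congrArg (fun M => resInv a g t p * M) h1
  simp only [Matrix.smul_mul, Matrix.mul_add, Matrix.mul_smul, Matrix.mul_zero] at h2
  rw [← Matrix.mul_assoc (resInv a g t p) (resMetric a g t p) D, Matrix.mul_assoc
    (resMetric a g t p), ← Matrix.mul_assoc (resInv a g t p), hinv, Matrix.one_mul,
    Matrix.one_mul] at h2
  have h3 := congrFun (congrFun (eq_neg_of_add_eq_zero_right h2) A) B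
  exact h3

theorem scale_ne (ha : IsScaleFactor T a) {t : ℝ} (ht : t ∈ Ico 0 T) :
    (cbrt a t ^ 2)⁻¹ ≠ 0 := inv_ne_zero (pow_ne_zero _ (cbrt_pos ha ht).ne')

/-- By `resK_apply`, `K = a k + (a'/3) Id`. The contribution `a''/3 = -(2/9) a^{1/3}` is exactly
what subtracts the round Ricci tensor, so every term on the right is small and carries a factor `r`.
-/
theorem evol_resK (ha : IsScaleFactor T a) (h : IsSolution T a g k n φ) {t : ℝ}
    (ht : t ∈ Ico 0 T) (p : S3) (A B : Fin 3) :
    dt T (fun s => resK a k s p A B) t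
      = -(cbrt a t * dt T a t * (resLapse a n t p * resK a k t p A B))
        + cbrt a t * ((1 / 3) * dt T a t ^ 2 * (1 : Matrix _ _ ℝ) A B * resLapse a n t p)
        - cbrt a t ^ 5 * ∑ C, resInv a g t p A C * hess (resMetric a g t) (resLapse a n t) C B p
        + cbrt a t * (n t p * (RicSharp (resMetric a g t) p A B
            - (2 / 9) * (1 : Matrix _ _ ℝ) A B))
        + cbrt a t ^ 5 * ((2 / 9) * (1 : Matrix _ _ ℝ) A B * resLapse a n t p)
        - cbrt a t * (n t p * ((∑ C, resInv a g t p A C * Zder C (φ t) p) * Zder B (φ t) p)) := by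
  have hx := cbrt_pos ha ht
  have hu : ∀ p, IsUnit (g t p).det := isUnit_det_metric h ht
  have h1 : HasDerivWithinAt (fun s => a s * k s p A B
      + (1 / 3) * dt T a s * (1 : Matrix (Fin 3) (Fin 3) ℝ) A B) _ (Ico 0 T) t :=
    ((ha.hasDerivWithinAt ht).mul
      (SlabC.hasDerivWithinAt_dt (N := 15) (h.reg_k A B) ht p)).add
      (((ha.ode t ht).const_mul (1 / 3)).mul_const _)
  rw [dt_congr (fun s hs => resK_apply ha h hs p A B) ht, dt_eq h1 ht, h.evol_k t ht p A B]
  have hinv : ∀ C, resInv a g t p A C = cbrt a t ^ 2 * (g t p)⁻¹ A C := fun C => by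
    rw [resInv, resMetric_eq ha ht, inv_const_smul (scale_ne ha ht) (hu p), inv_inv]
    rfl
  have hR : RicSharp (resMetric a g t) p A B = cbrt a t ^ 2 * RicSharp (g t) p A B := by
    rw [resMetric_eq ha ht, RicSharp_const_smul (scale_ne ha ht) hu, inv_inv]
    rfl
  have hH : ∀ C, hess (g t) (n t) C B p
      = cbrt a t ^ 4 * hess (resMetric a g t) (resLapse a n t) C B p := fun C => by
    rw [resMetric_eq ha ht, hess_const_smul (scale_ne ha ht) hu, lapse_eq (n := n) ha ht, hess_affine]
  have hK := resK_apply ha h ht p A B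
  have hn := congrFun (lapse_eq (n := n) ha ht) p
  simp only [hH, hinv, hR, hubble]
  generalize resLapse a n t p = ν at hn ⊢
  rw [hn, hK]
  simp only [mul_assoc, ← Finset.mul_sum]
  have e1 : ∑ C, (g t p)⁻¹ A C * (cbrt a t ^ 4 *
      hess (resMetric a g t) (resLapse a n t) C B p) = cbrt a t ^ 4 *
      ∑ C, (g t p)⁻¹ A C * hess (resMetric a g t) (resLapse a n t) C B p := by
    rw [Finset.mul_sum]
    exact Finset.sum_congr rfl fun C _ => by ring
  rw [e1]
  generalize ∑ C, (g t p)⁻¹ A C * hess (resMetric a g t) (resLapse a n t) C B p = X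
  generalize ∑ C, (g t p)⁻¹ A C * Zder C (φ t) p = Y
  generalize RicSharp (g t) p A B = R
  generalize Zder B (φ t) p = W
  generalize k t p A B = κ
  generalize (1 : Matrix (Fin 3) (Fin 3) ℝ) A B = δ
  generalize dt T a t = a'
  change _ + 1 / 3 * (-(2 / 3) * (cbrt a t * δ)) = _
  rw [cbrt_pow_three ha ht]
  field_simp
  ring

theorem evol_timeScalar (ha : IsScaleFactor T a) (h : IsSolution T a g k n φ) {t : ℝ}
    (ht : t ∈ Ico 0 T) (p : S3) :
    dt T (fun s => timeScalar T a n φ s p) t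
      = -(cbrt a t * dt T a t * (resLapse a n t p * (timeScalar T a n φ t p + Real.sqrt (2 / 3))))
        + cbrt a t * (n t p * lap (resMetric a g t) (φ t) p)
        + cbrt a t ^ 5 * gradInner (resMetric a g t) (resLapse a n t) (φ t) p := by
  have hx := cbrt_pos ha ht
  have hu : ∀ p, IsUnit (g t p).det := isUnit_det_metric h ht
  have h1 := ((ha.hasDerivWithinAt ht).mul
    (SlabC.hasDerivWithinAt_dt (N := 15) (slabC_normalDeriv h) ht p)).sub_const (Real.sqrt (2 / 3))
  refine (dt_eq h1 ht).trans ?_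
  have hw := h.wave t ht p
  have hL : lap (g t) (φ t) p = (cbrt a t ^ 2)⁻¹ * lap (resMetric a g t) (φ t) p := by
    rw [resMetric_eq ha ht, lap_const_smul (scale_ne ha ht) hu]
    field_simp
  have hG : gradInner (g t) (n t) (φ t) p
      = cbrt a t ^ 2 * gradInner (resMetric a g t) (resLapse a n t) (φ t) p := by
    rw [resMetric_eq ha ht, gradInner_const_smul (scale_ne ha ht) hu, lapse_eq (n := n) ha ht,
      gradInner_affine_left]
    field_simp
  rw [hL, hG, hubble] at hw
  have hnp := (h.lapse_pos t ht p).ne'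
  have hn := congrFun (lapse_eq (n := n) ha ht) p
  have hΨ : timeScalar T a n φ t p = a t * normalDeriv T n φ t p - Real.sqrt (2 / 3) := rfl
  have hw2 : dt T (fun s => normalDeriv T n φ s p) t = n t p *
      ((cbrt a t ^ 2)⁻¹ * lap (resMetric a g t) (φ t) p
        - dt T a t / a t * normalDeriv T n φ t p)
      + cbrt a t ^ 2 * gradInner (resMetric a g t) (resLapse a n t) (φ t) p := by
    have hnn := mul_inv_cancel₀ hnp
    linear_combination (-n t p) * hw - (dt T (fun s => normalDeriv T n φ s p) t
      - cbrt a t ^ 2 * gradInner (resMetric a g t) (resLapse a n t) (φ t) p) * hnn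
  rw [hw2, hΨ]
  generalize resLapse a n t p = ν at hn ⊢
  rw [hn, cbrt_pow_three ha ht]
  field_simp
  ring

/-- The definition of `Ψ` solved for `∂ₜφ`, followed by a frame derivative. -/
theorem evol_dT (ha : IsScaleFactor T a) (h : IsSolution T a g k n φ) {t : ℝ}
    (ht : t ∈ Ico 0 T) (A : Fin 3) (p : S3) :
    dt T (fun s => Zder A (φ s) p) t = (a t)⁻¹ *
      Zder A (fun p => n t p * (timeScalar T a n φ t p + Real.sqrt (2 / 3))) p := by
  rw [SlabC.dt_zder (h.reg_φ.of_le (by norm_num)) ht, ← congrFun (Zder_const_mul _ _ _) p]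
  congr 1
  funext q
  have h1 := (h.lapse_pos t ht q).ne'
  have h2 := (ha.pos t ht).ne'
  rw [timeScalar, normalDeriv]
  field_simp
  ring

/-- The lapse equation of the rescaled lapse, after insertion of the Hamiltonian constraint. -/
theorem resLapse_elliptic (ha : IsScaleFactor T a) (h : IsSolution T a g k n φ) {t : ℝ}
    (ht : t ∈ Ico 0 T) (p : S3) :
    (1 - cbrt a t ^ 4 / 3) * resLapse a n t p
      = cbrt a t ^ 4 * lap (resMetric a g t) (resLapse a n t) p
        - n t p * (((RicSharp (resMetric a g t) p).trace - 2 / 3)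
          - gradInner (resMetric a g t) (φ t) (φ t) p) := by
  have hx := cbrt_pos ha ht
  have hu : ∀ p, IsUnit (g t p).det := isUnit_det_metric h ht
  have h1 := h.lapse t ht p
  have h2 := h.hamiltonian t ht p
  have hL : lap (g t) (n t) p
      = cbrt a t ^ 2 * lap (resMetric a g t) (resLapse a n t) p := by
    rw [resMetric_eq ha ht, lap_const_smul (scale_ne ha ht) hu, lapse_eq (n := n) ha ht,
      lap_affine]
    field_simp
  have hG : gradInner (g t) (φ t) (φ t) p
      = (cbrt a t ^ 2)⁻¹ * gradInner (resMetric a g t) (φ t) (φ t) p := by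
    rw [resMetric_eq ha ht, gradInner_const_smul (scale_ne ha ht) hu]
    field_simp
  have hR : scalarCurv (g t) p = (cbrt a t ^ 2)⁻¹ * (RicSharp (resMetric a g t) p).trace := by
    rw [scalarCurv, resMetric_eq ha ht, RicSharp_const_smul (scale_ne ha ht) hu, inv_inv,
      Matrix.trace_smul, smul_eq_mul]
    field_simp
  have hH : dt T (hubble T a) t = -(2 / 3) * (cbrt a t ^ 2)⁻¹ - hubble T a t ^ 2 := by
    have h3 := (ha.ode t ht).div (ha.hasDerivWithinAt ht) (ha.pos t ht).ne'
    refine (dt_eq h3 ht).trans ?_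
    change (-(2 / 3) * cbrt a t * _ - _) / _ = _
    rw [hubble, cbrt_pow_three ha ht]
    field_simp
  have hK : (k t p * k t p).trace = (traceFree (k t) p * traceFree (k t) p).trace
      + (1 / 3) * hubble T a t ^ 2 := by
    have h4 : (k t p * k t p).trace = (traceFree (k t) p * traceFree (k t) p).trace
        + (1 / 3) * (k t p).trace ^ 2 := by
      simp only [traceFree, Matrix.trace_fin_three, Matrix.mul_apply, Fin.sum_univ_three,
        Matrix.sub_apply, Matrix.smul_apply, Matrix.one_apply, smul_eq_mul]
      simp
      ring
    rw [h4, h.cmc t ht p]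
    ring
  have hsq : hubble T a t ^ 2 = (cbrt a t ^ 6)⁻¹ - (cbrt a t ^ 2)⁻¹ := by
    rw [hubble, div_pow, dt_sq_cbrt ha ht, cbrt_pow_three ha ht]
    field_simp
  have hn := congrFun (lapse_eq (n := n) ha ht) p
  rw [hL, hH] at h1
  rw [hG, hR, hK] at h2
  -- The Hamiltonian constraint trades the quadratic terms in `k` and `∂ₜφ` for scalar curvature and
  -- `|∇φ|²`.
  have h5 : (traceFree (k t) p * traceFree (k t) p).trace + 1 / 3 * hubble T a t ^ 2
        + normalDeriv T n φ t p ^ 2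
      = (cbrt a t ^ 2)⁻¹ * ((RicSharp (resMetric a g t) p).trace
        - gradInner (resMetric a g t) (φ t) (φ t) p) + hubble T a t ^ 2 := by
    linear_combination -h2
  rw [h5, hsq] at h1
  have h6 := congrArg (fun y => cbrt a t ^ 2 * y) h1
  generalize (RicSharp (resMetric a g t) p).trace = R at *
  generalize gradInner (resMetric a g t) (φ t) (φ t) p = ω2 at *
  generalize lap (resMetric a g t) (resLapse a n t) p = L at *
  generalize resLapse a n t p = ν at *
  rw [hn] at h6 ⊢
  field_simp at h6
  refine mul_left_cancel₀ (pow_ne_zero 4 hx.ne') ?_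
  linear_combination (-(1 / 3)) * h6

/-- The symmetry of the second fundamental form. -/
theorem resMetric_mul_resK_symm (h : IsSolution T a g k n φ) {t : ℝ}
    (ht : t ∈ Ico 0 T) (p : S3) :
    (resMetric a g t p * resK a k t p).transpose = resMetric a g t p * resK a k t p := by
  have hs : ∀ s ∈ Ico 0 T, ∀ A B, g s p A B = g s p B A := fun s hs A B => by
    have := (h.metric s hs p).1.apply B A
    simpa using this
  have h1 : ∀ A B, (g t p * k t p) A B = (g t p * k t p) B A := fun A B => by
    -- The metric stays symmetric, hence so does its time derivative `-2 n g k`, and `n` can be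
    -- cancelled.
    have h2 := dt_congr (fun s hs' => hs s hs' A B) ht
    rw [h.evol_g t ht p A B, h.evol_g t ht p B A] at h2
    have h3 := (h.lapse_pos t ht p).ne'
    rw [Matrix.mul_apply, Matrix.mul_apply]
    exact mul_left_cancel₀ (mul_ne_zero (by norm_num) h3) h2
  ext A B
  simp only [Matrix.transpose_apply, resMetric, resK, traceFree, Matrix.smul_mul, Matrix.mul_smul,
    Matrix.mul_sub, Matrix.mul_one, Matrix.smul_apply, Matrix.sub_apply, smul_eq_mul]
  rw [h1 B A, hs t ht B A]

end Rescaled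

/-! ### Uniform bounds for families of functions -/

/-- A family of scales: bounds are to hold along the filter `l`, up to a constant, the factor `s`
and a power of the factor `ρ`. -/
structure Gauge (X : Type) where
  l : Filter X
  ρ : X → ℝ
  s : X → ℝ
  one_le_ρ : ∀ x, 1 ≤ ρ x
  s_nonneg : ∀ x, 0 ≤ s x
  s_le_one : ∀ x, s x ≤ 1

namespace Gauge

variable {X : Type} {γ : Gauge X}

/-- The scales without the small factor. -/
def one (γ : Gauge X) : Gauge X :=
  { γ with s := fun _ => 1, s_nonneg := fun _ => zero_le_one, s_le_one := fun _ => le_rfl }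

/-- The family `f` is, together with its frame derivatives of order at most `N`, bounded by a
constant times `s ρ ^ c`, for some `c`. -/
def Small (γ : Gauge X) (N : ℕ) (f : X → S3 → ℝ) : Prop :=
  ∃ (C : ℝ) (c : ℕ), 0 ≤ C ∧ ∀ᶠ x in γ.l, DerivBound N (f x) (C * γ.s x * γ.ρ x ^ c)

/-- The family `f` agrees with the constant `c` up to a small family. -/
def Near (γ : Gauge X) (N : ℕ) (f : X → S3 → ℝ) (c : ℝ) : Prop :=
  γ.Small N fun x p => f x p - c

namespace Small

variable {M N : ℕ} {f g : X → S3 → ℝ}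

theorem of_le (h : γ.Small N f) (hMN : M ≤ N) : γ.Small M f := by
  obtain ⟨C, c, hC, h⟩ := h
  exact ⟨C, c, hC, h.mono fun x hx => hx.of_le hMN⟩

theorem bdd (h : γ.Small N f) : γ.one.Small N f := by
  obtain ⟨C, c, hC, h⟩ := h
  refine ⟨C, c, hC, h.mono fun x hx => hx.mono ?_⟩
  have h1 := pow_nonneg (zero_le_one.trans (γ.one_le_ρ x)) c
  exact mul_le_mul_of_nonneg_right (mul_le_mul_of_nonneg_left (γ.s_le_one x) hC) h1

theorem mono_exponent {C : ℝ} (hC : 0 ≤ C) {c c' : ℕ} (hc : c ≤ c') (x : X) :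
    C * γ.s x * γ.ρ x ^ c ≤ C * γ.s x * γ.ρ x ^ c' :=
  mul_le_mul_of_nonneg_left (pow_le_pow_right₀ (γ.one_le_ρ x) hc)
    (mul_nonneg hC (γ.s_nonneg x))

theorem add (hf : γ.Small N f) (hg : γ.Small N g) : γ.Small N fun x p => f x p + g x p := by
  obtain ⟨C, c, hC, hf⟩ := hf
  obtain ⟨C', c', hC', hg⟩ := hg
  refine ⟨C + C', max c c', add_nonneg hC hC', ?_⟩
  filter_upwards [hf, hg] with x hfx hgx
  refine ((hfx.mono (mono_exponent hC (le_max_left c c') x)).add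
    (hgx.mono (mono_exponent hC' (le_max_right c c') x))).mono (le_of_eq ?_)
  ring

theorem mul (hf : γ.Small N f) (hg : γ.one.Small N g) : γ.Small N fun x p => f x p * g x p := by
  obtain ⟨C, c, hC, hf⟩ := hf
  obtain ⟨C', c', hC', hg⟩ := hg
  refine ⟨2 ^ N * (C * C'), c + c', by positivity, ?_⟩
  filter_upwards [hf, hg] with x hfx hgx
  refine (hfx.mul hgx).mono (le_of_eq ?_)
  simp only [one]
  ring

theorem time_mul (hf : γ.Small N f) {b : X → ℝ} {K : ℝ} (hb : ∀ x, |b x| ≤ K) :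
    γ.Small N fun x p => b x * f x p := by
  obtain ⟨C, c, hC, hf⟩ := hf
  refine ⟨|K| * C, c, by positivity, hf.mono fun x hx => (hx.const_mul (b x)).mono ?_⟩
  calc |b x| * (C * γ.s x * γ.ρ x ^ c) ≤ |K| * (C * γ.s x * γ.ρ x ^ c) :=
        mul_le_mul_of_nonneg_right ((hb x).trans (le_abs_self K)) hx.nonneg
    _ = _ := by ring

theorem const_mul (hf : γ.Small N f) (b : ℝ) : γ.Small N fun x p => b * f x p :=
  hf.time_mul (b := fun _ => b) (K := |b|) fun _ => le_rfl

theorem sub (hf : γ.Small N f) (hg : γ.Small N g) : γ.Small N fun x p => f x p - g x p := by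
  have h := hf.add (hg.const_mul (-1))
  simpa [sub_eq_add_neg] using h

theorem zero : γ.Small N fun _ _ => 0 :=
  ⟨0, 0, le_rfl, Filter.Eventually.of_forall fun _ => DerivBound.zero N (by simp)⟩

theorem sum {ι : Type*} {s : Finset ι} {f : ι → X → S3 → ℝ} (h : ∀ i ∈ s, γ.Small N (f i)) :
    γ.Small N fun x p => ∑ i ∈ s, f i x p := by
  classical
  induction s using Finset.induction_on with
  | empty => simpa using zero
  | insert i s hi ih =>
    simp only [Finset.sum_insert hi]
    exact (h i (Finset.mem_insert_self i s)).add
      (ih fun j hj => h j (Finset.mem_insert_of_mem hj))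

theorem zder (h : γ.Small (N + 1) f) (A : Fin 3) : γ.Small N fun x => Zder A (f x) := by
  obtain ⟨C, c, hC, h⟩ := h
  exact ⟨C, c, hC, h.mono fun x hx => hx.zder A⟩

theorem near (h : γ.Small N f) : γ.Near N f 0 := by
  simpa [Near] using h

end Small

theorem bdd_const (N : ℕ) (c : ℝ) : γ.one.Small N fun _ _ => c :=
  ⟨|c|, 0, abs_nonneg c, Filter.Eventually.of_forall fun _ =>
    (DerivBound.const N c).mono (by simp [one])⟩

namespace Near

variable {M N : ℕ} {f g : X → S3 → ℝ} {c c' : ℝ}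

theorem small (h : γ.Near N f 0) : γ.Small N f := by
  simpa [Near] using h

theorem of_le (h : γ.Near N f c) (hMN : M ≤ N) : γ.Near M f c := Small.of_le h hMN

theorem bdd (h : γ.Near N f c) : γ.one.Small N f := by
  have h1 := (Small.bdd h).add (bdd_const N c)
  simpa using h1

theorem congr_const (h : γ.Near N f c) (hc : c = c') : γ.Near N f c' := hc ▸ h

theorem const (N : ℕ) (c : ℝ) : γ.Near N (fun _ _ => c) c := by
  simpa [Near] using Small.zero

theorem add (hf : γ.Near N f c) (hg : γ.Near N g c') :
    γ.Near N (fun x p => f x p + g x p) (c + c') := by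
  have h := Small.add hf hg
  unfold Near
  convert h using 3
  ring

theorem sub (hf : γ.Near N f c) (hg : γ.Near N g c') :
    γ.Near N (fun x p => f x p - g x p) (c - c') := by
  have h := Small.sub hf hg
  unfold Near
  convert h using 3
  ring

theorem const_mul (hf : γ.Near N f c) (b : ℝ) : γ.Near N (fun x p => b * f x p) (b * c) := by
  have h := Small.const_mul hf b
  unfold Near
  convert h using 3
  ring

theorem mul (hf : γ.Near N f c) (hg : γ.Near N g c') :
    γ.Near N (fun x p => f x p * g x p) (c * c') := by
  -- `f g - c c' = (f - c) g + c (g - c')`.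
  have h := (Small.mul hf hg.bdd).add (Small.const_mul hg c)
  unfold Near
  convert h using 3
  ring

theorem sum {ι : Type*} {s : Finset ι} {f : ι → X → S3 → ℝ} {c : ι → ℝ}
    (h : ∀ i ∈ s, γ.Near N (f i) (c i)) :
    γ.Near N (fun x p => ∑ i ∈ s, f i x p) (∑ i ∈ s, c i) := by
  have h1 := Small.sum h
  unfold Near
  convert h1 using 3
  rw [Finset.sum_sub_distrib]

theorem zder (h : γ.Near (N + 1) f c) (A : Fin 3) : γ.Near N (fun x => Zder A (f x)) 0 := by
  have h1 := Small.zder h A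
  simp only [Zder_sub_const] at h1
  exact h1.near

end Near

/-! ### Curvature of metrics close to the round one -/

section Curvature

variable {N : ℕ} {h : X → MatrixField}

/-- For the identity matrix the derivative terms vanish, and total antisymmetry of the structure
constants reduces the Koszul formula to `∇_X Y = [X, Y]/2` on the frame. -/
theorem near_gammaLow (hh : ∀ A B, γ.Near (N + 1) (fun x p => h x p A B) ((1 : Matrix _ _ ℝ) A B))
    (A C B : Fin 3) : γ.Near N (fun x => gammaLow (h x) A C B) (structConst A B C / 2) := by
  have hs : ∀ A B C, γ.Near N (fun x p => ∑ D, structConst A B D * h x p D C) (structConst A B C) :=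
    fun A B C => (Near.sum fun D _ => ((hh D C).of_le (Nat.le_succ N)).const_mul
      (structConst A B D)).congr_const (by simp [Matrix.one_apply])
  refine ((((((hh B C).zder A).add ((hh A C).zder B)).sub ((hh A B).zder C)).add
    (hs A B C)).sub (hs A C B) |>.sub (hs B C A) |>.const_mul (1 / 2)).congr_const ?_
  simp only [structConst, eps]
  ring

theorem near_conn (hh : ∀ A B, γ.Near (N + 1) (fun x p => h x p A B) ((1 : Matrix _ _ ℝ) A B))
    (hi : ∀ A B, γ.Near N (fun x p => (h x p)⁻¹ A B) ((1 : Matrix _ _ ℝ) A B))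
    (A D B : Fin 3) : γ.Near N (fun x => conn (h x) A D B) (structConst A B D / 2) :=
  (Near.sum fun C _ => (hi C D).mul (near_gammaLow hh A C B)).congr_const
    (by simp [Matrix.one_apply])

/-- `Near` is stable under sums and products, and frame derivatives annihilate the limiting
constants. What remains is the finite computation of the round Ricci tensor from the structure
constants. -/
theorem near_Ric (hh : ∀ A B, γ.Near (N + 2) (fun x p => h x p A B) ((1 : Matrix _ _ ℝ) A B))
    (hi : ∀ A B, γ.Near (N + 2) (fun x p => (h x p)⁻¹ A B) ((1 : Matrix _ _ ℝ) A B))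
    (B C : Fin 3) :
    γ.Near N (fun x p => Ric (h x) p B C) ((2 / 9) * (1 : Matrix _ _ ℝ) B C) := by
  have h1 : ∀ A D B, γ.Near (N + 1) (fun x => conn (h x) A D B) (structConst A B D / 2) :=
    near_conn hh fun A B => (hi A B).of_le (by omega)
  have h0 : ∀ A D B, γ.Near N (fun x => conn (h x) A D B) (structConst A B D / 2) :=
    fun A D B => (h1 A D B).of_le (Nat.le_succ N)
  refine (Near.sum (s := Finset.univ) fun A _ => (((h1 B A C).zder A).sub ((h1 A A C).zder B)).add
    (Near.sum (s := Finset.univ) fun F _ => ((h0 B F C).mul (h0 A A F)).sub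
      ((h0 A F C).mul (h0 B A F))) |>.sub
    (Near.sum (s := Finset.univ) fun F _ => (h0 F A C).const_mul (structConst A B F))).congr_const ?_
  fin_cases B <;> fin_cases C <;> simp [structConst, eps, Fin.sum_univ_three] <;> norm_num

theorem near_RicSharp (hh : ∀ A B, γ.Near (N + 2) (fun x p => h x p A B) ((1 : Matrix _ _ ℝ) A B))
    (hi : ∀ A B, γ.Near (N + 2) (fun x p => (h x p)⁻¹ A B) ((1 : Matrix _ _ ℝ) A B))
    (A B : Fin 3) :
    γ.Near N (fun x p => RicSharp (h x) p A B) ((2 / 9) * (1 : Matrix _ _ ℝ) A B) := by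
  simp only [RicSharp, Matrix.mul_apply]
  refine (Near.sum fun C _ => ((hi A C).of_le (by omega)).mul (near_Ric hh hi C B)).congr_const ?_
  simp [Matrix.one_apply]

theorem small_hess {f : X → S3 → ℝ} (hf : γ.Small (N + 2) f)
    (hh : ∀ A B, γ.Near (N + 1) (fun x p => h x p A B) ((1 : Matrix _ _ ℝ) A B))
    (hi : ∀ A B, γ.Near N (fun x p => (h x p)⁻¹ A B) ((1 : Matrix _ _ ℝ) A B))
    (A B : Fin 3) : γ.Small N fun x => hess (h x) (f x) A B := by
  have h1 : (fun x => hess (h x) (f x) A B) = fun x p => Zder A (Zder B (f x)) p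
      - ∑ D, Zder D (f x) p * conn (h x) A D B p := by
    funext x p
    rw [hess_eq]
    simp only [mul_comm]
  rw [h1]
  exact ((hf.zder B).zder A).sub (Small.sum fun D _ =>
    ((hf.zder D).of_le (Nat.le_succ N)).mul (near_conn hh hi A D B).bdd)

/-- The assumption concerns the differential alone because the solution norm controls `dφ` but not
`φ`. -/
theorem small_lap_of_small_dT {f : X → S3 → ℝ} (hf : ∀ A, γ.Small (N + 1) fun x => Zder A (f x))
    (hh : ∀ A B, γ.Near (N + 1) (fun x p => h x p A B) ((1 : Matrix _ _ ℝ) A B))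
    (hi : ∀ A B, γ.Near N (fun x p => (h x p)⁻¹ A B) ((1 : Matrix _ _ ℝ) A B)) :
    γ.Small N fun x => lap (h x) (f x) := by
  have h1 : (fun x => lap (h x) (f x)) = fun x p => ∑ A, ∑ B,
      (Zder A (Zder B (f x)) p - ∑ D, Zder D (f x) p * conn (h x) A D B p) * (h x p)⁻¹ A B := by
    funext x p
    simp only [lap, hess_eq, mul_comm]
  rw [h1]
  exact Small.sum fun A _ => Small.sum fun B _ => (((hf B).zder A).sub (Small.sum fun D _ =>
    ((hf D).of_le (Nat.le_succ N)).mul (near_conn hh hi A D B).bdd)).mul (hi A B).bdd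

theorem small_gradInner {f f' : X → S3 → ℝ} (hf : ∀ A, γ.Small N fun x => Zder A (f x))
    (hf' : ∀ A, γ.one.Small N fun x => Zder A (f' x))
    (hi : ∀ A B, γ.Near N (fun x p => (h x p)⁻¹ A B) ((1 : Matrix _ _ ℝ) A B)) :
    γ.Small N fun x => gradInner (h x) (f x) (f' x) := by
  have h1 : (fun x => gradInner (h x) (f x) (f' x)) = fun x p => ∑ A, ∑ B,
      Zder A (f x) p * (h x p)⁻¹ A B * Zder B (f' x) p := by
    funext x p
    simp only [gradInner]
    refine Finset.sum_congr rfl fun A _ => Finset.sum_congr rfl fun B _ => ?_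
    ring
  rw [h1]
  exact Small.sum fun A _ => Small.sum fun B _ => ((hf A).mul (hi A B).bdd).mul (hf' B)

end Curvature

end Gauge

/-! ### Solutions obeying the bootstrap assumptions -/

/-- A solution obeying the bootstrap assumptions with parameters `ε`, `σ`. -/
structure Datum where
  (ε σ T : ℝ)
  a : ℝ → ℝ
  (g k : ℝ → MatrixField)
  (n φ : ℝ → S3 → ℝ)
  ε_pos : 0 < ε
  sqrt_le : Real.sqrt ε ≤ σ
  σ_le_one : σ ≤ 1
  T_pos : 0 < T
  scale : IsScaleFactor T a
  sol : IsSolution T a g k n φ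
  init : highNorm T a g k n φ 0 ≤ ε ^ 2
  bootstrap : ∀ t ∈ Ico 0 T, highNorm T a g k n φ t ≤ ε * a t ^ (-σ)

/-- A time slice of a solution obeying the bootstrap assumptions. -/
structure Slice where
  d : Datum
  t : ℝ
  ht : t ∈ Ico 0 d.T

namespace Datum

variable (d : Datum)

theorem zero_mem : (0 : ℝ) ∈ Ico 0 d.T := ⟨le_rfl, d.T_pos⟩

theorem sqrt_pos : 0 < Real.sqrt d.ε := Real.sqrt_pos.mpr d.ε_pos

theorem σ_pos : 0 < d.σ := d.sqrt_pos.trans_le d.sqrt_le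

theorem sqrt_le_one : Real.sqrt d.ε ≤ 1 := d.sqrt_le.trans d.σ_le_one

theorem sqrt_mul_sqrt : Real.sqrt d.ε * Real.sqrt d.ε = d.ε := Real.mul_self_sqrt d.ε_pos.le

theorem ε_le_sqrt : d.ε ≤ Real.sqrt d.ε := by
  have h1 := d.sqrt_mul_sqrt
  have h2 := d.sqrt_le_one
  have h3 := d.sqrt_pos
  nlinarith

theorem ε_le_one : d.ε ≤ 1 := d.ε_le_sqrt.trans d.sqrt_le_one

end Datum

namespace Slice

/-- The rescaled metric of the slice. -/
abbrev G (x : Slice) : MatrixField := resMetric x.d.a x.d.g x.t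

/-- The inverse rescaled metric of the slice. -/
abbrev Gi (x : Slice) : MatrixField := resInv x.d.a x.d.g x.t

/-- The rescaled second fundamental form of the slice. -/
abbrev K (x : Slice) : MatrixField := resK x.d.a x.d.k x.t

/-- The rescaled lapse of the slice. -/
abbrev ν (x : Slice) : S3 → ℝ := resLapse x.d.a x.d.n x.t

/-- The rescaled time derivative of the scalar field on the slice. -/
abbrev Ψ (x : Slice) : S3 → ℝ := timeScalar x.d.T x.d.a x.d.n x.d.φ x.t

/-- The cube root of the scale factor of the slice. -/
abbrev r (x : Slice) : ℝ := cbrt x.d.a x.t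

/-- The logarithmic time of the slice. -/
abbrev τ (x : Slice) : ℝ := logTime x.d.a x.t

variable (x : Slice)

theorem τ_nonneg : 0 ≤ x.τ := x.d.scale.logTime_nonneg x.ht

theorem r_pos : 0 < x.r := cbrt_pos x.d.scale x.ht

theorem r_le_one : x.r ≤ 1 := cbrt_le_one x.d.scale x.ht

theorem abs_r_pow_le (m : ℕ) : |x.r ^ m| ≤ 1 := by
  rw [abs_of_pos (pow_pos x.r_pos m)]
  exact pow_le_one₀ x.r_pos.le x.r_le_one

end Slice

/-- The filter of small parameters. -/
def smallParam : Filter Slice := Filter.comap (fun x => x.d.σ) (nhds 0)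

/-- The threshold depends on `σ` alone. A bound that holds eventually therefore holds on all slices
of a given solution at once, as integration in time requires. -/
theorem eventually_smallParam {P : Slice → Prop} :
    (∀ᶠ x in smallParam, P x) ↔ ∃ δ > 0, ∀ x : Slice, x.d.σ < δ → P x := by
  rw [smallParam, Filter.eventually_comap, Metric.eventually_nhds_iff]
  constructor
  · rintro ⟨δ, hδ, h⟩
    exact ⟨δ, hδ, fun x hx => h (by simpa [abs_of_pos x.d.σ_pos] using hx) x rfl⟩
  · rintro ⟨δ, hδ, h⟩
    refine ⟨δ, hδ, fun y hy x hxy => h x ?_⟩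
    subst hxy
    simpa [abs_of_pos x.d.σ_pos] using hy

theorem one_le_exp_mul_τ (x : Slice) {θ : ℝ} (hθ : 0 ≤ θ) : 1 ≤ Real.exp (θ * x.τ) :=
  Real.one_le_exp (mul_nonneg hθ x.τ_nonneg)

/-- The scale of the bootstrap assumptions. -/
def crude : Gauge Slice where
  l := smallParam
  ρ x := Real.exp (x.d.σ * x.τ)
  s x := x.d.ε
  one_le_ρ x := one_le_exp_mul_τ x x.d.σ_pos.le
  s_nonneg x := x.d.ε_pos.le
  s_le_one x := x.d.ε_le_one

/-- The scale of the improved bounds. -/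
def sharp : Gauge Slice where
  l := smallParam
  ρ x := Real.exp (Real.sqrt x.d.ε * x.τ)
  s x := Real.sqrt x.d.ε
  one_le_ρ x := one_le_exp_mul_τ x x.d.sqrt_pos.le
  s_nonneg x := x.d.sqrt_pos.le
  s_le_one x := x.d.sqrt_le_one

/-- The scale of the improved bounds, with the smallness of the bootstrap assumptions. -/
def sharpSmall : Gauge Slice :=
  { sharp with
    s := fun x => x.d.ε
    s_nonneg := fun x => x.d.ε_pos.le
    s_le_one := fun x => x.d.ε_le_one }

/-- The scale of bounds without loss. -/
def lossless : Gauge Slice where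
  l := smallParam
  ρ _ := 1
  s x := x.d.ε
  one_le_ρ _ := le_rfl
  s_nonneg x := x.d.ε_pos.le
  s_le_one x := x.d.ε_le_one

/-- The logarithm of the left side is `(1/3 - cσ) log a + cσ t`; the first term is nonpositive and
the second at most `2/3`. -/
theorem r_mul_exp_le (x : Slice) {c : ℕ} (hc : c * x.d.σ ≤ 1 / 3) :
    x.r * Real.exp (x.d.σ * x.τ) ^ c ≤ Real.exp 1 := by
  have ha := x.d.scale.pos x.t x.ht
  have h1 := Real.log_nonpos ha.le (x.d.scale.le_one x.ht)
  have h2 := x.d.scale.le_two x.ht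
  have h3 := x.ht.1
  have h4 : 0 ≤ c * x.d.σ := mul_nonneg (Nat.cast_nonneg c) x.d.σ_pos.le
  change x.d.a x.t ^ (1 / 3 : ℝ) * _ ≤ _
  rw [Real.rpow_def_of_pos ha, ← Real.exp_nat_mul, ← Real.exp_add]
  apply Real.exp_le_exp.mpr
  change _ + c * (x.d.σ * (x.t - Real.log (x.d.a x.t))) ≤ 1
  nlinarith

theorem Gauge.Small.lossless_of_crude {N : ℕ} {f : Slice → S3 → ℝ} (h : crude.Small N f) :
    lossless.Small N fun x p => x.r * f x p := by
  obtain ⟨C, c, hC, h⟩ := h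
  refine ⟨C * Real.exp 1, 0, by positivity, ?_⟩
  have h1 : ∀ᶠ x in smallParam, (c : ℝ) * x.d.σ ≤ 1 / 3 := by
    refine eventually_smallParam.mpr ⟨1 / (3 * (c + 1)), by positivity, fun x hx => ?_⟩
    rw [lt_div_iff₀ (by positivity)] at hx
    have := x.d.σ_pos
    nlinarith
  filter_upwards [h, h1] with x hx hcx
  refine (hx.const_mul x.r).mono ?_
  rw [abs_of_pos x.r_pos]
  simp only [lossless, crude, pow_zero, mul_one]
  calc x.r * (C * x.d.ε * Real.exp (x.d.σ * x.τ) ^ c)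
      = C * x.d.ε * (x.r * Real.exp (x.d.σ * x.τ) ^ c) := by ring
    _ ≤ C * x.d.ε * Real.exp 1 :=
        mul_le_mul_of_nonneg_left (r_mul_exp_le x hcx) (mul_nonneg hC x.d.ε_pos.le)
    _ = _ := by ring

theorem Gauge.Small.sharp_of_lossless {N : ℕ} {f : Slice → S3 → ℝ} (h : lossless.Small N f) :
    sharp.Small N f := by
  obtain ⟨C, c, hC, h⟩ := h
  refine ⟨C, 0, hC, h.mono fun x hx => hx.mono ?_⟩
  simpa [lossless, sharp] using mul_le_mul_of_nonneg_left x.d.ε_le_sqrt hC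

theorem Gauge.Small.sharpSmall_of_lossless {N : ℕ} {f : Slice → S3 → ℝ}
    (h : lossless.Small N f) : sharpSmall.Small N f := by
  obtain ⟨C, c, hC, h⟩ := h
  refine ⟨C, 0, hC, h.mono fun x hx => hx.mono ?_⟩
  simp [lossless, sharpSmall]

/-! ### Consequences of a bound of the solution norm -/

/-- The solution norm is a sum of nonnegative terms; the Sobolev ones are discarded. -/
theorem normC_le_highNorm {T : ℝ} {a : ℝ → ℝ} {g k : ℝ → MatrixField} {n φ : ℝ → S3 → ℝ} {t : ℝ}
    (ha : 0 ≤ a t) :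
    normC 14 (mixedT (resK a k t)) ≤ highNorm T a g k n φ t ∧
    normC 14 (covT (resMetric a g t - St)) ≤ highNorm T a g k n φ t ∧
    normC 14 (contraT (resInv a g t - St)) ≤ highNorm T a g k n φ t ∧
    normC 12 (scalarT (resLapse a n t)) ≤ highNorm T a g k n φ t ∧
    normC 14 (scalarT (timeScalar T a n φ t)) ≤ highNorm T a g k n φ t ∧
    normC 13 (dT (φ t)) ≤ highNorm T a g k n φ t := by
  have hC : ∀ {l m : ℕ} (M : ℕ) (ξ : Tensor l m), 0 ≤ normC M ξ := fun _ _ => Real.sqrt_nonneg _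
  have hH : ∀ {l m : ℕ} (M : ℕ) (ξ : Tensor l m), 0 ≤ normH M ξ := fun _ _ => Real.sqrt_nonneg _
  have hD : ∀ {l m : ℕ} (M : ℕ) (ξ : Tensor l m), 0 ≤ normHdot M ξ := fun _ _ =>
    Real.sqrt_nonneg _
  have h1 := hH 16 (mixedT (resK a k t))
  have h2 := mul_nonneg (Real.rpow_nonneg ha (2 / 3 : ℝ)) (hD 17 (covT (resMetric a g t)))
  have h3 := hH 16 (covT (resMetric a g t - St))
  have h4 := hH 16 (contraT (resInv a g t - St))
  have h5 : 0 ≤ ∑ L ∈ Finset.Icc (1 : ℕ) 4,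
      a t ^ ((2 / 3 : ℝ) * (L : ℝ)) * normHdot (14 + L) (scalarT (resLapse a n t)) :=
    Finset.sum_nonneg fun L _ => mul_nonneg (Real.rpow_nonneg ha _) (hD _ _)
  have h6 := hH 14 (scalarT (resLapse a n t))
  have h7 := hH 16 (scalarT (timeScalar T a n φ t))
  have h8 := mul_nonneg (Real.rpow_nonneg ha (2 / 3 : ℝ)) (hH 16 (dT (φ t)))
  have h9 := hH 15 (dT (φ t))
  have h10 := hC 14 (mixedT (resK a k t))
  have h11 := hC 14 (covT (resMetric a g t - St))
  have h12 := hC 14 (contraT (resInv a g t - St))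
  have h13 := hC 12 (scalarT (resLapse a n t))
  have h14 := hC 14 (scalarT (timeScalar T a n φ t))
  have h15 := hC 13 (dT (φ t))
  unfold highNorm
  refine ⟨?_, ?_, ?_, ?_, ?_, ?_⟩ <;> linarith

theorem lieFactor_pow_le {l m M : ℕ} {b : ℝ} (hb : 0 ≤ b) (hlm : l + m ≤ 2) (hM : M ≤ 14) :
    lieFactor l m ^ M * b ≤ 7 ^ 14 * b := by
  have h1 : lieFactor l m ≤ 7 := by
    have h2 : (l : ℝ) + m ≤ 2 := by exact_mod_cast hlm
    unfold lieFactor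
    linarith
  refine mul_le_mul_of_nonneg_right ?_ hb
  calc lieFactor l m ^ M ≤ 7 ^ M :=
        pow_le_pow_left₀ (zero_le_one.trans (one_le_lieFactor l m)) h1 M
    _ ≤ 7 ^ 14 := pow_le_pow_right₀ (by norm_num) hM

theorem derivBound_of_highNorm_le (x : Slice) {b : ℝ}
    (hb : highNorm x.d.T x.d.a x.d.g x.d.k x.d.n x.d.φ x.t ≤ b) :
    (∀ A B, DerivBound 14 (fun p => x.K p A B) (7 ^ 14 * b)) ∧
    (∀ A B, DerivBound 14 (fun p => x.G p A B - (1 : Matrix _ _ ℝ) A B) (7 ^ 14 * b)) ∧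
    (∀ A B, DerivBound 14 (fun p => x.Gi p A B - (1 : Matrix _ _ ℝ) A B) (7 ^ 14 * b)) ∧
    DerivBound 12 x.ν (7 ^ 14 * b) ∧ DerivBound 14 x.Ψ (7 ^ 14 * b) ∧
    ∀ A, DerivBound 13 (Zder A (x.d.φ x.t)) (7 ^ 14 * b) := by
  obtain ⟨h1, h2, h3, h4, h5, h6⟩ := normC_le_highNorm (T := x.d.T) (g := x.d.g) (k := x.d.k)
    (n := x.d.n) (φ := x.d.φ) (x.d.scale.pos x.t x.ht).le
  have hb0 : 0 ≤ b := (Real.sqrt_nonneg _).trans (h1.trans hb)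
  have hs := x.d.scale
  have hsol := x.d.sol
  have key : ∀ {l m M : ℕ} {ξ : Tensor l m}, l + m ≤ 2 → M ≤ 14 →
      (∀ I J, SlabC M 1 (fun _ => ξ I J)) → normC M ξ ≤ b →
      ∀ I J, DerivBound M (ξ I J) (7 ^ 14 * b) := fun hlm hM hξ hn I J =>
    (TensorBound.of_normC hξ hn I J).mono (lieFactor_pow_le hb0 hlm hM)
  refine ⟨fun A B => ?_, fun A B => ?_, fun A B => ?_, ?_, ?_, fun A => ?_⟩
  · exact key (by norm_num) le_rfl (fun I J => ((slabC_resK hs hsol (I 0) (J 0)).of_le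
      (by norm_num)).slice x.ht 1) (h1.trans hb) ![A] ![B]
  · exact key (by norm_num) le_rfl (fun I J => ((slabC_resMetric hs hsol (J 0) (J 1)).of_le
      (by norm_num)).slice x.ht 1 |>.sub (slabC_const 14 1 _)) (h2.trans hb) ![] ![A, B]
  · exact key (by norm_num) le_rfl (fun I J => ((slabC_resInv hs hsol (I 0) (I 1)).of_le
      (by norm_num)).slice x.ht 1 |>.sub (slabC_const 14 1 _)) (h3.trans hb) ![A, B] ![]
  · exact key (by norm_num) (by norm_num) (fun I J => ((slabC_resLapse hs hsol).of_le
      (by norm_num)).slice x.ht 1) (h4.trans hb) ![] ![]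
  · exact key (by norm_num) le_rfl (fun I J => ((slabC_timeScalar hs hsol).of_le
      (by norm_num)).slice x.ht 1) (h5.trans hb) ![] ![]
  · exact key (by norm_num) (by norm_num) (fun I J => ((slabC_dT hsol (J 0)).of_le
      (by norm_num)).slice x.ht 1) (h6.trans hb) ![] ![A]

theorem highNorm_le (x : Slice) : highNorm x.d.T x.d.a x.d.g x.d.k x.d.n x.d.φ x.t
    ≤ x.d.ε * Real.exp (x.d.σ * x.τ) :=
  (x.d.bootstrap x.t x.ht).trans (mul_le_mul_of_nonneg_left
    (x.d.scale.rpow_neg_le_exp x.ht x.d.σ_pos.le) x.d.ε_pos.le)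

theorem crude_small {N : ℕ} {f : Slice → S3 → ℝ}
    (h : ∀ x : Slice, DerivBound N (f x) (7 ^ 14 * (x.d.ε * Real.exp (x.d.σ * x.τ)))) :
    crude.Small N f :=
  ⟨7 ^ 14, 1, by positivity, Filter.Eventually.of_forall fun x =>
    (h x).mono (le_of_eq (by simp only [crude]; ring))⟩

theorem crude_K (A B : Fin 3) : crude.Small 14 fun x p => x.K p A B :=
  crude_small fun x => (derivBound_of_highNorm_le x (highNorm_le x)).1 A B

theorem crude_G (A B : Fin 3) :
    crude.Near 14 (fun x p => x.G p A B) ((1 : Matrix _ _ ℝ) A B) :=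
  crude_small fun x => (derivBound_of_highNorm_le x (highNorm_le x)).2.1 A B

theorem crude_Gi (A B : Fin 3) :
    crude.Near 14 (fun x p => x.Gi p A B) ((1 : Matrix _ _ ℝ) A B) :=
  crude_small fun x => (derivBound_of_highNorm_le x (highNorm_le x)).2.2.1 A B

theorem crude_ν : crude.Small 12 Slice.ν :=
  crude_small fun x => (derivBound_of_highNorm_le x (highNorm_le x)).2.2.2.1

theorem crude_Ψ : crude.Small 14 Slice.Ψ :=
  crude_small fun x => (derivBound_of_highNorm_le x (highNorm_le x)).2.2.2.2.1

theorem crude_dT (A : Fin 3) : crude.Small 13 fun x => Zder A (x.d.φ x.t) :=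
  crude_small fun x => (derivBound_of_highNorm_le x (highNorm_le x)).2.2.2.2.2 A

/-! ### Integration in time -/

/-- A rate `O(ε)` over a time at most 2, starting from data of size `ε² ≤ ε`. -/
theorem lossless_of_rate {N : ℕ} {u : Datum → ℝ → S3 → ℝ}
    (hu : ∀ d, SlabC (N + 1) d.T (u d)) {C₀ : ℝ}
    (h0 : ∀ d, DerivBound N (u d 0) (C₀ * d.ε ^ 2))
    (h : lossless.Small N fun x p => dt x.d.T (fun s => u x.d s p) x.t) :
    lossless.Small N fun x => u x.d x.t := by
  obtain ⟨C, c, hC, h⟩ := h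
  obtain ⟨δ, hδ, h⟩ := eventually_smallParam.mp h
  refine ⟨|C₀| + 2 * C, 0, by positivity, eventually_smallParam.mpr ⟨δ, hδ, fun x hx => ?_⟩⟩
  have hε := x.d.ε_pos
  have h1 := DerivBound.integrate (hu x.d) (β := fun t => |C₀| * x.d.ε + C * x.d.ε * t)
    (β' := fun _ => C * x.d.ε) (fun t _ => by
      simpa using ((hasDerivWithinAt_id t _).const_mul (C * x.d.ε)).const_add (|C₀| * x.d.ε))
    x.ht ((h0 x.d).mono ?_) (fun s hs => ?_)
  · refine h1.mono ?_
    have h2 := x.d.scale.le_two x.ht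
    have h3 : 0 ≤ C * x.d.ε := by positivity
    simp only [lossless, pow_zero, mul_one]
    nlinarith
  · have h2 := x.d.ε_le_one
    have h3 := le_abs_self C₀
    have h4 : x.d.ε ^ 2 ≤ x.d.ε := by nlinarith
    simp only [mul_zero, add_zero]
    exact (mul_le_mul_of_nonneg_right h3 (by positivity)).trans
      (mul_le_mul_of_nonneg_left h4 (abs_nonneg _))
  · simpa [lossless] using h ⟨x.d, s, hs.1, hs.2.trans_lt x.ht.2⟩ hx

/-- Since `1/a ≤ τ'`, integration gives `ε τ = √ε (√ε τ) ≤ √ε exp (√ε τ)`. -/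
theorem sharp_of_rate {N : ℕ} {u : Datum → ℝ → S3 → ℝ}
    (hu : ∀ d, SlabC (N + 1) d.T (u d)) {C₀ : ℝ}
    (h0 : ∀ d, DerivBound N (u d 0) (C₀ * d.ε ^ 2)) {E : Slice → S3 → ℝ}
    (hE : lossless.Small N E)
    (h : ∀ x p, dt x.d.T (fun s => u x.d s p) x.t = (x.d.a x.t)⁻¹ * E x p) :
    sharp.Small N fun x => u x.d x.t := by
  obtain ⟨C, c, hC, hE⟩ := hE
  obtain ⟨δ, hδ, hE⟩ := eventually_smallParam.mp hE
  refine ⟨|C₀| + C, 1, by positivity, eventually_smallParam.mpr ⟨δ, hδ, fun x hx => ?_⟩⟩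
  have hε := x.d.ε_pos
  have h1 := DerivBound.integrate (hu x.d)
    (β := fun t => |C₀| * x.d.ε + C * x.d.ε * logTime x.d.a t)
    (β' := fun t => C * x.d.ε * (1 - dt x.d.T x.d.a t / x.d.a t)) (fun t ht =>
      ((x.d.scale.hasDerivWithinAt_logTime ht).const_mul (C * x.d.ε)).const_add (|C₀| * x.d.ε))
    x.ht ((h0 x.d).mono ?_) (fun s hs => ?_)
  · refine h1.mono ?_
    have h2 := x.d.sqrt_mul_sqrt
    have h3 := x.d.ε_le_sqrt
    have h4 := x.d.sqrt_pos
    have h5 : Real.sqrt x.d.ε * x.τ ≤ Real.exp (Real.sqrt x.d.ε * x.τ) := by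
      linarith [Real.add_one_le_exp (Real.sqrt x.d.ε * x.τ)]
    have h6 := one_le_exp_mul_τ x h4.le
    simp only [sharp, pow_one]
    have h7 : |C₀| * x.d.ε ≤ |C₀| * Real.sqrt x.d.ε * Real.exp (Real.sqrt x.d.ε * x.τ) :=
      calc |C₀| * x.d.ε ≤ |C₀| * Real.sqrt x.d.ε := by gcongr
        _ ≤ _ := le_mul_of_one_le_right (by positivity) h6
    have h8 : C * x.d.ε * logTime x.d.a x.t
        ≤ C * Real.sqrt x.d.ε * Real.exp (Real.sqrt x.d.ε * x.τ) :=
      calc C * x.d.ε * logTime x.d.a x.t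
          = C * Real.sqrt x.d.ε * (Real.sqrt x.d.ε * x.τ) := by
            linear_combination (-C * logTime x.d.a x.t) * h2
        _ ≤ _ := mul_le_mul_of_nonneg_left h5 (by positivity)
    calc _ ≤ _ := add_le_add h7 h8
      _ = _ := by ring
  · have h2 := x.d.ε_le_one
    have h3 := le_abs_self C₀
    have h4 : x.d.ε ^ 2 ≤ x.d.ε := by nlinarith
    simp only [x.d.scale.logTime_zero, mul_zero, add_zero]
    exact (mul_le_mul_of_nonneg_right h3 (by positivity)).trans
      (mul_le_mul_of_nonneg_left h4 (abs_nonneg _))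
  · have hs' : s ∈ Ico 0 x.d.T := ⟨hs.1, hs.2.trans_lt x.ht.2⟩
    have ha := x.d.scale.pos s hs'
    have h2 := (hE ⟨x.d, s, hs'⟩ hx).const_mul (x.d.a s)⁻¹
    have h3 : (fun p => dt x.d.T (fun s => u x.d s p) s)
        = fun p => (x.d.a s)⁻¹ * E ⟨x.d, s, hs'⟩ p := by
      funext p
      exact h ⟨x.d, s, hs'⟩ p
    rw [h3]
    refine h2.mono ?_
    rw [abs_of_pos (inv_pos.mpr ha)]
    simp only [lossless, one_pow, mul_one]
    rw [mul_comm]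
    exact mul_le_mul_of_nonneg_left (x.d.scale.inv_le_deriv_logTime hs') (by positivity)

theorem hasDerivWithinAt_exp_logTime (d : Datum) {t : ℝ} (ht : t ∈ Ico 0 d.T) (θ : ℝ) :
    HasDerivWithinAt (fun t => Real.exp (θ * logTime d.a t))
      (Real.exp (θ * logTime d.a t) * (θ * (1 - dt d.T d.a t / d.a t))) (Ico 0 d.T) t :=
  ((d.scale.hasDerivWithinAt_logTime ht).const_mul θ).exp

/-- A linear Gronwall argument: rates of change of size `ε / a` only lead to a loss of powers of
`a ^ (-√ε)`. -/
theorem sharp_near_of_linear_rate {ι : Type} [Finite ι] {N : ℕ} {u : ι → Datum → ℝ → S3 → ℝ}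
    (hu : ∀ i d, SlabC (N + 1) d.T (u i d)) {C₀ : ℝ} {c₀ : ι → ℝ}
    (h0 : ∀ i d, DerivBound N (fun p => u i d 0 p - c₀ i) (C₀ * d.ε ^ 2))
    (hq : ∀ i, crude.Near N (fun x => u i x.d x.t) (c₀ i)) {L : ℝ} (hL : 0 ≤ L)
    (h : ∀ᶠ x in smallParam, ∀ b, 0 ≤ b →
      (∀ i, DerivBound N (fun p => u i x.d x.t p - c₀ i) b) → ∀ i,
        DerivBound N (fun p => dt x.d.T (fun s => u i x.d s p) x.t)
          (L * x.d.ε * (x.d.a x.t)⁻¹ * (1 + b))) (i : ι) :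
    sharp.Near N (fun x => u i x.d x.t) (c₀ i) := by
  obtain ⟨δ, hδ, h⟩ := eventually_smallParam.mp h
  choose Cq cq hCq hq using hq
  obtain ⟨δq, hδq, hq⟩ := eventually_smallParam.mp (Filter.eventually_all.mpr hq)
  refine ⟨2 * (|C₀| + L), 1, by positivity, eventually_smallParam.mpr
    ⟨min (min δ δq) (1 / (2 * (L + 1))), by positivity, fun x hx => ?_⟩⟩
  have hx1 : x.d.σ < δ := hx.trans_le ((min_le_left _ _).trans (min_le_left _ _))
  have hx2 : x.d.σ < δq := hx.trans_le ((min_le_left _ _).trans (min_le_right _ _))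
  have hx3 : x.d.σ < 1 / (2 * (L + 1)) := hx.trans_le (min_le_right _ _)
  set η := Real.sqrt x.d.ε with hη
  have hη0 : 0 < η := x.d.sqrt_pos
  have hηε : η * η = x.d.ε := x.d.sqrt_mul_sqrt
  -- This makes the integral inequality a contraction; it follows from `√ε ≤ σ` and the choice of
  -- threshold.
  have hLη : L * η ≤ 1 / 2 := by
    rw [lt_div_iff₀ (by positivity)] at hx3
    have := x.d.sqrt_le
    nlinarith
  have hmem : ∀ s ∈ Icc 0 x.t, s ∈ Ico 0 x.d.T := fun s hs => ⟨hs.1, hs.2.trans_lt x.ht.2⟩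
  set w : ℝ → ℝ := fun s => Real.exp (η * logTime x.d.a s) with hw
  have hw1 : ∀ s ∈ Icc 0 x.t, 1 ≤ w s := fun s hs =>
    one_le_exp_mul_τ ⟨x.d, s, hmem s hs⟩ hη0.le
  let P : ℝ → Prop := fun m => ∀ s ∈ Icc 0 x.t, ∀ i,
    DerivBound N (fun p => u i x.d s p - c₀ i) (m * w s)
  -- One Picard-type improvement. As `w' = η w τ'` and `τ' ≥ 1/a`, a rate `L ε a⁻¹ (1 + m) w` with
  -- `ε = η²` integrates to at most `L η (1 + m) w`.
  have hstep : ∀ m, 0 ≤ m → P m → P ((|C₀| + L) * η + m / 2) := by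
    intro m hm hP s hs i
    have hus : SlabC (N + 1) x.d.T (fun t p => u i x.d t p - c₀ i) :=
      (hu i x.d).sub (slabC_const _ _ _)
    have h1 := DerivBound.integrate hus
      (β := fun t => |C₀| * x.d.ε + L * η * (1 + m) * w t)
      (β' := fun t => L * η * (1 + m) * (w t * (η * (1 - dt x.d.T x.d.a t / x.d.a t))))
      (fun t ht => ((hasDerivWithinAt_exp_logTime x.d ht η).const_mul _).const_add _)
      (hmem s hs) ((h0 i x.d).mono ?_) (fun r hr => ?_)
    · refine h1.mono ?_
      have h2 := hw1 s hs
      have h3 : |C₀| * x.d.ε ≤ |C₀| * η * w s :=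
        calc |C₀| * x.d.ε ≤ |C₀| * η := mul_le_mul_of_nonneg_left x.d.ε_le_sqrt (abs_nonneg _)
          _ ≤ _ := le_mul_of_one_le_right (by positivity) h2
      have h4 : L * η * m * w s ≤ m / 2 * w s := by
        have h5 := mul_le_mul_of_nonneg_right hLη (mul_nonneg hm (zero_le_one.trans h2))
        linarith
      linarith
    · have h2 := x.d.ε_le_one
      have h3 := x.d.ε_pos
      have h4 : C₀ * x.d.ε ^ 2 ≤ |C₀| * x.d.ε := by
        have h5 : x.d.ε ^ 2 ≤ x.d.ε := by nlinarith
        exact (mul_le_mul_of_nonneg_right (le_abs_self C₀) (by positivity)).trans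
          (mul_le_mul_of_nonneg_left h5 (abs_nonneg _))
      have h5 : 0 ≤ L * η * (1 + m) * w 0 := by
        have := hw1 0 ⟨le_rfl, x.ht.1⟩
        positivity
      exact h4.trans (le_add_of_nonneg_right h5)
    · have hr' : r ∈ Icc 0 x.t := ⟨hr.1, hr.2.trans hs.2⟩
      have hw2 := hw1 r hr'
      have hb := h ⟨x.d, r, hmem r hr'⟩ hx1 (m * w r) (by positivity) (hP r hr') i
      have he : (fun p => dt x.d.T (fun s => u i x.d s p - c₀ i) r)
          = fun p => dt x.d.T (fun s => u i x.d s p) r := by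
        funext p
        exact derivWithin_sub_const (f := fun s => u i x.d s p) (c₀ i)
      rw [he]
      refine hb.mono ?_
      have ha := x.d.scale.pos r (hmem r hr')
      have hlt := x.d.scale.inv_le_deriv_logTime (hmem r hr')
      calc L * x.d.ε * (x.d.a r)⁻¹ * (1 + m * w r)
          ≤ L * x.d.ε * (x.d.a r)⁻¹ * ((1 + m) * w r) := by
            have h3 := x.d.ε_pos
            have h4 := inv_pos.mpr ha
            refine mul_le_mul_of_nonneg_left ?_ (by positivity)
            nlinarith
        _ = L * η * (1 + m) * (w r * (η * (x.d.a r)⁻¹)) := by rw [← hηε]; ring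
        _ ≤ _ := by gcongr
  -- The crude bound enters only to start the iteration with some finite `m` on the compact interval
  -- `[0, t]`; its size is irrelevant.
  have hinit : ∃ m, 0 ≤ m ∧ P m := by
    have hcont : ContinuousOn (logTime x.d.a) (Icc 0 x.t) := fun s hs =>
      ((x.d.scale.hasDerivWithinAt_logTime (hmem s hs)).continuousWithinAt).mono hmem
    obtain ⟨B, hB⟩ := isCompact_Icc.exists_bound_of_continuousOn hcont
    obtain ⟨m, hm⟩ := (Set.finite_range fun i =>
      Cq i * x.d.ε * Real.exp (x.d.σ * B) ^ cq i).bddAbove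
    refine ⟨|m|, abs_nonneg m, fun s hs i => (hq ⟨x.d, s, hmem s hs⟩ hx2 i).mono ?_⟩
    have h1 : Real.exp (x.d.σ * logTime x.d.a s) ≤ Real.exp (x.d.σ * B) :=
      Real.exp_le_exp.mpr (mul_le_mul_of_nonneg_left ((le_abs_self _).trans (hB s hs))
        x.d.σ_pos.le)
    have h2 := hm (Set.mem_range_self i)
    calc _ ≤ Cq i * x.d.ε * Real.exp (x.d.σ * B) ^ cq i :=
          mul_le_mul_of_nonneg_left (pow_le_pow_left₀ (Real.exp_pos _).le h1 _)
            (mul_nonneg (hCq i) x.d.ε_pos.le)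
      _ ≤ |m| := h2.trans (le_abs_self m)
      _ ≤ |m| * w s := le_mul_of_one_le_right (abs_nonneg m) (hw1 s hs)
  obtain ⟨m, hm, hPm⟩ := hinit
  have hA : 0 ≤ (|C₀| + L) * η := by positivity
  -- The fixed point of `m ↦ (|C₀| + L) η + m / 2` is `2 (|C₀| + L) η`, approached geometrically.
  have hiter : ∀ j : ℕ, P (2 * ((|C₀| + L) * η) + m * (1 / 2) ^ j) := by
    intro j
    induction j with
    | zero =>
      intro s hs i
      refine (hPm s hs i).mono (mul_le_mul_of_nonneg_right ?_ (zero_le_one.trans (hw1 s hs)))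
      simp only [pow_zero, mul_one]
      linarith
    | succ j ih =>
      have h1 := hstep _ (by positivity) ih
      have h2 : (|C₀| + L) * η + (2 * ((|C₀| + L) * η) + m * (1 / 2) ^ j) / 2
          = 2 * ((|C₀| + L) * η) + m * (1 / 2) ^ (j + 1) := by ring
      rwa [h2] at h1
  have hxt : x.t ∈ Icc 0 x.t := ⟨x.ht.1, le_rfl⟩
  refine DerivBound.of_forall_add fun κ hκ => ?_
  have hw3 : 0 < w x.t := Real.exp_pos _
  obtain ⟨j, hj⟩ := exists_pow_lt_of_lt_one (show 0 < κ / ((m + 1) * w x.t) by positivity)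
    (show (1 / 2 : ℝ) < 1 by norm_num)
  refine (hiter j x.t hxt i).mono ?_
  rw [lt_div_iff₀ (by positivity)] at hj
  have h3 : m * (1 / 2) ^ j * w x.t ≤ κ := by
    have h4 : (0 : ℝ) < (1 / 2) ^ j * w x.t := by positivity
    nlinarith
  calc _ = 2 * (|C₀| + L) * η * w x.t + m * (1 / 2) ^ j * w x.t := by ring
    _ ≤ _ := by
      simp only [sharp, pow_one]
      exact add_le_add le_rfl h3

/-! ### Improved bounds -/

open Gauge Filter

/-- The sums of the constants and of the exponents dominate each member of the finite family. -/
theorem Gauge.Small.uniform {X ι : Type} [Fintype ι] {γ : Gauge X} {N : ℕ} {f : ι → X → S3 → ℝ}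
    (h : ∀ i, γ.Small N (f i)) : ∃ (C : ℝ) (c : ℕ), 0 ≤ C ∧
      ∀ᶠ x in γ.l, ∀ i, DerivBound N (f i x) (C * γ.s x * γ.ρ x ^ c) := by
  choose C c hC h using h
  refine ⟨∑ i, C i, ∑ i, c i, Finset.sum_nonneg fun i _ => hC i, ?_⟩
  filter_upwards [Filter.eventually_all.mpr h] with x hx i
  refine (hx i).mono ((Small.mono_exponent (hC i)
    (Finset.single_le_sum (f := c) (fun _ _ => Nat.zero_le _) (Finset.mem_univ i)) x).trans ?_)
  have h1 := pow_nonneg (zero_le_one.trans (γ.one_le_ρ x)) (∑ i, c i)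
  exact mul_le_mul_of_nonneg_right (mul_le_mul_of_nonneg_right
    (Finset.single_le_sum (f := C) (fun i _ => hC i) (Finset.mem_univ i)) (γ.s_nonneg x)) h1

namespace Slice

/-- The time derivative of the scale factor at the time of the slice. -/
abbrev a' (x : Slice) : ℝ := dt x.d.T x.d.a x.t

theorem abs_a'_le (x : Slice) : |x.a'| ≤ 1 := x.d.scale.abs_dt_le_one x.ht

theorem lapse_eq (x : Slice) : x.d.n x.t = fun p => 1 + x.r ^ 4 * x.ν p :=
  EinsteinScalar.lapse_eq x.d.scale x.ht

end Slice

theorem crude_n : crude.one.Small 12 fun x => x.d.n x.t := by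
  simp only [Slice.lapse_eq]
  exact (bdd_const 12 1).add (crude_ν.time_mul fun x => x.abs_r_pow_le 4).bdd

theorem rate_K (A B : Fin 3) : ∃ E : Slice → S3 → ℝ, crude.Small 10 E ∧
    ∀ x p, dt x.d.T (fun s => resK x.d.a x.d.k s p A B) x.t = x.r * E x p := by
  set δ := (1 : Matrix (Fin 3) (Fin 3) ℝ) A B with hδ
  -- The right side of `evol_resK` divided by `r`, with a small factor in front of each product as
  -- `Small.mul` expects. The Hessian of `ν` lowers 12 derivatives to 10.
  refine ⟨fun x p => (-x.a') * (x.ν p * x.K p A B) + (1 / 3 * x.a' ^ 2 * δ) * x.ν p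
    - x.r ^ 4 * (∑ C, hess x.G x.ν C B p * x.Gi p A C)
    + (RicSharp x.G p A B - 2 / 9 * δ) * x.d.n x.t p + x.r ^ 4 * (2 / 9 * δ * x.ν p)
    - (∑ C, Zder C (x.d.φ x.t) p * x.Gi p A C) * Zder B (x.d.φ x.t) p * x.d.n x.t p,
    ?_, fun x p => ?_⟩
  · have hν := crude_ν.of_le (show 10 ≤ 12 by norm_num)
    have hK := (crude_K A B).of_le (show 10 ≤ 14 by norm_num)
    have hn := crude_n.of_le (show 10 ≤ 12 by norm_num)
    have hω := fun C => (crude_dT C).of_le (show 10 ≤ 13 by norm_num)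
    have hi := fun A B => (crude_Gi A B).of_le (show 10 ≤ 14 by norm_num)
    have hδ1 : |δ| ≤ 1 := by
      rw [hδ, Matrix.one_apply]
      split_ifs <;> simp
    refine (((((hν.mul hK.bdd).time_mul (K := 1) fun x => ?_).add
      (hν.time_mul (K := 1) fun x => ?_)).sub ((Small.sum fun C _ => (small_hess crude_ν
        (fun A B => (crude_G A B).of_le (by norm_num)) hi C B).mul (hi A C).bdd).time_mul
          fun x => x.abs_r_pow_le 4)).add (Small.mul (near_RicSharp (fun A B =>
            (crude_G A B).of_le (by norm_num)) (fun A B => (crude_Gi A B).of_le (by norm_num))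
              A B) hn)).add ((hν.const_mul (2 / 9 * δ)).time_mul fun x => x.abs_r_pow_le 4) |>.sub
      (((Small.sum fun C _ => (hω C).mul (hi A C).bdd).mul (hω B).bdd).mul hn)
    · rw [abs_neg]
      exact x.abs_a'_le
    · have h1 := x.abs_a'_le
      rw [abs_mul, abs_mul, abs_pow]
      have h2 : |x.a'| ^ 2 ≤ 1 := pow_le_one₀ (abs_nonneg _) h1
      calc |1 / 3| * |x.a'| ^ 2 * |δ| ≤ 1 * 1 * 1 := by
            gcongr
            norm_num [abs_le]
        _ = 1 := by norm_num
  · rw [evol_resK x.d.scale x.d.sol x.ht p A B]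
    have e1 : ∑ C, hess x.G x.ν C B p * x.Gi p A C = ∑ C, x.Gi p A C * hess x.G x.ν C B p :=
      Finset.sum_congr rfl fun C _ => mul_comm _ _
    have e2 : ∑ C, Zder C (x.d.φ x.t) p * x.Gi p A C = ∑ C, x.Gi p A C * Zder C (x.d.φ x.t) p :=
      Finset.sum_congr rfl fun C _ => mul_comm _ _
    beta_reduce
    rw [e1, e2]
    ring

theorem rate_Ψ : ∃ E : Slice → S3 → ℝ, crude.Small 10 E ∧
    ∀ x p, dt x.d.T (fun s => timeScalar x.d.T x.d.a x.d.n x.d.φ s p) x.t = x.r * E x p := by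
  refine ⟨fun x p => (-x.a') * (x.ν p * (x.Ψ p + Real.sqrt (2 / 3)))
    + lap x.G (x.d.φ x.t) p * x.d.n x.t p + x.r ^ 4 * gradInner x.G x.ν (x.d.φ x.t) p,
    ?_, fun x p => ?_⟩
  · have hν := crude_ν.of_le (show 10 ≤ 12 by norm_num)
    have hi := fun A B => (crude_Gi A B).of_le (show 10 ≤ 14 by norm_num)
    refine (((hν.mul ((crude_Ψ.of_le (show 10 ≤ 14 by norm_num)).bdd.add (bdd_const _ _))).time_mul
      (K := 1) fun x => ?_).add ((small_lap_of_small_dT (fun A => (crude_dT A).of_le (by norm_num))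
        (fun A B => (crude_G A B).of_le (by norm_num)) hi).mul
          (crude_n.of_le (by norm_num)))).add ((small_gradInner (fun A =>
            (crude_ν.of_le (show 10 + 1 ≤ 12 by norm_num)).zder A) (fun A =>
              ((crude_dT A).of_le (by norm_num)).bdd) hi).time_mul fun x => x.abs_r_pow_le 4)
    rw [abs_neg]
    exact x.abs_a'_le
  · rw [evol_timeScalar x.d.scale x.d.sol x.ht p]
    ring

theorem lossless_K (A B : Fin 3) : lossless.Small 10 fun x p => x.K p A B := by
  obtain ⟨E, hE, h⟩ := rate_K A B
  refine lossless_of_rate (u := fun d t p => resK d.a d.k t p A B) (C₀ := 7 ^ 14)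
    (fun d => (slabC_resK d.scale d.sol A B).of_le (by norm_num))
    (fun d => ((derivBound_of_highNorm_le ⟨d, 0, d.zero_mem⟩ d.init).1 A B).of_le (by norm_num)) ?_
  simp only [h]
  exact hE.lossless_of_crude

theorem lossless_Ψ : lossless.Small 10 Slice.Ψ := by
  obtain ⟨E, hE, h⟩ := rate_Ψ
  refine lossless_of_rate (u := fun d t p => timeScalar d.T d.a d.n d.φ t p) (C₀ := 7 ^ 14)
    (fun d => (slabC_timeScalar d.scale d.sol).of_le (by norm_num))
    (fun d => ((derivBound_of_highNorm_le ⟨d, 0, d.zero_mem⟩ d.init).2.2.2.2.1).of_le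
      (by norm_num)) ?_
  simp only [h]
  exact hE.lossless_of_crude

/-- `n - 1 = r³ (r ν)`: one factor `r` absorbs the loss in the crude bound of `ν`. -/
theorem lossless_n : lossless.Near 12 (fun x => x.d.n x.t) 1 := by
  have h1 := crude_ν.lossless_of_crude.time_mul fun x => x.abs_r_pow_le 3
  unfold Near
  convert h1 using 3 with x p
  beta_reduce
  rw [x.lapse_eq]
  ring

theorem lossless_metricRate (A B : Fin 3) :
    lossless.Small 10 fun x p => metricRate x.d.T x.d.a x.d.k x.d.n x.t p A B := by
  have h1 := ((lossless_K A B).mul (lossless_n.bdd.of_le (show 10 ≤ 12 by norm_num))).const_mul (-2)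
  have h2 := ((crude_ν.of_le (show 10 ≤ 12 by norm_num)).lossless_of_crude.time_mul
    (b := fun x => x.r ^ 3 * x.a') (K := 1) fun x => by
      rw [abs_mul]
      exact mul_le_one₀ (x.abs_r_pow_le 3) (abs_nonneg _) x.abs_a'_le).const_mul
      (2 / 3 * (1 : Matrix _ _ ℝ) A B)
  convert h1.add h2 using 3 with x p
  simp only [metricRate, Matrix.add_apply, Matrix.smul_apply, smul_eq_mul]
  ring

theorem exists_metricRate_bound : ∃ C : ℝ, 0 ≤ C ∧ ∀ᶠ x in smallParam, ∀ A B,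
    DerivBound 10 (fun p => metricRate x.d.T x.d.a x.d.k x.d.n x.t p A B) (C * x.d.ε) := by
  obtain ⟨C, c, hC, h⟩ := Small.uniform (ι := Fin 3 × Fin 3)
    (f := fun i (x : Slice) p => metricRate x.d.T x.d.a x.d.k x.d.n x.t p i.1 i.2)
    fun i => lossless_metricRate i.1 i.2
  exact ⟨C, hC, h.mono fun x hx A B => (hx (A, B)).mono (by simp [lossless])⟩

theorem derivBound_of_sub_one {N : ℕ} {f : S3 → ℝ} {b : ℝ} {A B : Fin 3}
    (h : DerivBound N (fun p => f p - (1 : Matrix (Fin 3) (Fin 3) ℝ) A B) b) :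
    DerivBound N f (1 + b) := by
  have h1 := h.add (DerivBound.const N ((1 : Matrix (Fin 3) (Fin 3) ℝ) A B))
  simp only [sub_add_cancel] at h1
  refine h1.mono ?_
  have h2 : |(1 : Matrix (Fin 3) (Fin 3) ℝ) A B| ≤ 1 := by
    rw [Matrix.one_apply]
    split_ifs <;> simp
  linarith

/-- The product `G κ` is of size `ε (1 + b)` when `G - 1` is of size `b`. The factor `3 · 2 ^ 10` in
`L` comes from three summands and the Leibniz rule at order 10. -/
theorem sharp_G (A B : Fin 3) :
    sharp.Near 10 (fun x p => x.G p A B) ((1 : Matrix _ _ ℝ) A B) := by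
  obtain ⟨C, hC, hκ⟩ := exists_metricRate_bound
  refine sharp_near_of_linear_rate (ι := Fin 3 × Fin 3)
    (u := fun i d t p => resMetric d.a d.g t p i.1 i.2) (C₀ := 7 ^ 14)
    (c₀ := fun i => (1 : Matrix _ _ ℝ) i.1 i.2) (L := 3 * (2 ^ 10 * C))
    (fun i d => (slabC_resMetric d.scale d.sol i.1 i.2).of_le (by norm_num))
    (fun i d => ((derivBound_of_highNorm_le ⟨d, 0, d.zero_mem⟩ d.init).2.1 i.1 i.2).of_le
      (by norm_num)) (fun i => (crude_G i.1 i.2).of_le (by norm_num)) (by positivity)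
    (hκ.mono fun x hx b hb hu i => ?_) (A, B)
  have h1 : (fun p => dt x.d.T (fun s => resMetric x.d.a x.d.g s p i.1 i.2) x.t) = fun p =>
      (x.d.a x.t)⁻¹ * ∑ D, x.G p i.1 D * metricRate x.d.T x.d.a x.d.k x.d.n x.t p D i.2 := by
    funext p
    rw [evol_resMetric x.d.scale x.d.sol x.ht, Matrix.mul_apply]
  rw [h1]
  refine ((DerivBound.sum (s := Finset.univ) fun D _ =>
    (derivBound_of_sub_one (hu (i.1, D))).mul (hx D i.2)).const_mul _).mono (le_of_eq ?_)
  rw [abs_of_pos (inv_pos.mpr (x.d.scale.pos x.t x.ht))]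
  simp only [Finset.sum_const, Finset.card_univ, Fintype.card_fin, nsmul_eq_mul]
  push_cast
  ring

theorem sharp_Gi (A B : Fin 3) :
    sharp.Near 10 (fun x p => x.Gi p A B) ((1 : Matrix _ _ ℝ) A B) := by
  obtain ⟨C, hC, hκ⟩ := exists_metricRate_bound
  refine sharp_near_of_linear_rate (ι := Fin 3 × Fin 3)
    (u := fun i d t p => resInv d.a d.g t p i.1 i.2) (C₀ := 7 ^ 14)
    (c₀ := fun i => (1 : Matrix _ _ ℝ) i.1 i.2) (L := 3 * (2 ^ 10 * C))
    (fun i d => (slabC_resInv d.scale d.sol i.1 i.2).of_le (by norm_num))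
    (fun i d => ((derivBound_of_highNorm_le ⟨d, 0, d.zero_mem⟩ d.init).2.2.1 i.1 i.2).of_le
      (by norm_num)) (fun i => (crude_Gi i.1 i.2).of_le (by norm_num)) (by positivity)
    (hκ.mono fun x hx b hb hu i => ?_) (A, B)
  have h1 : (fun p => dt x.d.T (fun s => resInv x.d.a x.d.g s p i.1 i.2) x.t) = fun p =>
      -(x.d.a x.t)⁻¹ * ∑ D, metricRate x.d.T x.d.a x.d.k x.d.n x.t p i.1 D * x.Gi p D i.2 := by
    funext p
    rw [evol_resInv x.d.scale x.d.sol x.ht, Matrix.mul_apply, neg_mul]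
  rw [h1]
  refine ((DerivBound.sum (s := Finset.univ) fun D _ =>
    (hx i.1 D).mul (derivBound_of_sub_one (hu (D, i.2)))).const_mul _).mono (le_of_eq ?_)
  rw [abs_neg, abs_of_pos (inv_pos.mpr (x.d.scale.pos x.t x.ht))]
  simp only [Finset.sum_const, Finset.card_univ, Fintype.card_fin, nsmul_eq_mul]
  push_cast
  ring

/-- The rate is `a⁻¹` times the differential of `n (Ψ + √(2/3))`, which is constant up to a lossless
error at order 10. -/
theorem sharp_dT (A : Fin 3) : sharp.Small 9 fun x => Zder A (x.d.φ x.t) := by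
  refine sharp_of_rate (u := fun d t => Zder A (d.φ t)) (C₀ := 7 ^ 14)
    (fun d => (slabC_dT d.sol A).of_le (by norm_num))
    (fun d => ((derivBound_of_highNorm_le ⟨d, 0, d.zero_mem⟩ d.init).2.2.2.2.2 A).of_le
      (by norm_num)) ?_ (fun x p => evol_dT x.d.scale x.d.sol x.ht A p)
  exact (((lossless_n.of_le (show 9 + 1 ≤ 12 by norm_num)).mul
    (lossless_Ψ.near.add (Near.const 10 (Real.sqrt (2 / 3))))).zder A).small

theorem sharp_RicSharp (A B : Fin 3) :
    sharp.Near 8 (fun x p => RicSharp x.G p A B) ((2 / 9) * (1 : Matrix _ _ ℝ) A B) :=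
  near_RicSharp sharp_G sharp_Gi A B

/-- In the elliptic identity `r⁴ Δν` is treated as a source: the crude bound suffices for it, and
the remaining terms are sharp at order 8. -/
theorem sharp_ν : sharp.Small 8 Slice.ν := by
  have hi := fun A B => (sharp_Gi A B).of_le (show 8 ≤ 10 by norm_num)
  have hω := fun A => (sharp_dT A).of_le (show 8 ≤ 9 by norm_num)
  have hlap := (small_lap_of_small_dT (N := 8) (fun A => (crude_ν.of_le
    (show 9 + 1 ≤ 12 by norm_num)).zder A) (fun A B => (crude_G A B).of_le (by norm_num))
      (fun A B => (crude_Gi A B).of_le (by norm_num))).lossless_of_crude.sharp_of_lossless.time_mul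
        fun x => x.abs_r_pow_le 3
  have hR : sharp.Small 8 fun x p => (RicSharp x.G p).trace - 2 / 3 :=
    (Near.sum (s := Finset.univ) fun A _ => sharp_RicSharp A A).congr_const
      (by simp; norm_num)
  have hn : sharp.one.Small 8 fun x => x.d.n x.t := by
    have h1 := (Small.sharp_of_lossless lossless_n).bdd.add (bdd_const 12 1)
    simp only [sub_add_cancel] at h1
    exact h1.of_le (by norm_num)
  -- The coefficient `1 - r⁴/3` is at least `2/3`, hence `K = 3 / 2`.
  have h := (hlap.sub ((hR.sub (small_gradInner hω (fun A => (hω A).bdd) hi)).mul hn)).time_mul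
    (b := fun x => (1 - x.r ^ 4 / 3)⁻¹) (K := 3 / 2) fun x => by
      have h1 : x.r ^ 4 ≤ 1 := pow_le_one₀ x.r_pos.le x.r_le_one
      rw [abs_of_pos (inv_pos.mpr (by linarith)), inv_le_comm₀ (by linarith) (by norm_num)]
      linarith
  convert h using 3 with x p
  have h1 : x.r ^ 4 ≤ 1 := pow_le_one₀ x.r_pos.le x.r_le_one
  have h2 := resLapse_elliptic x.d.scale x.d.sol x.ht p
  rw [eq_inv_mul_iff_mul_eq₀ (by linarith : 1 - x.r ^ 4 / 3 ≠ 0)]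
  refine h2.trans ?_
  ring

/-! ### Norms of tensors which are symmetric with respect to the metric -/

theorem sum_fin_two_arrow (F : Fin 3 → Fin 3 → ℝ) :
    ∑ A : Fin 2 → Fin 3, F (A 0) (A 1) = ∑ a, ∑ b, F a b := by
  rw [← Fintype.sum_prod_type' F]
  exact Fintype.sum_equiv (finTwoArrowEquiv (Fin 3)) _ _ fun _ => rfl

theorem sum_quadratic_eq_trace (P Q S : Matrix (Fin 3) (Fin 3) ℝ) :
    ∑ a, ∑ a', ∑ b, ∑ b', P a a' * Q b b' * S a b * S a' b'
      = (S.transpose * (P * S * Q.transpose)).trace := by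
  simp only [Matrix.trace, Matrix.diag, Matrix.mul_apply, Matrix.transpose_apply, Finset.mul_sum,
    Finset.sum_mul]
  conv_rhs => rw [Finset.sum_comm]
  refine Finset.sum_congr rfl fun a _ => ?_
  rw [Finset.sum_comm]
  refine Finset.sum_congr rfl fun b _ => ?_
  rw [Finset.sum_comm]
  refine Finset.sum_congr rfl fun b' _ => Finset.sum_congr rfl fun a' _ => ?_
  ring

theorem pnorm_mixedT (h k : MatrixField) (p : S3) :
    pnorm h (mixedT k) p
      = Real.sqrt (((k p).transpose * (h p * k p * (h p)⁻¹.transpose)).trace) := by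
  rw [← sum_quadratic_eq_trace]
  simp only [pnorm, mixedT, Fin.prod_univ_one]
  congr 1

theorem pnorm_covT (h S : MatrixField) (p : S3) :
    pnorm h (covT S) p
      = Real.sqrt (((S p).transpose * ((h p)⁻¹ * S p * (h p)⁻¹.transpose)).trace) := by
  rw [← sum_quadratic_eq_trace]
  simp only [pnorm, covT, Fin.prod_univ_two, Finset.univ_unique, Finset.sum_singleton,
    Finset.univ_eq_empty, Finset.prod_empty, one_mul]
  congr 1
  rw [sum_fin_two_arrow (fun a b => ∑ B' : Fin 2 → Fin 3,
    (h p)⁻¹ a (B' 0) * (h p)⁻¹ b (B' 1) * S p a b * S p (B' 0) (B' 1))]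
  refine Finset.sum_congr rfl fun a _ => ?_
  conv_rhs => rw [Finset.sum_comm]
  refine Finset.sum_congr rfl fun b _ => ?_
  exact sum_fin_two_arrow (fun a' b' => (h p)⁻¹ a a' * (h p)⁻¹ b b' * S p a b * S p a' b')

theorem pnorm_contraT (h S : MatrixField) (p : S3) :
    pnorm h (contraT S) p
      = Real.sqrt (((S p).transpose * (h p * S p * (h p).transpose)).trace) := by
  rw [← sum_quadratic_eq_trace]
  simp only [pnorm, contraT, Fin.prod_univ_two, Finset.univ_unique, Finset.sum_singleton,
    Finset.univ_eq_empty, Finset.prod_empty, mul_one]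
  congr 1
  rw [sum_fin_two_arrow (fun a b => ∑ B' : Fin 2 → Fin 3,
    h p a (B' 0) * h p b (B' 1) * S p a b * S p (B' 0) (B' 1))]
  refine Finset.sum_congr rfl fun a _ => ?_
  conv_rhs => rw [Finset.sum_comm]
  refine Finset.sum_congr rfl fun b _ => ?_
  exact sum_fin_two_arrow (fun a' b' => h p a a' * h p b b' * S p a b * S p a' b')

theorem sqrt_trace_sq_le {M : Matrix (Fin 3) (Fin 3) ℝ} {B : ℝ} (hB : 0 ≤ B)
    (h : ∀ a b, |M a b| ≤ B) : Real.sqrt ((M * M).trace) ≤ 3 * B := by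
  refine Real.sqrt_le_iff.mpr ⟨by positivity, ?_⟩
  calc (M * M).trace = ∑ a, ∑ b, M a b * M b a := by
        simp only [Matrix.trace, Matrix.diag, Matrix.mul_apply]
    _ ≤ ∑ _a : Fin 3, ∑ _b : Fin 3, B * B :=
        Finset.sum_le_sum fun a _ => Finset.sum_le_sum fun b _ => by
          refine (le_abs_self _).trans ?_
          rw [abs_mul]
          exact mul_le_mul (h a b) (h b a) (abs_nonneg _) hB
    _ = (3 * B) ^ 2 := by
        simp only [Finset.sum_const, Finset.card_univ, Fintype.card_fin, nsmul_eq_mul]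
        push_cast
        ring

section Symmetric

variable {H M : Matrix (Fin 3) (Fin 3) ℝ}

/-- The hypothesis on `H * M` says that `M` is self-adjoint for `H`; its adjoint in the norm is then
`M` itself, and `H` drops out. -/
theorem trace_mixed_of_symm (hH : H.transpose = H) (hd : IsUnit H.det)
    (hM : (H * M).transpose = H * M) :
    (M.transpose * (H * M * H⁻¹.transpose)).trace = (M * M).trace := by
  rw [Matrix.transpose_nonsing_inv, hH, ← hM, Matrix.transpose_mul, hH, Matrix.mul_assoc,
    Matrix.mul_nonsing_inv _ hd, Matrix.mul_one, ← Matrix.transpose_mul, Matrix.trace_transpose]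

theorem trace_cov_of_symm (hH : H.transpose = H) (hd : IsUnit H.det)
    (hM : (H * M).transpose = H * M) :
    ((H * M).transpose * (H⁻¹ * (H * M) * H⁻¹.transpose)).trace = (M * M).trace := by
  rw [Matrix.transpose_nonsing_inv, hH, hM, ← Matrix.mul_assoc H⁻¹, Matrix.nonsing_inv_mul _ hd,
    Matrix.one_mul, ← Matrix.mul_assoc, Matrix.trace_mul_comm, ← Matrix.mul_assoc,
    ← Matrix.mul_assoc, Matrix.nonsing_inv_mul _ hd, Matrix.one_mul]

theorem trace_contra_of_symm (hH : H.transpose = H) (hd : IsUnit H.det)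
    (hM : (H * M).transpose = H * M) :
    ((M * H⁻¹).transpose * (H * (M * H⁻¹) * H.transpose)).trace = (M * M).trace := by
  have h1 : (M * H⁻¹).transpose = M * H⁻¹ := by
    have h2 : M.transpose * H = H * M := by
      rw [← hM, Matrix.transpose_mul, hH]
    rw [Matrix.transpose_mul, Matrix.transpose_nonsing_inv, hH]
    calc H⁻¹ * M.transpose = H⁻¹ * (M.transpose * H) * H⁻¹ := by
          rw [Matrix.mul_assoc, Matrix.mul_assoc, Matrix.mul_nonsing_inv _ hd, Matrix.mul_one]
      _ = M * H⁻¹ := by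
          rw [h2, ← Matrix.mul_assoc, Matrix.nonsing_inv_mul _ hd, Matrix.one_mul]
  rw [h1, hH, Matrix.mul_assoc H, Matrix.mul_assoc M H⁻¹ H, Matrix.nonsing_inv_mul _ hd,
    Matrix.mul_one, Matrix.mul_assoc, ← Matrix.mul_assoc H⁻¹, Matrix.nonsing_inv_mul _ hd,
    Matrix.one_mul]

end Symmetric

namespace Slice

variable (x : Slice)

theorem G_symm (p : S3) : (x.G p).transpose = x.G p := by
  have h := (x.d.sol.metric x.t x.ht p).1
  ext A B
  have h1 := h.apply A B
  simp only [star_trivial] at h1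
  simp [Slice.G, resMetric, h1]

theorem isUnit_det (p : S3) : IsUnit (x.G p).det :=
  isUnit_det_resMetric x.d.scale x.d.sol x.ht p

/-- The logarithmic rate of change of the metric of the slice, multiplied by the scale factor. -/
abbrev κ : MatrixField := metricRate x.d.T x.d.a x.d.k x.d.n x.t

theorem G_mul_κ_symm (p : S3) : (x.G p * x.κ p).transpose = x.G p * x.κ p := by
  have h := resMetric_mul_resK_symm x.d.sol x.ht p
  simp only [κ, metricRate, Matrix.mul_add, Matrix.mul_smul, Matrix.mul_one,
    Matrix.transpose_add, Matrix.transpose_smul]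
  rw [h, x.G_symm p]

theorem pnorm_K_le {B : ℝ} (hB : 0 ≤ B) {p : S3} (h : ∀ a b, |x.K p a b| ≤ B) :
    pnorm x.G (mixedT x.K) p ≤ 3 * B := by
  rw [pnorm_mixedT, trace_mixed_of_symm (x.G_symm p) (x.isUnit_det p)
    (resMetric_mul_resK_symm x.d.sol x.ht p)]
  exact sqrt_trace_sq_le hB h

theorem abs_smul_κ_le {B : ℝ} {p : S3} (h : ∀ a b, |x.κ p a b| ≤ B) {b : ℝ}
    (hb : |b| = (x.d.a x.t)⁻¹) (i j : Fin 3) : |(b • x.κ p) i j| ≤ B * (x.d.a x.t)⁻¹ := by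
  rw [Matrix.smul_apply, smul_eq_mul, abs_mul, hb, mul_comm]
  exact mul_le_mul_of_nonneg_right (h i j) (inv_nonneg.mpr (x.d.scale.pos x.t x.ht).le)

theorem symm_smul_κ (b : ℝ) (p : S3) :
    (x.G p * (b • x.κ p)).transpose = x.G p * (b • x.κ p) := by
  rw [Matrix.mul_smul, Matrix.transpose_smul, x.G_mul_κ_symm p]

/-- With one index raised, `∂ₜG = a⁻¹ G κ` becomes the self-adjoint endomorphism `a⁻¹ κ`, so no
bound on `G` is spent. -/
theorem pnorm_dt_G_le {B : ℝ} (hB : 0 ≤ B) {p : S3} (h : ∀ a b, |x.κ p a b| ≤ B) :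
    pnorm x.G (timeDeriv x.d.T (fun s => covT (resMetric x.d.a x.d.g s)) x.t) p
      ≤ 3 * (B * (x.d.a x.t)⁻¹) := by
  have ha := x.d.scale.pos x.t x.ht
  have h1 : timeDeriv x.d.T (fun s => covT (resMetric x.d.a x.d.g s)) x.t
      = covT (fun p => x.G p * ((x.d.a x.t)⁻¹ • x.κ p)) := by
    funext I J q
    refine (evol_resMetric x.d.scale x.d.sol x.ht q (J 0) (J 1)).trans ?_
    rw [covT, Matrix.mul_smul]
    rfl
  rw [h1, pnorm_covT, trace_cov_of_symm (x.G_symm p) (x.isUnit_det p) (x.symm_smul_κ _ p)]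
  exact sqrt_trace_sq_le (by positivity)
    (x.abs_smul_κ_le h (abs_of_pos (inv_pos.mpr ha)))

theorem pnorm_dt_Gi_le {B : ℝ} (hB : 0 ≤ B) {p : S3} (h : ∀ a b, |x.κ p a b| ≤ B) :
    pnorm x.G (timeDeriv x.d.T (fun s => contraT (resInv x.d.a x.d.g s)) x.t) p
      ≤ 3 * (B * (x.d.a x.t)⁻¹) := by
  have ha := x.d.scale.pos x.t x.ht
  have h1 : timeDeriv x.d.T (fun s => contraT (resInv x.d.a x.d.g s)) x.t
      = contraT (fun p => ((-(x.d.a x.t)⁻¹) • x.κ p) * (x.G p)⁻¹) := by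
    funext I J q
    refine (evol_resInv x.d.scale x.d.sol x.ht q (I 0) (I 1)).trans ?_
    rw [contraT, Matrix.smul_mul, ← neg_mul]
    rfl
  rw [h1, pnorm_contraT, trace_contra_of_symm (x.G_symm p) (x.isUnit_det p) (x.symm_smul_κ _ p)]
  exact sqrt_trace_sq_le (by positivity)
    (x.abs_smul_κ_le h (by rw [abs_neg, abs_of_pos (inv_pos.mpr ha)]))

end Slice

/-! ### Bounds of the sup-norms -/

/-- Measuring with `G` costs one bound on `G` or `G⁻¹` per index. This only raises the power of `ρ`,
which is left free. -/
theorem exists_sumSup_le {γ : Gauge Slice} (hG : ∀ A B, γ.one.Small 0 fun x p => x.G p A B)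
    (hi : ∀ A B, γ.one.Small 0 fun x p => x.Gi p A B) {l m M : ℕ} {ξ : Slice → Tensor l m}
    (hξ : ∀ I J, γ.Small M fun x => ξ x I J) {s : Finset ℕ} (hs : ∀ N ∈ s, N ≤ M) :
    ∃ (C : ℝ) (c : ℕ), 0 ≤ C ∧ ∀ᶠ x in γ.l, sumSup x.G s (ξ x) ≤ C * γ.s x * γ.ρ x ^ c := by
  obtain ⟨C₁, c₁, hC₁, h₁⟩ := Small.uniform (ι := Fin 3 × Fin 3)
    (f := fun i (x : Slice) p => x.G p i.1 i.2) fun i => hG i.1 i.2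
  obtain ⟨C₂, c₂, hC₂, h₂⟩ := Small.uniform (ι := Fin 3 × Fin 3)
    (f := fun i (x : Slice) p => x.Gi p i.1 i.2) fun i => hi i.1 i.2
  obtain ⟨C₃, c₃, hC₃, h₃⟩ := Small.uniform (ι := (Fin l → Fin 3) × (Fin m → Fin 3))
    (f := fun i x => ξ x i.1 i.2) fun i => hξ i.1 i.2
  refine ⟨sumFactor l m s * ((1 + C₁ + C₂) ^ (l + m) * C₃), (c₁ + c₂) * (l + m) + c₃,
    mul_nonneg (sumFactor_nonneg l m s) (by positivity), ?_⟩
  filter_upwards [h₁, h₂, h₃] with x hx₁ hx₂ hx₃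
  have hρ := γ.one_le_ρ x
  have hρ0 := zero_le_one.trans hρ
  have e1 : γ.ρ x ^ c₁ ≤ γ.ρ x ^ (c₁ + c₂) := pow_le_pow_right₀ hρ (by omega)
  have e2 : γ.ρ x ^ c₂ ≤ γ.ρ x ^ (c₁ + c₂) := pow_le_pow_right₀ hρ (by omega)
  have e3 : 1 ≤ γ.ρ x ^ (c₁ + c₂) := one_le_pow₀ hρ
  have h := sumSup_le (h := x.G) (H := (1 + C₁ + C₂) * γ.ρ x ^ (c₁ + c₂))
    (B := C₃ * γ.s x * γ.ρ x ^ c₃) (s := s) (M := M) (ξ := ξ x) ?_ (fun p A B => ?_)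
    (fun p A B => ?_) hs fun I J => hx₃ (I, J)
  · refine h.trans (le_of_eq ?_)
    rw [mul_pow, ← pow_mul, pow_add]
    ring
  · have h4 := mul_nonneg (add_nonneg hC₁ hC₂) (zero_le_one.trans e3)
    linarith
  · refine ((hx₁ (A, B)).abs_le p).trans ?_
    simp only [one, mul_one]
    change C₁ * γ.ρ x ^ c₁ ≤ _
    have h4 := mul_le_mul_of_nonneg_left e1 hC₁
    have h5 := mul_nonneg hC₂ (zero_le_one.trans e3)
    linarith
  · refine ((hx₂ (A, B)).abs_le p).trans ?_
    simp only [one, mul_one]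
    change C₂ * γ.ρ x ^ c₂ ≤ _
    have h4 := mul_le_mul_of_nonneg_left e2 hC₂
    have h5 := mul_nonneg hC₁ (zero_le_one.trans e3)
    linarith

theorem abs_St_le (p : S3) (A B : Fin 3) : |St p A B| ≤ 1 := by
  rw [St, Matrix.one_apply]
  split_ifs <;> simp

theorem abs_St_inv_le (p : S3) (A B : Fin 3) : |(St p)⁻¹ A B| ≤ 1 := by
  have h := abs_St_le p A B
  rw [St] at h ⊢
  rwa [inv_one]

theorem exists_sumSup_St_le {γ : Gauge Slice} {l m M : ℕ} {ξ : Slice → Tensor l m}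
    (hξ : ∀ I J, γ.Small M fun x => ξ x I J) {s : Finset ℕ} (hs : ∀ N ∈ s, N ≤ M) :
    ∃ (C : ℝ) (c : ℕ), 0 ≤ C ∧ ∀ᶠ x in γ.l, sumSup St s (ξ x) ≤ C * γ.s x * γ.ρ x ^ c := by
  obtain ⟨C, c, hC, h⟩ := Small.uniform (ι := (Fin l → Fin 3) × (Fin m → Fin 3))
    (f := fun i x => ξ x i.1 i.2) fun i => hξ i.1 i.2
  refine ⟨sumFactor l m s * C, c, mul_nonneg (sumFactor_nonneg l m s) hC, ?_⟩
  filter_upwards [h] with x hx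
  refine (sumSup_le (M := M) le_rfl abs_St_le abs_St_inv_le hs fun I J => hx (I, J)).trans
    (le_of_eq ?_)
  rw [one_pow]
  ring

theorem exists_sumSupDt_le {l m : ℕ} {u : Datum → ℝ → Tensor l m}
    (hu : ∀ d I J, SlabC 11 d.T (fun t => u d t I J))
    (h : ∀ I J, ∃ E : Slice → S3 → ℝ, crude.Small 10 E ∧
      ∀ x p, dt x.d.T (fun s => u x.d s I J p) x.t = x.r * E x p) {s : Finset ℕ}
    (hs : ∀ N ∈ s, N ≤ 10) :
    ∃ (C : ℝ) (c : ℕ), 0 ≤ C ∧ ∀ᶠ x in smallParam, sumSupDt x.d.T St s (u x.d) x.t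
      ≤ C * x.d.ε * (x.r * Real.exp (x.d.σ * x.τ) ^ c) := by
  choose E hE h using h
  obtain ⟨C, c, hC, hE⟩ := Small.uniform (ι := (Fin l → Fin 3) × (Fin m → Fin 3))
    (f := fun i x => E i.1 i.2 x) fun i => hE i.1 i.2
  refine ⟨sumFactor l m s * C, c, mul_nonneg (sumFactor_nonneg l m s) hC, ?_⟩
  filter_upwards [hE] with x hx
  refine (sumSupDt_le (M := 10) (B := x.r * (C * x.d.ε * Real.exp (x.d.σ * x.τ) ^ c)) (hu x.d)
    x.ht hs fun I J => ?_).trans (le_of_eq (by ring))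
  have h1 : timeDeriv x.d.T (u x.d) x.t I J = fun p => x.r * E I J x p := by
    funext p
    exact h I J x p
  rw [h1]
  have h2 := (hx (I, J)).const_mul x.r
  rwa [abs_of_pos x.r_pos] at h2

/-! ### Conversion to powers of the scale factor -/

/-- Since `a ≤ 1`, the bound weakens as `K` grows, both as a prefactor and in the exponent.
Quantifying over large `K` lets several estimates share one constant. -/
theorem eventually_le_rpow {f s : Slice → ℝ} (hs : ∀ x, 0 ≤ s x)
    (h : ∃ (C : ℝ) (c : ℕ), 0 ≤ C ∧ ∀ᶠ x in smallParam,
      f x ≤ C * s x * Real.exp (Real.sqrt x.d.ε * x.τ) ^ c) :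
    ∀ᶠ K : ℝ in atTop, ∀ᶠ x in smallParam,
      f x ≤ K * s x * x.d.a x.t ^ (-K * Real.sqrt x.d.ε) := by
  obtain ⟨C, c, hC, h⟩ := h
  filter_upwards [eventually_ge_atTop (c : ℝ), eventually_ge_atTop (C * Real.exp (2 * c)),
    eventually_ge_atTop 0] with K hc hCK hK
  filter_upwards [h] with x hx
  have hη := x.d.sqrt_pos
  have hη1 := x.d.sqrt_le_one
  have h1 := x.d.scale.exp_mul_logTime_le x.ht (mul_nonneg (Nat.cast_nonneg c) hη.le)
  have h2 : Real.exp (2 * (c * Real.sqrt x.d.ε)) ≤ Real.exp (2 * c) :=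
    Real.exp_le_exp.mpr (by
      have : (0 : ℝ) ≤ c := Nat.cast_nonneg c
      nlinarith)
  have h3 : x.d.a x.t ^ (-(c * Real.sqrt x.d.ε)) ≤ x.d.a x.t ^ (-K * Real.sqrt x.d.ε) :=
    Real.rpow_le_rpow_of_exponent_ge (x.d.scale.pos x.t x.ht) (x.d.scale.le_one x.ht) (by
      nlinarith)
  rw [← Real.exp_nat_mul, ← mul_assoc] at hx
  have h4 := Real.rpow_nonneg (x.d.scale.pos x.t x.ht).le (-(c * Real.sqrt x.d.ε))
  have h5 := hs x
  calc f x ≤ C * s x * Real.exp (c * Real.sqrt x.d.ε * x.τ) := hx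
    _ ≤ C * s x * (Real.exp (2 * c) * x.d.a x.t ^ (-K * Real.sqrt x.d.ε)) := by
        refine mul_le_mul_of_nonneg_left (h1.trans ?_) (by positivity)
        exact mul_le_mul h2 h3 h4 (Real.exp_pos _).le
    _ = C * Real.exp (2 * c) * s x * x.d.a x.t ^ (-K * Real.sqrt x.d.ε) := by ring
    _ ≤ _ := by
        have h6 := h4.trans h3
        gcongr

theorem eventually_le_mul {f s : Slice → ℝ} (hs : ∀ x, 0 ≤ s x)
    (h : ∃ C : ℝ, ∀ᶠ x in smallParam, f x ≤ C * s x) :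
    ∀ᶠ K : ℝ in atTop, ∀ᶠ x in smallParam, f x ≤ K * s x := by
  obtain ⟨C, h⟩ := h
  filter_upwards [eventually_ge_atTop C] with K hK
  filter_upwards [h] with x hx
  exact hx.trans (mul_le_mul_of_nonneg_right hK (hs x))

theorem eventually_le_rpow_third {f : Slice → ℝ}
    (h : ∃ (C : ℝ) (c : ℕ), 0 ≤ C ∧ ∀ᶠ x in smallParam,
      f x ≤ C * x.d.ε * (x.r * Real.exp (x.d.σ * x.τ) ^ c)) :
    ∀ᶠ K : ℝ in atTop, ∀ᶠ x in smallParam,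
      f x ≤ K * x.d.ε * x.d.a x.t ^ (1 / 3 - K * x.d.σ) := by
  obtain ⟨C, c, hC, h⟩ := h
  filter_upwards [eventually_ge_atTop (c : ℝ), eventually_ge_atTop (C * Real.exp (2 * c)),
    eventually_ge_atTop 0] with K hc hCK hK
  filter_upwards [h] with x hx
  have hσ := x.d.σ_pos
  have hσ1 := x.d.σ_le_one
  have ha := x.d.scale.pos x.t x.ht
  have h1 := x.d.scale.exp_mul_logTime_le x.ht (mul_nonneg (Nat.cast_nonneg c) hσ.le)
  have h2 : Real.exp (2 * (c * x.d.σ)) ≤ Real.exp (2 * c) :=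
    Real.exp_le_exp.mpr (by
      have : (0 : ℝ) ≤ c := Nat.cast_nonneg c
      nlinarith)
  have h3 : x.d.a x.t ^ (-(c * x.d.σ)) ≤ x.d.a x.t ^ (-(K * x.d.σ)) :=
    Real.rpow_le_rpow_of_exponent_ge ha (x.d.scale.le_one x.ht) (by nlinarith)
  have h4 : x.r * x.d.a x.t ^ (-(K * x.d.σ)) = x.d.a x.t ^ (1 / 3 - K * x.d.σ) := by
    rw [sub_eq_add_neg, Real.rpow_add ha]
    rfl
  rw [← Real.exp_nat_mul, ← mul_assoc (c : ℝ)] at hx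
  have h5 := Real.rpow_nonneg ha.le (-(c * x.d.σ))
  have h6 := x.d.ε_pos
  have h7 := x.r_pos
  calc f x ≤ C * x.d.ε * (x.r * Real.exp (c * x.d.σ * x.τ)) := hx
    _ ≤ C * x.d.ε * (x.r * (Real.exp (2 * c) * x.d.a x.t ^ (-(K * x.d.σ)))) := by
        refine mul_le_mul_of_nonneg_left (mul_le_mul_of_nonneg_left (h1.trans ?_) h7.le)
          (by positivity)
        exact mul_le_mul h2 h3 h5 (Real.exp_pos _).le
    _ = C * Real.exp (2 * c) * x.d.ε * (x.r * x.d.a x.t ^ (-(K * x.d.σ))) := by ring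
    _ ≤ K * x.d.ε * (x.r * x.d.a x.t ^ (-(K * x.d.σ))) := by
        have h8 := h5.trans h3
        gcongr
    _ = _ := by rw [h4]

/-! ### The strong sup-norm estimates -/

theorem sharp_one_G (A B : Fin 3) : sharp.one.Small 0 fun x p => x.G p A B :=
  (sharp_G A B).bdd.of_le (Nat.zero_le _)

theorem sharp_one_Gi (A B : Fin 3) : sharp.one.Small 0 fun x p => x.Gi p A B :=
  (sharp_Gi A B).bdd.of_le (Nat.zero_le _)

theorem sqrt_ε_nonneg (x : Slice) : 0 ≤ Real.sqrt x.d.ε := x.d.sqrt_pos.le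

theorem ε_nonneg (x : Slice) : 0 ≤ x.d.ε := x.d.ε_pos.le

theorem le_of_mem_Icc_zero {M : ℕ} : ∀ N ∈ Finset.Icc 0 M, N ≤ M := fun _ hN =>
  (Finset.mem_Icc.mp hN).2

theorem eventually_lossless {f : Slice → ℝ} (h : ∃ (C : ℝ) (c : ℕ), 0 ≤ C ∧
    ∀ᶠ x in smallParam, f x ≤ C * x.d.ε * 1 ^ c) :
    ∀ᶠ K : ℝ in atTop, ∀ᶠ x in smallParam, f x ≤ K * x.d.ε := by
  obtain ⟨C, c, -, h⟩ := h
  exact eventually_le_mul ε_nonneg ⟨C, by simpa using h⟩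

theorem exists_κ_bound : ∃ C : ℝ, 0 ≤ C ∧ ∀ᶠ x : Slice in smallParam, ∀ p A B,
    |x.κ p A B| ≤ C * x.d.ε := by
  obtain ⟨C, hC, h⟩ := exists_metricRate_bound
  exact ⟨C, hC, h.mono fun x hx p A B => (hx A B).abs_le p⟩

theorem eventually_supNorm_K : ∀ᶠ K : ℝ in atTop, ∀ᶠ x in smallParam,
    supNorm x.G (mixedT x.K) ≤ K * x.d.ε := by
  obtain ⟨C, c, hC, h⟩ := Small.uniform (ι := Fin 3 × Fin 3)
    (f := fun i (x : Slice) p => x.K p i.1 i.2) fun i => lossless_K i.1 i.2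
  refine eventually_le_mul ε_nonneg ⟨3 * C, h.mono fun x hx => ?_⟩
  have : Nonempty S3 := ⟨radial 0⟩
  refine ciSup_le fun p => (x.pnorm_K_le (B := C * x.d.ε) (mul_nonneg hC x.d.ε_pos.le)
    fun a b => ?_).trans (le_of_eq (by ring))
  simpa [lossless] using (hx (a, b)).abs_le p

theorem eventually_supNorm_dt_G : ∀ᶠ K : ℝ in atTop, ∀ᶠ x in smallParam,
    supNorm x.G (timeDeriv x.d.T (fun s => covT (resMetric x.d.a x.d.g s)) x.t)
      ≤ K * x.d.ε * x.d.a x.t ^ (-1 : ℝ) := by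
  obtain ⟨C, hC, h⟩ := exists_κ_bound
  simp only [mul_assoc]
  refine eventually_le_mul (fun x => mul_nonneg x.d.ε_pos.le
    (Real.rpow_nonneg (x.d.scale.pos x.t x.ht).le _)) ⟨3 * C, h.mono fun x hx => ?_⟩
  have : Nonempty S3 := ⟨radial 0⟩
  refine ciSup_le fun p => (x.pnorm_dt_G_le (mul_nonneg hC x.d.ε_pos.le) (hx p)).trans
    (le_of_eq ?_)
  rw [Real.rpow_neg_one]
  ring

theorem eventually_supNorm_dt_Gi : ∀ᶠ K : ℝ in atTop, ∀ᶠ x in smallParam,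
    supNorm x.G (timeDeriv x.d.T (fun s => contraT (resInv x.d.a x.d.g s)) x.t)
      ≤ K * x.d.ε * x.d.a x.t ^ (-1 : ℝ) := by
  obtain ⟨C, hC, h⟩ := exists_κ_bound
  simp only [mul_assoc]
  refine eventually_le_mul (fun x => mul_nonneg x.d.ε_pos.le
    (Real.rpow_nonneg (x.d.scale.pos x.t x.ht).le _)) ⟨3 * C, h.mono fun x hx => ?_⟩
  have : Nonempty S3 := ⟨radial 0⟩
  refine ciSup_le fun p => (x.pnorm_dt_Gi_le (mul_nonneg hC x.d.ε_pos.le) (hx p)).trans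
    (le_of_eq ?_)
  rw [Real.rpow_neg_one]
  ring

end
end EinsteinScalar

/-! ### Choice of the constants and conclusion. -/

theorem proposition14p3 :
    ∃ ε₀ σ₀ C c : ℝ, 0 < ε₀ ∧ 0 < σ₀ ∧ 0 < C ∧ 0 < c ∧
      ∀ (ε σ T : ℝ) (a : ℝ → ℝ) (g k : ℝ → MatrixField) (n φ : ℝ → S3 → ℝ),
        0 < ε → ε ≤ ε₀ → Real.sqrt ε ≤ σ → σ ≤ σ₀ → 0 < T →
        IsScaleFactor T a →
        IsSolution T a g k n φ →
        highNorm T a g k n φ 0 ≤ ε ^ 2 →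
        (∀ t ∈ Set.Ico 0 T, highNorm T a g k n φ t ≤ ε * a t ^ (-σ)) →
        ∀ t ∈ Set.Ico 0 T,
          sumSup St (Finset.Icc 0 10) (covT (resMetric a g t - St))
            ≤ C * Real.sqrt ε * a t ^ (-c * Real.sqrt ε) ∧
          sumSup St (Finset.Icc 0 10) (contraT (resInv a g t - St))
            ≤ C * Real.sqrt ε * a t ^ (-c * Real.sqrt ε) ∧
          sumSup (resMetric a g t) (Finset.Icc 0 10) (covT (resMetric a g t - St))
            ≤ C * Real.sqrt ε * a t ^ (-c * Real.sqrt ε) ∧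
          sumSup (resMetric a g t) (Finset.Icc 0 10) (contraT (resInv a g t - St))
            ≤ C * Real.sqrt ε * a t ^ (-c * Real.sqrt ε) ∧
          supNorm (resMetric a g t) (timeDeriv T (fun s => covT (resMetric a g s)) t)
            ≤ C * ε * a t ^ (-1 : ℝ) ∧
          supNorm (resMetric a g t) (timeDeriv T (fun s => contraT (resInv a g s)) t)
            ≤ C * ε * a t ^ (-1 : ℝ) ∧
          sumSup St (Finset.Icc 0 10) (mixedT (resK a k t)) ≤ C * ε ∧
          sumSupDt T St (Finset.Icc 0 10) (fun s => mixedT (resK a k s)) t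
            ≤ C * ε * a t ^ (1 / 3 - c * σ) ∧
          supNorm (resMetric a g t) (mixedT (resK a k t)) ≤ C * ε ∧
          sumSup (resMetric a g t) (Finset.Icc 1 10) (mixedT (resK a k t))
            ≤ C * ε * a t ^ (-c * Real.sqrt ε) ∧
          sumSup St (Finset.Icc 0 10) (scalarT (timeScalar T a n φ t)) ≤ C * ε ∧
          sumSupDt T St (Finset.Icc 0 10) (fun s => scalarT (timeScalar T a n φ s)) t
            ≤ C * ε * a t ^ (1 / 3 - c * σ) ∧
          sumSup (resMetric a g t) (Finset.Icc 0 9) (dT (φ t))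
            ≤ C * Real.sqrt ε * a t ^ (-c * Real.sqrt ε) ∧
          sumSup St (Finset.Icc 0 8) (scalarT (resLapse a n t))
            ≤ C * Real.sqrt ε * a t ^ (-c * Real.sqrt ε) ∧
          sumSup (resMetric a g t) (Finset.Icc 0 8)
              (mixedT (fun p => RicSharp (resMetric a g t) p - (2 / 9 : ℝ) • 1))
            ≤ C * Real.sqrt ε * a t ^ (-c * Real.sqrt ε) := by
  have h1 := eventually_le_rpow sqrt_ε_nonneg (exists_sumSup_St_le (γ := sharp)
    (ξ := fun x => covT (x.G - St)) (fun I J => sharp_G (J 0) (J 1)) le_of_mem_Icc_zero)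
  have h2 := eventually_le_rpow sqrt_ε_nonneg (exists_sumSup_St_le (γ := sharp)
    (ξ := fun x => contraT (x.Gi - St)) (fun I J => sharp_Gi (I 0) (I 1)) le_of_mem_Icc_zero)
  have h3 := eventually_le_rpow sqrt_ε_nonneg (exists_sumSup_le sharp_one_G sharp_one_Gi
    (ξ := fun x => covT (x.G - St)) (fun I J => sharp_G (J 0) (J 1)) le_of_mem_Icc_zero)
  have h4 := eventually_le_rpow sqrt_ε_nonneg (exists_sumSup_le sharp_one_G sharp_one_Gi
    (ξ := fun x => contraT (x.Gi - St)) (fun I J => sharp_Gi (I 0) (I 1)) le_of_mem_Icc_zero)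
  have h7 := eventually_lossless (exists_sumSup_St_le (γ := lossless)
    (ξ := fun x => mixedT x.K) (fun I J => lossless_K (I 0) (J 0)) le_of_mem_Icc_zero)
  have h8 := eventually_le_rpow_third (exists_sumSupDt_le
    (u := fun d s => mixedT (resK d.a d.k s))
    (fun d I J => (slabC_resK d.scale d.sol (I 0) (J 0)).of_le (by norm_num))
    (fun I J => rate_K (I 0) (J 0)) le_of_mem_Icc_zero)
  have h10 := eventually_le_rpow ε_nonneg (exists_sumSup_le (γ := sharpSmall)
    sharp_one_G sharp_one_Gi (ξ := fun x => mixedT x.K) (s := Finset.Icc 1 10)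
    (fun I J => (lossless_K (I 0) (J 0)).sharpSmall_of_lossless)
    fun N hN => (Finset.mem_Icc.mp hN).2)
  have h11 := eventually_lossless (exists_sumSup_St_le (γ := lossless)
    (ξ := fun x => scalarT x.Ψ) (fun I J => lossless_Ψ) le_of_mem_Icc_zero)
  have h12 := eventually_le_rpow_third (exists_sumSupDt_le
    (u := fun d s => scalarT (timeScalar d.T d.a d.n d.φ s))
    (fun d I J => (slabC_timeScalar d.scale d.sol).of_le (by norm_num))
    (fun I J => rate_Ψ) le_of_mem_Icc_zero)
  have h13 := eventually_le_rpow sqrt_ε_nonneg (exists_sumSup_le sharp_one_G sharp_one_Gi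
    (ξ := fun x => dT (x.d.φ x.t)) (fun I J => sharp_dT (J 0)) le_of_mem_Icc_zero)
  have h14 := eventually_le_rpow sqrt_ε_nonneg (exists_sumSup_St_le (γ := sharp)
    (ξ := fun x => scalarT x.ν) (fun I J => sharp_ν) le_of_mem_Icc_zero)
  have h15 := eventually_le_rpow sqrt_ε_nonneg (exists_sumSup_le sharp_one_G sharp_one_Gi
    (ξ := fun x => mixedT (fun p => RicSharp x.G p - (2 / 9 : ℝ) • 1))
    (fun I J => sharp_RicSharp (I 0) (J 0)) le_of_mem_Icc_zero)
  -- One `K` serves as `C` and as `c` in all fifteen estimates.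
  obtain ⟨K, hK, h1, h2, h3, h4, h5, h6, h7, h8, h9, h10, h11, h12, h13, h14, h15⟩ :=
    ((Filter.eventually_gt_atTop (0 : ℝ)).and (h1.and (h2.and (h3.and (h4.and
      (eventually_supNorm_dt_G.and (eventually_supNorm_dt_Gi.and (h7.and (h8.and
        (eventually_supNorm_K.and (h10.and (h11.and (h12.and (h13.and
          (h14.and h15))))))))))))))).exists
  obtain ⟨δ, hδ, h⟩ := eventually_smallParam.mp (h1.and (h2.and (h3.and (h4.and (h5.and (h6.and
    (h7.and (h8.and (h9.and (h10.and (h11.and (h12.and (h13.and (h14.and h15))))))))))))))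
  -- `σ₀ ≤ 1` is required by `Datum`, and `δ / 2` gives the strict inequality `σ < δ`. Smallness of
  -- `ε` comes from `√ε ≤ σ`.
  refine ⟨1, min 1 (δ / 2), K, K, one_pos, by positivity, hK, hK, ?_⟩
  intro ε σ T a g k n φ hε _ hεσ hσ hT ha hsol h0 hN t ht
  exact h ⟨⟨ε, σ, T, a, g, k, n, φ, hε, hεσ, hσ.trans (min_le_left _ _), hT, ha, hsol, h0, hN⟩,
    t, ht⟩ (lt_of_le_of_lt (hσ.trans (min_le_right _ _)) (half_lt_self hδ))
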